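/- Let $X$ be a $C^\infty$-manifold, a complex manifold, or a smooth variety over $\mathbb{C}$, with structure sheaf $\mathcal{O}_X$ (complex valued $C^\infty$-functions, holomorphic functions, or regular functions), and let $X^\sharp$ be the differential graded manifold with underlying space $X$ and structure sheaf the de Rham complex $\mathcal{O}_{X^\sharp}=(\Omega_X^\bullet,d)$, a sheaf of commutative DG $\mathbb{C}$-algebras. Let $\mathcal{T}_{X^\sharp}$ be the DG $\mathcal{O}_{X^\sharp}$-module of graded derivations of $\mathcal{O}_{X^\sharp}$ (with the graded commutator as bracket and $D\mapsto[d,D]$ as differential), and let $\Omega^1_{X^\sharp}$ be its graded $\mathcal{O}_{X^\sharp}$-dual, with the universal derivation $f\mapsto df$, $(df)(D)=(-1)^{|D||f|}D(f)$. A *Courant $\mathcal{O}_{X^\sharp}$-algebroid* is a sheaf of DG $\mathcal{O}_{X^\sharp}$-modules $\mathcal{Q}$ with $\mathbb{C}$-linear maps of degree $0$, compatible with the differentials: a bracket $[\ ,\ ]:\mathcal{Q}\otimes_{\mathbb{C}}\mathcal{Q}\to\mathcal{Q}$ with $[a,[b,c]]=[[a,b],c]+(-1)^{|a||b|}[b,[a,c]]$;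 an $\mathcal{O}_{X^\sharp}$-linear, bracket-preserving anchor $\pi:\mathcal{Q}\to\mathcal{T}_{X^\sharp}$; a (graded) symmetric $\mathcal{O}_{X^\sharp}$-bilinear pairing $\langle\ ,\ \rangle:\mathcal{Q}\otimes\mathcal{Q}\to\mathcal{O}_{X^\sharp}$; and a derivation $\partial:\mathcal{O}_{X^\sharp}\to\mathcal{Q}$, i.e. the composition of $f\mapsto df$ with an $\mathcal{O}_{X^\sharp}$-linear map $\Omega^1_{X^\sharp}\to\mathcal{Q}$; such that, for local sections $f$ of $\mathcal{O}_{X^\sharp}$ and $q,q_1,q_2$ of $\mathcal{Q}$, $$\pi\circ\partial=0,\qquad [q_1,fq_2]=\pi(q_1)(f)\,q_2+(-1)^{|q_1||f|}f[q_1,q_2],$$ $$\langle[q,q_1],q_2\rangle+(-1)^{|q||q_1|}\langle q_1,[q,q_2]\rangle=\pi(q)(\langle q_1,q_2\rangle),$$ $$[q,\partial(f)]=\partial(\pi(q)(f)),\qquad \langle q,\partial(f)\rangle=\pi(q)(f),\qquad [q_1,q_2]+(-1)^{|q_1||q_2|}[q_2,q_1]=\partial(\langle q_1,q_2\rangle).$$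 It is *exact* if the map $\mathcal{Q}/\Omega_{\mathcal{Q}}\to\mathcal{T}_{X^\sharp}$ induced by $\pi$ is an isomorphism, where $\Omega_{\mathcal{Q}}\subset\mathcal{Q}$ is the $\mathcal{O}_{X^\sharp}$-submodule generated by the image of $\partial$. Morphisms of Courant algebroids are the morphisms of DG $\mathcal{O}_{X^\sharp}$-modules that respect the brackets, anchors, pairings and derivations. A *flat connection* on $\mathcal{Q}$ is a morphism of DG $\mathcal{O}_{X^\sharp}$-modules $\nabla:\mathcal{T}_{X^\sharp}\to\mathcal{Q}$ with $\pi\circ\nabla=\mathrm{id}$ that preserves brackets. The same definitions apply over every open subset $U$ of $X$. Let $\mathcal{ECA}_{\mathcal{O}_{X^\sharp}}$ be the assignment of the category of exact Courant algebroids over $(U,\mathcal{O}_{X^\sharp}|_U)$ to $U$, with the restriction functors. Then: 1. for every open $U\subseteq X$ (in particular $U=X$), every exact Courant $\mathcal{O}_{X^\sharp}|_U$-algebroid admits a unique flat connection; 2. $\mathcal{ECA}_{\mathcal{O}_{X^\sharp}}$ is a stack on $X$, and it is equivalent to the final stack $U\mapsto[0]$, where $[0]$ is the category with one object and one morphism.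 -/

import Mathlib

open CategoryTheory TopologicalSpace

universe u
set_option linter.unusedSimpArgs false

noncomputable section

namespace DRCourant

/-- The sheaf condition for a presheaf `sec` on a family `P` of open subsets of `X`: a compatible
family of sections over a cover glues uniquely. -/
def UniqueGluing {X : Type u} [TopologicalSpace X] {P : Type u} [Preorder P] (o : P → Opens X)
    (sec : P → Type u) (res : ∀ {V W : P}, W ≤ V → sec V → sec W) : Prop :=
  ∀ (V : P) (ι : Type u) (W : ι → P) (hW : ∀ a, W a ≤ V),
    (∀ x ∈ o V, ∃ a, x ∈ o (W a)) →
    ∀ s : ∀ a, sec (W a),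
      (∀ (a b : ι) (Z : P) (ha : Z ≤ W a) (hb : Z ≤ W b), res ha (s a) = res hb (s b)) →
      ∃! t : sec V, ∀ a, res (hW a) t = s a

/-- A sheaf of commutative `ℂ`-algebras on `X`. -/
structure AlgSheaf (X : Type u) [TopologicalSpace X] where
  sec : Opens X → Type u
  [ring : ∀ V, CommRing (sec V)]
  [alg : ∀ V, Algebra ℂ (sec V)]
  res : ∀ {V W : Opens X}, W ≤ V → sec V →ₐ[ℂ] sec W
  res_self : ∀ {V : Opens X} (f : sec V), res (le_refl V) f = f
  res_res : ∀ {V W Z : Opens X} (h : W ≤ V) (h' : Z ≤ W) (f : sec V),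
    res h' (res h f) = res (h'.trans h) f
  glue : UniqueGluing id sec fun h => res h

attribute [instance] AlgSheaf.ring AlgSheaf.alg

variable {X : Type u} [TopologicalSpace X]

section VectorFields

variable (O : AlgSheaf X)

/-- Vector fields on the open set `V`: derivations of the sheaf of `ℂ`-algebras `O|_V`. -/
def VF (V : Opens X) :
    Submodule ℂ (∀ W : Set.Iic V, Derivation ℂ (O.sec W) (O.sec W)) where
  carrier := {ξ | ∀ (W W' : Opens X) (h : W ≤ V) (h' : W' ≤ W) (f : O.sec W),
    O.res h' (ξ ⟨W, h⟩ f) = ξ ⟨W', h'.trans h⟩ (O.res h' f)}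
  add_mem' := by
    intro a b ha hb W W' h h' f
    simp [ha W W' h h' f, hb W W' h h' f]
  zero_mem' := by intro W W' h h' f; simp
  smul_mem' := by
    intro c a ha W W' h h' f
    simp [ha W W' h h' f]

variable {O}

namespace VF

theorem ext {V : Opens X} {ξ η : VF O V}
    (h : ∀ (W : Opens X) (hW : W ≤ V) (f : O.sec W), ξ.1 ⟨W, hW⟩ f = η.1 ⟨W, hW⟩ f) : ξ = η := by
  apply Subtype.ext
  funext W
  exact Derivation.ext fun f => h W.1 W.2 f

/-- Restriction of a vector field to a smaller open set. -/
def res {V W : Opens X} (h : W ≤ V) (ξ : VF O V) : VF O W :=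
  ⟨fun Z => ξ.1 ⟨Z.1, Z.2.trans h⟩, fun Z Z' hZ h' f => ξ.2 Z Z' (hZ.trans h) h' f⟩

/-- The product of a function and a vector field. -/
def fsmul {V : Opens X} (f : O.sec V) (ξ : VF O V) : VF O V :=
  ⟨fun Z => O.res Z.2 f • ξ.1 Z, fun Z Z' hZ h' g => by
    simp only [Derivation.coe_smul, Pi.smul_apply, smul_eq_mul, map_mul]
    rw [ξ.2 Z Z' hZ h' g]
    exact congrArg (· * _) (O.res_res _ _ f)⟩

/-- The commutator of vector fields. -/
def bracket {V : Opens X} (ξ η : VF O V) : VF O V :=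
  ⟨fun Z => ⁅ξ.1 Z, η.1 Z⁆, fun Z Z' hZ h' g => by
    simp [Derivation.commutator_apply, ξ.2 Z Z' hZ h', η.2 Z Z' hZ h']⟩

/-- The action of a vector field on functions. -/
def act {V : Opens X} (ξ : VF O V) : O.sec V →ₗ[ℂ] O.sec V :=
  (ξ.1 ⟨V, Set.mem_Iic.2 le_rfl⟩).toLinearMap

theorem act_mul {V : Opens X} (ξ : VF O V) (f g : O.sec V) :
    act ξ (f * g) = act ξ f * g + f * act ξ g := by
  have := (ξ.1 ⟨V, Set.mem_Iic.2 le_rfl⟩).leibniz f g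
  simp only [smul_eq_mul] at this
  exact this.trans (by simp only [act]; ring_nf; rfl)

theorem res_act {V W : Opens X} (h : W ≤ V) (ξ : VF O V) (f : O.sec V) :
    O.res h (act ξ f) = act (res h ξ) (O.res h f) := ξ.2 V W le_rfl h f

theorem act_add {V : Opens X} (ξ η : VF O V) (f : O.sec V) :
    act (ξ + η) f = act ξ f + act η f := rfl

theorem act_fsmul {V : Opens X} (g : O.sec V) (ξ : VF O V) (f : O.sec V) :
    act (fsmul g ξ) f = g * act ξ f := congrArg (· * act ξ f) (O.res_self g)

theorem act_bracket {V : Opens X} (ξ η : VF O V) (f : O.sec V) :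
    act (bracket ξ η) f = act ξ (act η f) - act η (act ξ f) := rfl

theorem ext_act {V : Opens X} {ξ η : VF O V}
    (h : ∀ (W : Opens X) (hW : W ≤ V) (f : O.sec W), act (res hW ξ) f = act (res hW η) f) :
    ξ = η := ext h

theorem res_res {V W Z : Opens X} (h : W ≤ V) (h' : Z ≤ W) (ξ : VF O V) :
    res h' (res h ξ) = res (h'.trans h) ξ := rfl

theorem res_self {V : Opens X} (ξ : VF O V) : res le_rfl ξ = ξ := rfl

theorem res_add {V W : Opens X} (h : W ≤ V) (ξ η : VF O V) :
    res h (ξ + η) = res h ξ + res h η := rfl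

theorem res_bracket {V W : Opens X} (h : W ≤ V) (ξ η : VF O V) :
    res h (bracket ξ η) = bracket (res h ξ) (res h η) := rfl

theorem res_fsmul {V W : Opens X} (h : W ≤ V) (f : O.sec V) (ξ : VF O V) :
    res h (fsmul f ξ) = fsmul (O.res h f) (res h ξ) :=
  ext_act fun Z hZ g => by
    rw [res_res]
    exact congrArg (· * act (res (hZ.trans h) ξ) g) (O.res_res _ _ f).symm

theorem bracket_self {V : Opens X} (ξ : VF O V) : bracket ξ ξ = 0 :=
  ext_act fun Z hZ g => by
    rw [res_bracket, act_bracket, sub_self]; rfl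

theorem bracket_add {V : Opens X} (ξ η ζ : VF O V) :
    bracket ξ (η + ζ) = bracket ξ η + bracket ξ ζ :=
  ext_act fun Z hZ g => by
    simp only [res_bracket, act_bracket, res_add, act_add, map_add]; ring

theorem add_bracket {V : Opens X} (ξ η ζ : VF O V) :
    bracket (ξ + η) ζ = bracket ξ ζ + bracket η ζ :=
  ext_act fun Z hZ g => by
    simp only [res_bracket, act_bracket, res_add, act_add, map_add]; ring

theorem bracket_fsmul {V : Opens X} (ξ η : VF O V) (f : O.sec V) :
    bracket ξ (fsmul f η) = fsmul (act ξ f) η + fsmul f (bracket ξ η) :=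
  ext_act fun Z hZ g => by
    simp only [res_bracket, act_bracket, res_add, act_add, res_fsmul, act_fsmul, act_mul, res_act]
    ring

theorem bracket_antisymm {V : Opens X} (ξ η : VF O V) :
    bracket ξ η + bracket η ξ = 0 :=
  ext_act fun Z hZ g => by
    simp only [res_bracket, act_bracket, res_add, act_add]
    ring_nf
    rfl

theorem fsmul_bracket {V : Opens X} (ξ η : VF O V) (f : O.sec V) :
    bracket (fsmul f ξ) η + fsmul (act η f) ξ = fsmul f (bracket ξ η) :=
  ext_act fun Z hZ g => by
    simp only [res_bracket, act_bracket, res_add, act_add, res_fsmul, act_fsmul, act_mul, res_act]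
    ring

theorem jacobi {V : Opens X} (ξ η ζ : VF O V) :
    bracket ξ (bracket η ζ) = bracket (bracket ξ η) ζ + bracket η (bracket ξ ζ) :=
  ext_act fun Z hZ g => by
    simp only [res_bracket, act_bracket, res_add, act_add, map_sub]
    ring

end VF

end VectorFields

section Forms

variable (O : AlgSheaf X)

/-- Auxiliary, unrestricted "multi-maps": a map of degree `0` on `V` is a function on `V`, and a
map of degree `p + 1` on `V` assigns to every vector field on an open `W ≤ V` a map of degree `p`
on `W`.  Differential forms are singled out among them by `IsForm`. -/
def PreForm : ℕ → Opens X → Type u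
  | 0, V => O.sec V
  | p + 1, V => ∀ W : Set.Iic V, VF O W.1 → PreForm p W.1

instance PreForm.addCommGroup : ∀ (p : ℕ) (V : Opens X), AddCommGroup (PreForm O p V)
  | 0, V => inferInstanceAs (AddCommGroup (O.sec V))
  | p + 1, V =>
    letI : ∀ W, AddCommGroup (PreForm O p W) := PreForm.addCommGroup p
    inferInstanceAs (AddCommGroup (∀ W : Set.Iic V, VF O W.1 → PreForm O p W.1))

instance PreForm.module : ∀ (p : ℕ) (V : Opens X), Module ℂ (PreForm O p V)
  | 0, V => inferInstanceAs (Module ℂ (O.sec V))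
  | p + 1, V =>
    letI : ∀ W, Module ℂ (PreForm O p W) := PreForm.module p
    inferInstanceAs (Module ℂ (∀ W : Set.Iic V, VF O W.1 → PreForm O p W.1))

variable {O}

namespace PreForm

/-- A function, as a multi-map of degree `0`, and conversely. -/
def ofFun {V : Opens X} : O.sec V →ₗ[ℂ] PreForm O 0 V where
  toFun f := f
  map_add' _ _ := rfl
  map_smul' _ _ := rfl

/-- The function underlying a multi-map of degree `0`. -/
def toFun {V : Opens X} : PreForm O 0 V →ₗ[ℂ] O.sec V where
  toFun f := f
  map_add' _ _ := rfl
  map_smul' _ _ := rfl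

@[simp] theorem toFun_ofFun {V : Opens X} (f : O.sec V) : toFun (ofFun f) = f := rfl
@[simp] theorem ofFun_toFun {V : Opens X} (f : PreForm O 0 V) : ofFun (toFun f) = f := rfl

/-- Evaluation of a multi-map of positive degree on a vector field `ξ` on `W ≤ V`; this is the
contraction `ι_ξ`. -/
def ev {p : ℕ} {V W : Opens X} (h : W ≤ V) (ξ : VF O W) :
    PreForm O (p + 1) V →ₗ[ℂ] PreForm O p W where
  toFun ω := ω ⟨W, h⟩ ξ
  map_add' _ _ := rfl
  map_smul' _ _ := rfl

/-- Construction of a multi-map of positive degree from its contractions. -/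
def mk {p : ℕ} {V : Opens X} (F : ∀ {W : Opens X}, W ≤ V → VF O W → PreForm O p W) :
    PreForm O (p + 1) V := fun W ξ => F (W := W.1) W.2 ξ

@[simp] theorem ev_mk {p : ℕ} {V W : Opens X} (h : W ≤ V) (ξ : VF O W)
    (F : ∀ {W : Opens X}, W ≤ V → VF O W → PreForm O p W) : ev h ξ (mk F) = F h ξ := rfl

theorem ext_ev {p : ℕ} {V : Opens X} {α β : PreForm O (p + 1) V}
    (h : ∀ (W : Opens X) (hW : W ≤ V) (ξ : VF O W), ev hW ξ α = ev hW ξ β) : α = β := by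
  funext W ξ; exact h W.1 W.2 ξ

theorem ext_fun {V : Opens X} {α β : PreForm O 0 V} (h : toFun α = toFun β) : α = β := h

/-- Restriction to a smaller open set. -/
def res : ∀ {p : ℕ} {V W : Opens X}, W ≤ V → PreForm O p V →ₗ[ℂ] PreForm O p W
  | 0, _, _, h => ofFun ∘ₗ (O.res h).toLinearMap ∘ₗ toFun
  | _ + 1, _, _, h =>
    { toFun := fun ω => mk fun hZ ξ => ev (hZ.trans h) ξ ω
      map_add' := fun _ _ => rfl
      map_smul' := fun _ _ => rfl }

/-- The exterior product of multi-maps of degrees `p` and `q` (of interest only for `r = p + q`),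
determined by the fact that contraction with a vector field is an antiderivation. -/
def wedge : ∀ (r : ℕ) {p q : ℕ} {V : Opens X}, PreForm O p V → PreForm O q V → PreForm O r V
  | 0, 0, 0, _, f, g => ofFun (toFun f * toFun g)
  | 0, _ + 1, _, _, _, _ => 0
  | 0, 0, _ + 1, _, _, _ => 0
  | _ + 1, 0, 0, _, _, _ => 0
  | r + 1, 0, _ + 1, _, f, β => mk fun h ξ => wedge r (res h f) (ev h ξ β)
  | r + 1, _ + 1, 0, _, α, g => mk fun h ξ => wedge r (ev h ξ α) (res h g)
  | r + 1, p + 1, _ + 1, _, α, β => mk fun h ξ =>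
      wedge r (ev h ξ α) (res h β) + (-1 : ℂ) ^ (p + 1) • wedge r (res h α) (ev h ξ β)

/-- The Lie derivative, determined by `ι_η L_ξ = L_ξ ι_η - ι_[ξ,η]`. -/
def lie : ∀ {p : ℕ} {V : Opens X}, VF O V → PreForm O p V → PreForm O p V
  | 0, _, ξ, f => ofFun (VF.act ξ (toFun f))
  | _ + 1, _, ξ, ω => mk fun h η =>
      lie (VF.res h ξ) (ev h η ω) - ev h (VF.bracket (VF.res h ξ) η) ω

/-- The de Rham differential, determined by Cartan's formula `ι_ξ d = L_ξ - d ι_ξ`. -/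
def d : ∀ {p : ℕ} {V : Opens X}, PreForm O p V → PreForm O (p + 1) V
  | 0, _, f => mk fun h ξ => lie ξ (res h f)
  | _ + 1, _, ω => mk fun h ξ => lie ξ (res h ω) - d (ev h ξ ω)

/-- The multi-map `ω` is alternating in its first two arguments: `ι_ξ ι_ξ ω = 0`. -/
def IsAlt : ∀ {p : ℕ} {V : Opens X}, PreForm O (p + 1) V → Prop
  | 0, _, _ => True
  | _ + 1, V, ω => ∀ {W : Opens X} (h : W ≤ V) (ξ : VF O W), ev le_rfl ξ (ev h ξ ω) = 0

/-- The condition on a multi-map to be a differential form: it is `O`-linear, compatible with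
restrictions and alternating. -/
def IsForm : ∀ {p : ℕ} {V : Opens X}, PreForm O p V → Prop
  | 0, _, _ => True
  | p + 1, V, ω =>
      (∀ {W : Opens X} (h : W ≤ V) (ξ : VF O W), IsForm (ev h ξ ω)) ∧
      (∀ {W : Opens X} (h : W ≤ V) (ξ η : VF O W), ev h (ξ + η) ω = ev h ξ ω + ev h η ω) ∧
      (∀ {W : Opens X} (h : W ≤ V) (f : O.sec W) (ξ : VF O W),
        ev h (VF.fsmul f ξ) ω = wedge p (ofFun f) (ev h ξ ω)) ∧
      (∀ {W Z : Opens X} (h : W ≤ V) (h' : Z ≤ W) (ξ : VF O W),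
        res h' (ev h ξ ω) = ev (h'.trans h) (VF.res h' ξ) ω) ∧
      IsAlt ω

/-! ### Cartan calculus -/

@[simp] theorem ev_res {p : ℕ} {V W Z : Opens X} (h : W ≤ V) (h' : Z ≤ W) (ξ : VF O Z)
    (ω : PreForm O (p + 1) V) : ev h' ξ (res h ω) = ev (h'.trans h) ξ ω := rfl

@[simp] theorem toFun_res {V W : Opens X} (h : W ≤ V) (f : PreForm O 0 V) :
    toFun (res h f) = O.res h (toFun f) := rfl

@[simp] theorem res_ofFun {V W : Opens X} (h : W ≤ V) (f : O.sec V) :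
    res h (ofFun f) = ofFun (O.res h f) := rfl

theorem res_res : ∀ {p : ℕ} {V W Z : Opens X} (h : W ≤ V) (h' : Z ≤ W) (ω : PreForm O p V),
    res h' (res h ω) = res (h'.trans h) ω
  | 0, _, _, _, h, h', f => ext_fun (by simp [O.res_res])
  | _ + 1, _, _, _, _, _, _ => rfl

theorem res_self : ∀ {p : ℕ} {V : Opens X} (ω : PreForm O p V), res le_rfl ω = ω
  | 0, _, f => ext_fun (by simp [O.res_self])
  | _ + 1, _, _ => rfl

@[simp] theorem wedge_00 {V : Opens X} (f g : PreForm O 0 V) :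
    wedge 0 f g = ofFun (toFun f * toFun g) := by simp [wedge]
@[simp] theorem wedge_z1 {p q : ℕ} {V : Opens X} (f : PreForm O (p + 1) V) (g : PreForm O q V) :
    wedge 0 f g = 0 := by simp [wedge]
@[simp] theorem wedge_z2 {p q : ℕ} {V : Opens X} (f : PreForm O p V) (g : PreForm O (q + 1) V) :
    wedge 0 f g = 0 := by cases p <;> simp [wedge]
@[simp] theorem wedge_s00 {r : ℕ} {V : Opens X} (f g : PreForm O 0 V) :
    wedge (r + 1) f g = 0 := by simp [wedge]
@[simp] theorem ev_wedge01 {r q : ℕ} {V W : Opens X} (h : W ≤ V) (ξ : VF O W) (f : PreForm O 0 V)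
    (β : PreForm O (q + 1) V) :
    ev h ξ (wedge (r + 1) f β) = wedge r (res h f) (ev h ξ β) := by simp [wedge]
@[simp] theorem ev_wedge10 {r q : ℕ} {V W : Opens X} (h : W ≤ V) (ξ : VF O W) (f : PreForm O 0 V)
    (β : PreForm O (q + 1) V) :
    ev h ξ (wedge (r + 1) β f) = wedge r (ev h ξ β) (res h f) := by simp [wedge]
@[simp] theorem ev_wedge11 {r p q : ℕ} {V W : Opens X} (h : W ≤ V) (ξ : VF O W)
    (α : PreForm O (p + 1) V) (β : PreForm O (q + 1) V) :
    ev h ξ (wedge (r + 1) α β) =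
      wedge r (ev h ξ α) (res h β) + (-1 : ℂ) ^ (p + 1) • wedge r (res h α) (ev h ξ β) := by
  simp [wedge]

@[simp] theorem ev_lie {p : ℕ} {V W : Opens X} (h : W ≤ V) (η : VF O W) (ξ : VF O V)
    (ω : PreForm O (p + 1) V) : ev h η (lie ξ ω) =
      lie (VF.res h ξ) (ev h η ω) - ev h (VF.bracket (VF.res h ξ) η) ω := by simp [lie]

@[simp] theorem lie_zero_deg {V : Opens X} (ξ : VF O V) (f : PreForm O 0 V) :
    lie ξ f = ofFun (VF.act ξ (toFun f)) := by simp [lie]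

@[simp] theorem ev_d_zero {V W : Opens X} (h : W ≤ V) (ξ : VF O W) (f : PreForm O 0 V) :
    ev h ξ (d f) = lie ξ (res h f) := by simp [d]

@[simp] theorem ev_d_succ {p : ℕ} {V W : Opens X} (h : W ≤ V) (ξ : VF O W)
    (ω : PreForm O (p + 1) V) : ev h ξ (d ω) = lie ξ (res h ω) - d (ev h ξ ω) := by simp [d]

theorem wedge_add_left : ∀ (r : ℕ) {p q : ℕ} {V : Opens X} (α α' : PreForm O p V)
    (β : PreForm O q V), wedge r (α + α') β = wedge r α β + wedge r α' β
  | 0, 0, 0, _, _, _, _ => ext_fun (by simp [add_mul])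
  | 0, 0, _ + 1, _, _, _, _ => by simp
  | 0, _ + 1, _, _, _, _, _ => by simp
  | _ + 1, 0, 0, _, _, _, _ => by simp
  | r + 1, 0, _ + 1, _, α, α', β => ext_ev fun W h ξ => by
      simp [wedge_add_left r]
  | r + 1, _ + 1, 0, _, α, α', β => ext_ev fun W h ξ => by
      simp [wedge_add_left r]
  | r + 1, _ + 1, _ + 1, _, α, α', β => ext_ev fun W h ξ => by
      simp only [map_add, ev_wedge11, wedge_add_left r, smul_add]; abel

theorem wedge_smul_left : ∀ (r : ℕ) {p q : ℕ} {V : Opens X} (c : ℂ) (α : PreForm O p V)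
    (β : PreForm O q V), wedge r (c • α) β = c • wedge r α β
  | 0, 0, 0, _, _, _, _ => ext_fun (by simp)
  | 0, 0, _ + 1, _, _, _, _ => by simp
  | 0, _ + 1, _, _, _, _, _ => by simp
  | _ + 1, 0, 0, _, _, _, _ => by simp
  | r + 1, 0, _ + 1, _, _, _, _ => ext_ev fun W h ξ => by
      simp [wedge_smul_left r]
  | r + 1, _ + 1, 0, _, _, _, _ => ext_ev fun W h ξ => by
      simp [wedge_smul_left r]
  | r + 1, _ + 1, _ + 1, _, _, _, _ => ext_ev fun W h ξ => by
      simp only [map_smul, ev_wedge11, wedge_smul_left r, smul_add]; module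

theorem wedge_comm : ∀ (r : ℕ) {p q : ℕ} {V : Opens X} (α : PreForm O p V)
    (β : PreForm O q V), wedge r α β = (-1 : ℂ) ^ (p * q) • wedge r β α
  | 0, 0, 0, _, _, _ => ext_fun (by simp [mul_comm])
  | 0, 0, _ + 1, _, _, _ => by simp
  | 0, _ + 1, _, _, _, _ => by simp
  | _ + 1, 0, 0, _, _, _ => by simp
  | r + 1, 0, _ + 1, _, _, _ => ext_ev fun W h ξ => by
      rw [ev_wedge01, map_smul, ev_wedge10, wedge_comm r, zero_mul, zero_mul]
  | r + 1, _ + 1, 0, _, _, _ => ext_ev fun W h ξ => by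
      rw [ev_wedge10, map_smul, ev_wedge01, wedge_comm r, mul_zero, mul_zero]
  | r + 1, p + 1, q + 1, _, α, β => ext_ev fun W h ξ => by
      simp only [map_smul, ev_wedge11, smul_add]
      rw [wedge_comm r (ev h ξ α) (res h β), wedge_comm r (res h α) (ev h ξ β)]
      rw [add_comm]
      simp only [smul_smul, ← pow_add]
      congr 2
      · exact congrArg _ (by
          rw [show p + 1 + (p + 1) * q = (p + 1) * (q + 1) by ring])
      · rw [show (p + 1) * (q + 1) + (q + 1) = p * (q + 1) + 2 * (q + 1) by ring, pow_add]
        simp [pow_mul]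

theorem wedge_add_right (r : ℕ) {p q : ℕ} {V : Opens X} (α : PreForm O p V)
    (β β' : PreForm O q V) : wedge r α (β + β') = wedge r α β + wedge r α β' := by
  rw [wedge_comm, wedge_add_left, smul_add, ← wedge_comm, ← wedge_comm]

theorem wedge_smul_right (r : ℕ) {p q : ℕ} {V : Opens X} (c : ℂ) (α : PreForm O p V)
    (β : PreForm O q V) : wedge r α (c • β) = c • wedge r α β := by
  rw [wedge_comm, wedge_smul_left, smul_comm, ← wedge_comm]

/-- The exterior product as a bilinear map. -/
def wedgeₗ (r : ℕ) {p q : ℕ} {V : Opens X} :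
    PreForm O p V →ₗ[ℂ] PreForm O q V →ₗ[ℂ] PreForm O r V :=
  LinearMap.mk₂ ℂ (wedge r) (wedge_add_left r) (wedge_smul_left r) (wedge_add_right r)
    (wedge_smul_right r)

theorem wedge_zero_left (r : ℕ) {p q : ℕ} {V : Opens X} (β : PreForm O q V) :
    wedge r (0 : PreForm O p V) β = 0 := LinearMap.map_zero₂ (wedgeₗ r) β
theorem wedge_zero_right (r : ℕ) {p q : ℕ} {V : Opens X} (α : PreForm O p V) :
    wedge r α (0 : PreForm O q V) = 0 := (wedgeₗ r α).map_zero
theorem wedge_sub_left (r : ℕ) {p q : ℕ} {V : Opens X} (α α' : PreForm O p V)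
    (β : PreForm O q V) : wedge r (α - α') β = wedge r α β - wedge r α' β :=
  LinearMap.map_sub₂ (wedgeₗ r) α α' β
theorem wedge_sub_right (r : ℕ) {p q : ℕ} {V : Opens X} (α : PreForm O p V)
    (β β' : PreForm O q V) : wedge r α (β - β') = wedge r α β - wedge r α β' :=
  (wedgeₗ r α).map_sub β β'

theorem res_wedge : ∀ (r : ℕ) {p q : ℕ} {V W : Opens X} (h : W ≤ V) (α : PreForm O p V)
    (β : PreForm O q V), res h (wedge r α β) = wedge r (res h α) (res h β)
  | 0, 0, 0, _, _, _, _, _ => ext_fun (by simp)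
  | 0, 0, _ + 1, _, _, _, _, _ => by simp
  | 0, _ + 1, _, _, _, _, _, _ => by simp
  | _ + 1, 0, 0, _, _, _, _, _ => by simp
  | r + 1, 0, _ + 1, _, _, _, _, _ => ext_ev fun W h ξ => by simp [res_res]
  | r + 1, _ + 1, 0, _, _, _, _, _ => ext_ev fun W h ξ => by simp [res_res]
  | r + 1, _ + 1, _ + 1, _, _, _, _, _ => ext_ev fun W h ξ => by simp [res_res]

theorem wedge_assoc (n : ℕ) : ∀ {p q s m l : ℕ} {V : Opens X} (α : PreForm O p V)
    (β : PreForm O q V) (γ : PreForm O s V), p + q = m → q + s = l →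
    wedge n (wedge m α β) γ = wedge n α (wedge l β γ) := by
  induction n with
  | zero =>
    intro p q s m l V α β γ hm hl
    rcases p with _ | p <;> rcases q with _ | q <;> rcases s with _ | s <;>
      rcases m with _ | m <;> rcases l with _ | l <;>
      first
        | omega
        | exact ext_fun (by simp [mul_assoc])
  | succ n ih =>
    intro p q s m l V α β γ hm hl
    rcases p with _ | p <;> rcases q with _ | q <;> rcases s with _ | s <;>
      rcases m with _ | m <;> rcases l with _ | l <;>
      first
        | omega
        | simp only [wedge_s00]
        | skip
    · obtain rfl : l = s := by omega
      refine ext_ev fun W h ξ => ?_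
      simp only [ev_wedge01, res_wedge]
      rw [ih (l := l) _ _ _ (by omega) (by omega)]
    · obtain rfl : l = q := by omega
      refine ext_ev fun W h ξ => ?_
      simp only [ev_wedge01, ev_wedge10]
      rw [ih (l := l) _ _ _ (by omega) (by omega)]
    · obtain rfl : m = q := by omega
      refine ext_ev fun W h ξ => ?_
      simp only [ev_wedge11, ev_wedge01, res_wedge, wedge_add_right, wedge_smul_right]
      rw [ih (l := l) _ _ _ (by omega) (by omega), ih (l := l) _ _ _ (by omega) (by omega)]
    · refine ext_ev fun W h ξ => ?_
      simp only [ev_wedge10, res_wedge]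
      rw [ih (l := 0) _ _ _ (by omega) (by omega)]
    · obtain rfl : m = p := by omega
      refine ext_ev fun W h ξ => ?_
      simp only [ev_wedge11, ev_wedge01, ev_wedge10, res_wedge]
      rw [ih (l := l + 1) _ _ _ (by omega) (by omega), ih (l := l) _ _ _ (by omega) (by omega)]
    · obtain rfl : l = q := by omega
      refine ext_ev fun W h ξ => ?_
      simp only [ev_wedge11, ev_wedge10, res_wedge, wedge_add_left, wedge_smul_left]
      rw [ih (l := l + 1) _ _ _ (by omega) (by omega), ih (l := l) _ _ _ (by omega) (by omega)]
    · refine ext_ev fun W h ξ => ?_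
      simp only [ev_wedge11, res_wedge, wedge_add_left, wedge_smul_left, wedge_add_right,
        wedge_smul_right]
      rw [ih (PreForm.ev h ξ α) _ _ (show p + (q + 1) = m by omega) hl,
        ih _ (PreForm.ev h ξ β) _ (show p + 1 + q = m by omega) (show q + (s + 1) = l by omega),
        ih _ _ (PreForm.ev h ξ γ) hm (show q + 1 + s = l by omega)]
      simp only [smul_add, smul_smul, ← pow_add]
      rw [show m + 1 = p + 1 + (q + 1) by omega]
      abel

theorem one_wedge : ∀ {p : ℕ} {V : Opens X} (α : PreForm O p V), wedge p (ofFun 1) α = α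
  | 0, _, α => ext_fun (by simp)
  | p + 1, _, α => ext_ev fun W h ξ => by simp [one_wedge (p := p)]

theorem lie_add : ∀ {p : ℕ} {V : Opens X} (ξ : VF O V) (α β : PreForm O p V),
    lie ξ (α + β) = lie ξ α + lie ξ β
  | 0, _, _, _, _ => ext_fun (by simp)
  | p + 1, _, _, _, _ => ext_ev fun W h ξ => by
      simp only [map_add, ev_lie, lie_add (p := p)]; abel

theorem lie_smul : ∀ {p : ℕ} {V : Opens X} (ξ : VF O V) (c : ℂ) (α : PreForm O p V),
    lie ξ (c • α) = c • lie ξ α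
  | 0, _, _, _, _ => ext_fun (by simp)
  | p + 1, _, _, _, _ => ext_ev fun W h ξ => by
      simp only [map_smul, ev_lie, lie_smul (p := p), smul_sub]

/-- The Lie derivative as a linear map. -/
def lieₗ {p : ℕ} {V : Opens X} (ξ : VF O V) : PreForm O p V →ₗ[ℂ] PreForm O p V where
  toFun := lie ξ
  map_add' := lie_add ξ
  map_smul' := lie_smul ξ

theorem lie_sub {p : ℕ} {V : Opens X} (ξ : VF O V) (α β : PreForm O p V) :
    lie ξ (α - β) = lie ξ α - lie ξ β := (lieₗ ξ).map_sub α β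
theorem lie_zero {p : ℕ} {V : Opens X} (ξ : VF O V) :
    lie ξ (0 : PreForm O p V) = 0 := (lieₗ ξ).map_zero

theorem res_lie : ∀ {p : ℕ} {V W : Opens X} (h : W ≤ V) (ξ : VF O V) (α : PreForm O p V),
    res h (lie ξ α) = lie (VF.res h ξ) (res h α)
  | 0, _, _, _, _, _ => ext_fun (by simp [VF.res_act])
  | _ + 1, _, _, _, _, _ => ext_ev fun W h ξ => by simp [VF.res_res]

theorem lie_wedge : ∀ (r : ℕ) {p q : ℕ} {V : Opens X} (ξ : VF O V) (α : PreForm O p V)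
    (β : PreForm O q V), lie ξ (wedge r α β) = wedge r (lie ξ α) β + wedge r α (lie ξ β)
  | 0, 0, 0, _, _, _, _ => ext_fun (by simp [VF.act_mul])
  | 0, 0, _ + 1, _, _, _, _ => by simp [lie_zero]
  | 0, _ + 1, _, _, _, _, _ => by simp [lie_zero]
  | _ + 1, 0, 0, _, _, _, _ => by simp [lie_zero]
  | r + 1, 0, _ + 1, _, _, _, _ => ext_ev fun W h η => by
      simp only [ev_lie, ev_wedge01, map_add, lie_wedge r, res_lie, wedge_sub_right]
      abel
  | r + 1, _ + 1, 0, _, _, _, _ => ext_ev fun W h η => by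
      simp only [ev_lie, ev_wedge10, map_add, lie_wedge r, res_lie, wedge_sub_left]
      abel
  | r + 1, _ + 1, _ + 1, _, _, _, _ => ext_ev fun W h η => by
      simp only [ev_lie, ev_wedge11, map_add, lie_wedge r, res_lie, wedge_sub_left,
        wedge_sub_right, lie_add, lie_smul, smul_sub, smul_add]
      abel

theorem d_add : ∀ {p : ℕ} {V : Opens X} (α β : PreForm O p V), d (α + β) = d α + d β
  | 0, _, _, _ => ext_ev fun W h ξ => by simp only [ev_d_zero, map_add, lie_add]
  | p + 1, _, _, _ => ext_ev fun W h ξ => by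
      simp only [ev_d_succ, map_add, lie_add, d_add (p := p)]; abel

theorem d_smul : ∀ {p : ℕ} {V : Opens X} (c : ℂ) (α : PreForm O p V), d (c • α) = c • d α
  | 0, _, _, _ => ext_ev fun W h ξ => by simp only [ev_d_zero, map_smul, lie_smul]
  | p + 1, _, _, _ => ext_ev fun W h ξ => by
      simp only [ev_d_succ, map_smul, lie_smul, d_smul (p := p), smul_sub]

/-- The de Rham differential as a linear map. -/
def dₗ {p : ℕ} {V : Opens X} : PreForm O p V →ₗ[ℂ] PreForm O (p + 1) V where
  toFun := d
  map_add' := d_add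
  map_smul' := d_smul

theorem d_sub {p : ℕ} {V : Opens X} (α β : PreForm O p V) : d (α - β) = d α - d β :=
  dₗ.map_sub α β
theorem d_zero {p : ℕ} {V : Opens X} : d (0 : PreForm O p V) = 0 := dₗ.map_zero

theorem d_neg {p : ℕ} {V : Opens X} (α : PreForm O p V) : d (-α) = - d α := dₗ.map_neg α

theorem res_d : ∀ {p : ℕ} {V W : Opens X} (h : W ≤ V) (α : PreForm O p V),
    res h (d α) = d (res h α)
  | 0, _, _, _, _ => ext_ev fun W h ξ => by rw [ev_res, ev_d_zero, ev_d_zero, res_res]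
  | _ + 1, _, _, _, _ => ext_ev fun W h ξ => by
      rw [ev_res, ev_d_succ, ev_d_succ, res_res, ev_res]

theorem d_wedge (r : ℕ) : ∀ {p q : ℕ} {V : Opens X} (α : PreForm O p V)
    (β : PreForm O q V), p + q = r →
    d (wedge r α β) = wedge (r + 1) (d α) β + (-1 : ℂ) ^ p • wedge (r + 1) α (d β) := by
  induction r with
  | zero =>
    intro p q V α β hr
    obtain rfl : p = 0 := by omega
    obtain rfl : q = 0 := by omega
    exact ext_ev fun W h ξ => ext_fun (by simp [VF.act_mul])
  | succ r ih =>
    intro p q V α β hr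
    rcases p with _ | p <;> rcases q with _ | q
    · omega
    · refine ext_ev fun W h ξ => ?_
      simp only [ev_d_succ, ev_wedge01, map_add, ev_wedge11, ev_d_zero, res_wedge,
        lie_wedge, ih (res h α) (ev h ξ β) (by omega), wedge_sub_right, res_d,
        pow_zero, one_smul, zero_add, pow_one, neg_smul]
      abel
    · refine ext_ev fun W h ξ => ?_
      have e : ((-1 : ℂ) ^ p * (-1 : ℂ) ^ p) = 1 := by
        rw [← mul_pow]; simp
      have e1 : (-1 : ℂ) ^ (p + 1) = - (-1 : ℂ) ^ p := by rw [pow_succ]; simp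
      have e2 : (-1 : ℂ) ^ (p + 1 + 1) = (-1 : ℂ) ^ p := by rw [pow_succ, pow_succ]; simp
      simp only [ev_d_succ, ev_wedge10, map_add, map_smul, map_neg, ev_wedge11, ev_d_zero,
        res_wedge, lie_wedge, ih (ev h ξ α) (res h β) (show p + 0 = r by omega), wedge_sub_left,
        res_d, smul_add, smul_smul, e1, e2, neg_smul, neg_mul, mul_neg, neg_neg, e, one_smul,
        smul_neg]
      abel
    · refine ext_ev fun W h ξ => ?_
      have e : ((-1 : ℂ) ^ p * (-1 : ℂ) ^ p) = 1 := by
        rw [← mul_pow]; simp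
      have e1 : (-1 : ℂ) ^ (p + 1) = - (-1 : ℂ) ^ p := by rw [pow_succ]; simp
      have e2 : (-1 : ℂ) ^ (p + 1 + 1) = (-1 : ℂ) ^ p := by rw [pow_succ, pow_succ]; simp
      simp only [ev_d_succ, map_add, map_smul, map_neg, d_neg, ev_wedge11, res_wedge, e1, e2,
        lie_wedge, ih (ev h ξ α) (res h β) (show p + (q + 1) = r by omega),
        ih (res h α) (ev h ξ β) (show p + 1 + q = r by omega), d_add, d_smul,
        wedge_sub_left, wedge_sub_right, res_d, smul_sub, smul_add, smul_smul,
        mul_neg, mul_one, neg_smul, smul_neg, neg_mul, neg_neg, e, one_smul]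
      abel

namespace IsForm

theorem ev {p : ℕ} {V W : Opens X} {ω : PreForm O (p + 1) V} (hω : IsForm ω) (h : W ≤ V)
    (ξ : VF O W) : IsForm (PreForm.ev h ξ ω) := hω.1 h ξ

theorem ev_add {p : ℕ} {V W : Opens X} {ω : PreForm O (p + 1) V} (hω : IsForm ω) (h : W ≤ V)
    (ξ η : VF O W) : PreForm.ev h (ξ + η) ω = PreForm.ev h ξ ω + PreForm.ev h η ω := hω.2.1 h ξ η

theorem ev_fsmul {p : ℕ} {V W : Opens X} {ω : PreForm O (p + 1) V} (hω : IsForm ω) (h : W ≤ V)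
    (f : O.sec W) (ξ : VF O W) :
    PreForm.ev h (VF.fsmul f ξ) ω = wedge p (ofFun f) (PreForm.ev h ξ ω) := hω.2.2.1 h f ξ

theorem res_ev {p : ℕ} {V W Z : Opens X} {ω : PreForm O (p + 1) V} (hω : IsForm ω) (h : W ≤ V)
    (h' : Z ≤ W) (ξ : VF O W) :
    res h' (PreForm.ev h ξ ω) = PreForm.ev (h'.trans h) (VF.res h' ξ) ω := hω.2.2.2.1 h h' ξ

theorem alt {p : ℕ} {V W : Opens X} {ω : PreForm O (p + 2) V} (hω : IsForm ω) (h : W ≤ V)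
    (ξ : VF O W) : PreForm.ev le_rfl ξ (PreForm.ev h ξ ω) = 0 := hω.2.2.2.2 h ξ

theorem ev_zero {p : ℕ} {V W : Opens X} {ω : PreForm O (p + 1) V} (hω : IsForm ω) (h : W ≤ V) :
    PreForm.ev h (0 : VF O W) ω = 0 := by
  have := hω.ev_add h 0 0
  rw [add_zero] at this
  exact left_eq_add.mp this

theorem antisymm {p : ℕ} {V W : Opens X} {ω : PreForm O (p + 2) V} (hω : IsForm ω) (h : W ≤ V)
    (ξ η : VF O W) : PreForm.ev le_rfl ξ (PreForm.ev h η ω) = 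
      - PreForm.ev le_rfl η (PreForm.ev h ξ ω) := by
  have := hω.alt h (ξ + η)
  rw [hω.ev_add, map_add, (hω.ev h ξ).ev_add, (hω.ev h η).ev_add, hω.alt, hω.alt, zero_add,
    add_zero, add_comm] at this
  exact eq_neg_of_add_eq_zero_left this

end IsForm

theorem lie_lie : ∀ {p : ℕ} {V : Opens X} (ξ η : VF O V) {ω : PreForm O p V}, IsForm ω →
    lie ξ (lie η ω) - lie η (lie ξ ω) = lie (VF.bracket ξ η) ω
  | 0, _, _, _, _, _ => ext_fun (by simp [VF.act_bracket])
  | p + 1, V, ξ, η, ω, hω => ext_ev fun W h ζ => by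
      have e := lie_lie (p := p) (VF.res h ξ) (VF.res h η) (hω.ev h ζ)
      have j := congrArg (fun z => PreForm.ev h z ω)
        (VF.jacobi (VF.res h ξ) (VF.res h η) ζ)
      simp only [hω.ev_add] at j
      simp only [map_sub, ev_lie, lie_sub, VF.res_bracket, ← e, j]
      abel

theorem lie_vadd : ∀ {p : ℕ} {V : Opens X} (ξ η : VF O V) {ω : PreForm O p V}, IsForm ω →
    lie (ξ + η) ω = lie ξ ω + lie η ω
  | 0, _, _, _, _, _ => ext_fun (by simp [VF.act_add])
  | p + 1, V, ξ, η, ω, hω => ext_ev fun W h ζ => by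
      simp only [map_add, ev_lie, VF.res_add, VF.add_bracket, hω.ev_add,
        lie_vadd (p := p) _ _ (hω.ev h ζ)]
      abel

theorem lie_fsmul_zero {V : Opens X} (f : O.sec V) (ξ : VF O V) (g : PreForm O 0 V) :
    lie (VF.fsmul f ξ) g = wedge 0 (ofFun f) (lie ξ g) :=
  ext_fun (by simp [VF.act_fsmul])

theorem lie_fsmul : ∀ {p : ℕ} {V : Opens X} (f : O.sec V) (ξ : VF O V)
    {ω : PreForm O (p + 1) V}, IsForm ω →
    lie (VF.fsmul f ξ) ω =
      wedge (p + 1) (ofFun f) (lie ξ ω) + wedge (p + 1) (d (ofFun f)) (PreForm.ev le_rfl ξ ω) := by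
  intro p
  induction p with
  | zero =>
    intro V f ξ ω hω
    refine ext_ev fun W h η => ?_
    have e := congrArg (fun z => PreForm.ev h z ω) (VF.fsmul_bracket (VF.res h ξ) η (O.res h f))
    simp only [hω.ev_add, hω.ev_fsmul] at e
    rw [← eq_sub_iff_add_eq] at e
    simp only [map_add, ev_lie, VF.res_fsmul, ev_wedge01, ev_wedge10, ev_d_zero, e,
      lie_fsmul_zero, res_ofFun, wedge_sub_right, hω.res_ev]
    simp only [lie_zero_deg, toFun_ofFun]
    abel
  | succ p ih =>
    intro V f ξ ω hω
    refine ext_ev fun W h η => ?_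
    have e := congrArg (fun z => PreForm.ev h z ω) (VF.fsmul_bracket (VF.res h ξ) η (O.res h f))
    simp only [hω.ev_add, hω.ev_fsmul] at e
    rw [← eq_sub_iff_add_eq] at e
    have a : PreForm.ev h η (PreForm.ev le_rfl ξ ω) =
        - PreForm.ev le_rfl (VF.res h ξ) (PreForm.ev h η ω) := by
      rw [← hω.antisymm, ← hω.res_ev le_rfl h ξ]
      rfl
    simp only [map_add, ev_lie, VF.res_fsmul, ev_wedge01, ev_wedge11, ev_d_zero, e, a,
      ih _ _ (hω.ev h η), res_ofFun, wedge_sub_right, hω.res_ev, lie_zero_deg, toFun_ofFun, res_d,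
      zero_add, pow_one, neg_smul, one_smul]
    rw [show wedge (p + 1) (d (ofFun ((O.res h) f)))
      (-(PreForm.ev le_rfl (VF.res h ξ)) ((PreForm.ev h η) ω)) = - _ from
      (wedgeₗ _ _).map_neg _]
    simp only [wedgeₗ, LinearMap.mk₂_apply, neg_neg]
    abel

theorem lie_d : ∀ {p : ℕ} {V : Opens X} (ξ : VF O V) {ω : PreForm O p V}, IsForm ω →
    lie ξ (d ω) = d (lie ξ ω)
  | 0, _, _, _, _ => ext_ev fun W h η => ext_fun (by simp [VF.act_bracket, VF.res_act])
  | p + 1, V, ξ, ω, hω => ext_ev fun W h η => by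
      have hr : IsForm (res h ω) := ⟨fun h' => hω.ev (h'.trans h), fun h' => hω.ev_add _,
        fun h' => hω.ev_fsmul _, fun h' h'' => hω.res_ev _ _, by
          cases p with
          | zero => trivial
          | succ p => exact fun h' => hω.alt _⟩
      simp only [ev_lie, ev_d_succ, lie_sub, d_sub, lie_d (p := p) _ (hω.ev h η), res_lie,
        ← lie_lie _ _ hr]
      abel

theorem d_d : ∀ {p : ℕ} {V : Opens X} {ω : PreForm O p V}, IsForm ω → d (d ω) = 0
  | 0, _, f, _ => ext_ev fun W h ξ => by
      simp only [ev_d_succ, ev_d_zero, map_zero, res_d,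
        lie_d ξ (ω := res h f) trivial, sub_self]
  | p + 1, V, ω, hω => ext_ev fun W h ξ => by
      have hr : IsForm (res h ω) := ⟨fun h' => hω.ev (h'.trans h), fun h' => hω.ev_add _,
        fun h' => hω.ev_fsmul _, fun h' h'' => hω.res_ev _ _, by
          cases p with
          | zero => trivial
          | succ p => exact fun h' => hω.alt _⟩
      simp only [ev_d_succ, map_zero, res_d, lie_d _ hr, d_sub, d_d (p := p) (hω.ev h ξ)]
      abel

namespace IsForm

theorem zero : ∀ {p : ℕ} {V : Opens X}, IsForm (0 : PreForm O p V)
  | 0, _ => trivial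
  | p + 1, V => ⟨fun _ _ => by rw [map_zero]; exact zero (p := p), fun _ _ _ => by simp,
      fun _ _ _ => by simp [wedge_zero_right], fun _ _ _ => by simp, by
        cases p with
        | zero => trivial
        | succ p => intro W h ξ; simp⟩

theorem add : ∀ {p : ℕ} {V : Opens X} {α β : PreForm O p V}, IsForm α → IsForm β → IsForm (α + β)
  | 0, _, _, _, _, _ => trivial
  | p + 1, V, α, β, hα, hβ => ⟨fun h ξ => by rw [map_add]; exact (hα.ev h ξ).add (hβ.ev h ξ),
      fun h ξ η => by simp only [map_add, hα.ev_add, hβ.ev_add]; abel,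
      fun h f ξ => by simp only [map_add, hα.ev_fsmul, hβ.ev_fsmul, wedge_add_right],
      fun h h' ξ => by simp only [map_add, hα.res_ev, hβ.res_ev], by
        cases p with
        | zero => trivial
        | succ p => intro W h ξ; simp only [map_add, hα.alt, hβ.alt, add_zero]⟩

theorem smul : ∀ {p : ℕ} {V : Opens X} (c : ℂ) {α : PreForm O p V}, IsForm α → IsForm (c • α)
  | 0, _, _, _, _ => trivial
  | p + 1, V, c, α, hα => ⟨fun h ξ => by rw [map_smul]; exact (hα.ev h ξ).smul c,
      fun h ξ η => by simp only [map_smul, hα.ev_add, smul_add],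
      fun h f ξ => by simp only [map_smul, hα.ev_fsmul, wedge_smul_right],
      fun h h' ξ => by simp only [map_smul, hα.res_ev], by
        cases p with
        | zero => trivial
        | succ p => intro W h ξ; simp only [map_smul, hα.alt, smul_zero]⟩

theorem sub {p : ℕ} {V : Opens X} {α β : PreForm O p V} (hα : IsForm α) (hβ : IsForm β) :
    IsForm (α - β) := by
  rw [sub_eq_add_neg, ← neg_one_smul ℂ β]
  exact hα.add (hβ.smul _)

theorem res {p : ℕ} {V W : Opens X} (h : W ≤ V) {α : PreForm O p V} (hα : IsForm α) :
    IsForm (PreForm.res h α) := by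
  cases p with
  | zero => trivial
  | succ p =>
    exact ⟨fun h' => hα.ev (h'.trans h), fun h' => hα.ev_add _,
        fun h' => hα.ev_fsmul _, fun h' h'' => hα.res_ev _ _, by
          cases p with
          | zero => trivial
          | succ p => exact fun h' => hα.alt _⟩

end IsForm

theorem wedge_fun_left {r p q m : ℕ} {V : Opens X} (f : PreForm O 0 V) (α : PreForm O p V)
    (β : PreForm O q V) (hm : p + q = m) :
    wedge r (wedge p f α) β = wedge r f (wedge m α β) :=
  wedge_assoc r f α β (zero_add p) hm

theorem wedge_fun_right {r p q m : ℕ} {V : Opens X} (f : PreForm O 0 V) (α : PreForm O p V)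
    (β : PreForm O q V) (hm : p + q = m) :
    wedge r α (wedge q f β) = wedge r f (wedge m α β) := by
  rw [← wedge_assoc r α f β (add_zero p) (zero_add q), wedge_comm p α f, mul_zero, pow_zero,
    one_smul, wedge_assoc r f α β (zero_add p) hm]

theorem IsForm.wedge (r : ℕ) : ∀ {p q : ℕ} {V : Opens X} {α : PreForm O p V} {β : PreForm O q V},
    IsForm α → IsForm β → p + q = r → IsForm (wedge r α β) := by
  induction r with
  | zero => intros; trivial
  | succ r ih =>
    intro p q V α β hα hβ hr
    rcases p with _ | p <;> rcases q with _ | q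
    · omega
    · obtain rfl : q = r := by omega
      refine ⟨fun h ξ => ?_, fun h ξ η => ?_, fun h f ξ => ?_, fun h h' ξ => ?_, ?_⟩
      · rw [ev_wedge01]; exact ih (hα.res h) (hβ.ev h ξ) (by omega)
      · simp only [ev_wedge01, hβ.ev_add, wedge_add_right]
      · rw [ev_wedge01, hβ.ev_fsmul, wedge_fun_right _ _ _ (zero_add q), ev_wedge01]
      · simp only [ev_wedge01, res_wedge, res_res, hβ.res_ev]
      · cases q with
        | zero => trivial
        | succ q => intro W h ξ; simp only [ev_wedge01, hβ.alt, wedge_zero_right]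
    · obtain rfl : p = r := by omega
      refine ⟨fun h ξ => ?_, fun h ξ η => ?_, fun h f ξ => ?_, fun h h' ξ => ?_, ?_⟩
      · rw [ev_wedge10]; exact ih (hα.ev h ξ) (hβ.res h) (by omega)
      · simp only [ev_wedge10, hα.ev_add, wedge_add_left]
      · rw [ev_wedge10, hα.ev_fsmul, wedge_fun_left _ _ _ (add_zero p), ev_wedge10]
      · simp only [ev_wedge10, res_wedge, res_res, hα.res_ev]
      · cases p with
        | zero => trivial
        | succ p => intro W h ξ; simp only [ev_wedge10, hα.alt, wedge_zero_left]
    · refine ⟨fun h ξ => ?_, fun h ξ η => ?_, fun h f ξ => ?_, fun h h' ξ => ?_, ?_⟩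
      · rw [ev_wedge11]
        exact (ih (hα.ev h ξ) (hβ.res h) (by omega)).add
          ((ih (hα.res h) (hβ.ev h ξ) (by omega)).smul _)
      · simp only [ev_wedge11, hα.ev_add, hβ.ev_add, wedge_add_left, wedge_add_right, smul_add]
        abel
      · rw [ev_wedge11, hα.ev_fsmul, hβ.ev_fsmul,
          wedge_fun_left _ _ _ (show p + (q + 1) = r by omega),
          wedge_fun_right _ _ _ (show p + 1 + q = r by omega), ev_wedge11,
          wedge_add_right, wedge_smul_right]
      · simp only [ev_wedge11, map_add, map_smul, res_wedge, res_res, hα.res_ev, hβ.res_ev]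
      · cases r with
        | zero => trivial
        | succ r =>
          intro W h ξ
          have e1 : (-1 : ℂ) ^ (p + 1) = - (-1 : ℂ) ^ p := by rw [pow_succ]; simp
          rcases p with _ | p <;> rcases q with _ | q
          · simp only [ev_wedge11, map_add, map_smul, map_neg, ev_wedge01, ev_wedge10, res_res,
              ev_res, res_self, e1, pow_zero, neg_smul, one_smul]
            abel
          · simp only [ev_wedge11, map_add, map_smul, map_neg, ev_wedge01, res_res, hβ.alt, ev_res,
              res_self, wedge_zero_right, smul_zero, add_zero, e1, pow_zero, neg_smul, one_smul]
            abel
          · simp only [ev_wedge11, map_add, map_smul, map_neg, ev_wedge10, res_res, hα.alt, ev_res,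
              res_self, wedge_zero_left, smul_zero, add_zero, zero_add, e1, neg_smul]
            abel
          · simp only [ev_wedge11, map_add, map_smul, map_neg, res_res, hα.alt, hβ.alt, ev_res,
              res_self, wedge_zero_left, wedge_zero_right, smul_zero, add_zero, zero_add, e1,
              neg_smul, smul_add, smul_neg, neg_add, neg_neg]
            abel

theorem IsForm.lie : ∀ {p : ℕ} {V : Opens X} (ξ : VF O V) {ω : PreForm O p V}, IsForm ω →
    IsForm (lie ξ ω)
  | 0, _, _, _, _ => trivial
  | p + 1, V, ξ, ω, hω => by
      refine ⟨fun h η => ?_, fun h η ζ => ?_, fun h f η => ?_, fun h h' η => ?_, ?_⟩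
      · rw [ev_lie]; exact (IsForm.lie (p := p) _ (hω.ev h η)).sub (hω.ev h _)
      · simp only [ev_lie, hω.ev_add, VF.bracket_add, lie_add]; abel
      · simp only [ev_lie, hω.ev_add, hω.ev_fsmul, VF.bracket_fsmul, lie_wedge, lie_zero_deg,
          toFun_ofFun, wedge_sub_right]
        abel
      · simp only [ev_lie, map_sub, res_lie, hω.res_ev, VF.res_res, VF.res_bracket]
      · cases p with
        | zero => trivial
        | succ p =>
          intro W h η
          have e := ev_lie le_rfl η (VF.res h ξ) (PreForm.ev h η ω)
          rw [hω.alt, lie_zero, zero_sub, VF.res_self] at e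
          rw [ev_lie, map_sub, e, hω.antisymm h η]
          abel

theorem IsForm.d : ∀ {p : ℕ} {V : Opens X} {ω : PreForm O p V}, IsForm ω → IsForm (d ω)
  | 0, V, g, _ => by
      refine ⟨fun h η => trivial, fun h η ζ => ?_, fun h f η => ?_, fun h h' η => ?_, trivial⟩
      · simp only [ev_d_zero]; exact lie_vadd _ _ trivial
      · simp only [ev_d_zero, lie_fsmul_zero]
      · simp only [ev_d_zero, res_lie, res_res]
  | p + 1, V, ω, hω => by
      refine ⟨fun h η => ?_, fun h η ζ => ?_, fun h f η => ?_, fun h h' η => ?_, ?_⟩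
      · rw [ev_d_succ]; exact ((hω.res h).lie η).sub (IsForm.d (p := p) (hω.ev h η))
      · simp only [ev_d_succ, lie_vadd _ _ (hω.res h), hω.ev_add, d_add]; abel
      · simp only [ev_d_succ, lie_fsmul _ _ (hω.res h), hω.ev_fsmul, wedge_sub_right, ev_res]
        rw [d_wedge p _ _ (zero_add p), pow_zero, one_smul]
        abel
      · simp only [ev_d_succ, map_sub, res_lie, res_d, hω.res_ev, res_res]
      · intro W h η
        have e := ev_lie le_rfl η η (PreForm.res h ω)
        rw [VF.res_self, VF.bracket_self, (hω.res h).ev_zero, sub_zero] at e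
        simp only [ev_d_succ, map_sub, e, ev_res]
        cases p with
        | zero => simp only [ev_d_zero, res_self, sub_self]
        | succ p => simp only [ev_d_succ, res_self, hω.alt, d_zero, sub_zero, sub_self]

theorem separated : ∀ {p : ℕ} {V : Opens X} {ι : Type u} {W : ι → Opens X} (hW : ∀ a, W a ≤ V)
    (_ : ∀ x ∈ V, ∃ a, x ∈ W a) {t t' : PreForm O p V} (_ : IsForm t) (_ : IsForm t')
    (_ : ∀ a, res (hW a) t = res (hW a) t'), t = t'
  | 0, V, ι, W, hW, cov, t, t', _, _, h => by
      obtain ⟨u, _, hu⟩ := O.glue V ι W hW cov (fun a => O.res (hW a) (toFun t)) (by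
        intro a b Z ha hb
        exact (O.res_res _ _ _).trans (O.res_res _ _ _).symm)
      exact (hu _ fun a => rfl).trans (hu _ fun a => (h a).symm).symm
  | p + 1, V, ι, W, hW, cov, t, t', ht, ht', h => ext_ev fun Z hZ ξ => by
      refine separated (p := p) (W := fun a => Z ⊓ W a) (fun a => inf_le_left) ?_ (ht.ev hZ ξ)
        (ht'.ev hZ ξ) ?_
      · intro x hx
        obtain ⟨a, ha⟩ := cov x (hZ hx)
        exact ⟨a, hx, ha⟩
      · intro a
        have e := congrArg (PreForm.ev (inf_le_right : Z ⊓ W a ≤ W a) (VF.res inf_le_left ξ)) (h a)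
        rw [ev_res, ev_res] at e
        rw [ht.res_ev, ht'.res_ev]
        exact e

theorem exists_glue : ∀ {p : ℕ} {V : Opens X} {ι : Type u} {W : ι → Opens X} (hW : ∀ a, W a ≤ V)
    (_ : ∀ x ∈ V, ∃ a, x ∈ W a) (s : ∀ a, PreForm O p (W a)) (_ : ∀ a, IsForm (s a))
    (_ : ∀ (a b : ι) (Z : Opens X) (ha : Z ≤ W a) (hb : Z ≤ W b), res ha (s a) = res hb (s b)),
    ∃ t : PreForm O p V, IsForm t ∧ ∀ a, res (hW a) t = s a
  | 0, V, ι, W, hW, cov, s, _, h => by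
      obtain ⟨t, ht, _⟩ := O.glue V ι W hW cov (fun a => toFun (s a)) h
      exact ⟨t, trivial, ht⟩
  | p + 1, V, ι, W, hW, cov, s, hs, h => by
      have cov' : ∀ {Z : Opens X} (hZ : Z ≤ V), ∀ x ∈ Z, ∃ a, x ∈ Z ⊓ W a := by
        intro Z hZ x hx
        obtain ⟨a, ha⟩ := cov x (hZ hx)
        exact ⟨a, hx, ha⟩
      have key : ∀ {Z : Opens X} (hZ : Z ≤ V) (ξ : VF O Z), ∃ t : PreForm O p Z, IsForm t ∧
          ∀ a, res (inf_le_left : Z ⊓ W a ≤ Z) t =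
            ev (inf_le_right : Z ⊓ W a ≤ W a) (VF.res inf_le_left ξ) (s a) := by
        intro Z hZ ξ
        refine exists_glue (p := p) (fun a => inf_le_left) (cov' hZ) _
          (fun a => (hs a).ev _ _) ?_
        intro a b Z' ha hb
        rw [(hs a).res_ev, (hs b).res_ev, VF.res_res, VF.res_res]
        exact congrArg (PreForm.ev le_rfl (VF.res (ha.trans inf_le_left) ξ))
          (h a b Z' (ha.trans inf_le_right) (hb.trans inf_le_right))
      choose F hF hFr using @key
      have uniq : ∀ {Z : Opens X} (hZ : Z ≤ V) (ξ : VF O Z) (t : PreForm O p Z), IsForm t →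
          (∀ a, res (inf_le_left : Z ⊓ W a ≤ Z) t =
            ev (inf_le_right : Z ⊓ W a ≤ W a) (VF.res inf_le_left ξ) (s a)) → F hZ ξ = t :=
        fun hZ ξ t ht h' => separated (fun a => inf_le_left) (cov' hZ) (hF hZ ξ) ht
          fun a => (hFr hZ ξ a).trans (h' a).symm
      refine ⟨mk fun hZ ξ => F hZ ξ, ⟨fun hZ ξ => hF hZ ξ, fun hZ ξ η => ?_, fun hZ f ξ => ?_,
        fun hZ h' ξ => ?_, ?_⟩, fun a => ext_ev fun Z hZ ξ => ?_⟩
      · simp only [ev_mk]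
        refine uniq hZ _ _ ((hF hZ ξ).add (hF hZ η)) fun a => ?_
        rw [map_add, hFr, hFr, VF.res_add, (hs a).ev_add]
      · simp only [ev_mk]
        refine uniq hZ _ _ (IsForm.wedge p (α := ofFun f) trivial (hF hZ ξ) (zero_add p))
          fun a => ?_
        rw [res_wedge, hFr, VF.res_fsmul, (hs a).ev_fsmul, res_ofFun]
      · simp only [ev_mk]
        refine (uniq (h'.trans hZ) (VF.res h' ξ) _ ((hF hZ ξ).res h') fun a => ?_).symm
        have e := congrArg (PreForm.res (inf_le_inf_right (W a) h')) (hFr hZ ξ a)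
        rw [res_res, (hs a).res_ev] at e
        rw [res_res]
        exact e
      · cases p with
        | zero => trivial
        | succ p =>
          intro Z hZ ξ
          simp only [ev_mk]
          refine separated (fun a => inf_le_left) (cov' hZ) ((hF hZ ξ).ev le_rfl ξ) IsForm.zero
            fun a => ?_
          rw [(hF hZ ξ).res_ev, map_zero]
          have e := congrArg (PreForm.ev le_rfl (VF.res (inf_le_left : Z ⊓ W a ≤ Z) ξ))
            (hFr hZ ξ a)
          rw [ev_res, (hs a).alt] at e
          exact e
      · rw [ev_res, ev_mk]
        refine uniq _ ξ _ ((hs a).ev hZ ξ) fun b => ?_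
        rw [(hs a).res_ev]
        exact congrArg (PreForm.ev le_rfl (VF.res inf_le_left ξ))
          (h a b (Z ⊓ W b) (inf_le_left.trans hZ) inf_le_right)

end PreForm

/-- The space `Ω^p(V)` of differential `p`-forms on `V`. -/
def Form (O : AlgSheaf X) (p : ℕ) (V : Opens X) : Submodule ℂ (PreForm O p V) where
  carrier := {ω | PreForm.IsForm ω}
  add_mem' := PreForm.IsForm.add
  zero_mem' := PreForm.IsForm.zero
  smul_mem' := fun c _ h => PreForm.IsForm.smul c h

end Forms

section DG

/-- A sheaf of commutative differential graded `ℂ`-algebras on `X` (so that `X` with such a sheaf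
is a differential graded manifold in the wide sense).  `sec i V` are the sections of degree `i`
over `V`; the degrees of products and differentials are specified by proofs of equalities. -/
structure CdgaSheaf (X : Type u) [TopologicalSpace X] where
  sec : ℤ → Opens X → Type u
  [grp : ∀ i V, AddCommGroup (sec i V)]
  [mod : ∀ i V, Module ℂ (sec i V)]
  res : ∀ {i : ℤ} {V W : Opens X}, W ≤ V → sec i V →ₗ[ℂ] sec i W
  one : ∀ V : Opens X, sec 0 V
  mul : ∀ {V : Opens X} {i j k : ℤ}, i + j = k → sec i V →ₗ[ℂ] sec j V →ₗ[ℂ] sec k V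
  d : ∀ {V : Opens X} {i j : ℤ}, i + 1 = j → sec i V →ₗ[ℂ] sec j V
  res_self : ∀ {i : ℤ} {V : Opens X} (a : sec i V), res (le_refl V) a = a
  res_res : ∀ {i : ℤ} {V W Z : Opens X} (h : W ≤ V) (h' : Z ≤ W) (a : sec i V),
    res h' (res h a) = res (h'.trans h) a
  glue : ∀ i : ℤ, UniqueGluing id (sec i) fun h => res h
  res_one : ∀ {V W : Opens X} (h : W ≤ V), res h (one V) = one W
  res_mul : ∀ {V W : Opens X} (hW : W ≤ V) {i j k : ℤ} (h : i + j = k) (a : sec i V)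
    (b : sec j V), res hW (mul h a b) = mul h (res hW a) (res hW b)
  res_d : ∀ {V W : Opens X} (hW : W ≤ V) {i j : ℤ} (h : i + 1 = j) (a : sec i V),
    res hW (d h a) = d h (res hW a)
  one_mul : ∀ {V : Opens X} {i : ℤ} (a : sec i V), mul (zero_add i) (one V) a = a
  mul_comm : ∀ {V : Opens X} {i j k : ℤ} (h : i + j = k) (h' : j + i = k) (a : sec i V)
    (b : sec j V), mul h a b = (-1 : ℂ) ^ (i * j) • mul h' b a
  mul_assoc : ∀ {V : Opens X} {i j l m n k : ℤ} (h₁ : i + j = m) (h₂ : m + l = k)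
    (h₃ : j + l = n) (h₄ : i + n = k) (a : sec i V) (b : sec j V) (c : sec l V),
    mul h₂ (mul h₁ a b) c = mul h₄ a (mul h₃ b c)
  d_mul : ∀ {V : Opens X} {i j k i' j' k' : ℤ} (h : i + j = k) (hi : i + 1 = i')
    (hj : j + 1 = j') (hk : k + 1 = k') (h₁ : i' + j = k') (h₂ : i + j' = k') (a : sec i V)
    (b : sec j V),
    d hk (mul h a b) = mul h₁ (d hi a) b + (-1 : ℂ) ^ i • mul h₂ a (d hj b)
  d_d : ∀ {V : Opens X} {i j k : ℤ} (h : i + 1 = j) (h' : j + 1 = k) (a : sec i V),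
    d h' (d h a) = 0

attribute [instance] CdgaSheaf.grp CdgaSheaf.mod

end DG

section DeRham

variable (O : AlgSheaf X)

/-- The sections of the de Rham complex in degree `i`: the `i`-forms, and zero if `i < 0`. -/
def DRSec : ℤ → Opens X → Type u
  | .ofNat p, V => Form O p V
  | .negSucc _, _ => PUnit

namespace DRSec

instance addCommGroup : ∀ (i : ℤ) (V : Opens X), AddCommGroup (DRSec O i V)
  | .ofNat p, V => inferInstanceAs (AddCommGroup (Form O p V))
  | .negSucc _, _ => inferInstanceAs (AddCommGroup PUnit)

instance module : ∀ (i : ℤ) (V : Opens X), Module ℂ (DRSec O i V)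
  | .ofNat p, V => inferInstanceAs (Module ℂ (Form O p V))
  | .negSucc _, _ =>
    { smul := fun _ _ => PUnit.unit
      one_smul := fun _ => rfl
      mul_smul := fun _ _ _ => rfl
      smul_zero := fun _ => rfl
      smul_add := fun _ _ _ => rfl
      add_smul := fun _ _ _ => rfl
      zero_smul := fun _ => rfl }

instance (n : ℕ) (V : Opens X) : Subsingleton (DRSec O (.negSucc n) V) :=
  inferInstanceAs (Subsingleton PUnit)

variable {O}

/-- The form underlying a section of non-negative degree. -/
def val {p : ℕ} {V : Opens X} : DRSec O (.ofNat p) V →ₗ[ℂ] PreForm O p V :=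
  (Form O p V).subtype

/-- A form, as a section of the de Rham complex. -/
def of {p : ℕ} {V : Opens X} (ω : PreForm O p V) (h : ω.IsForm) : DRSec O (.ofNat p) V :=
  (⟨ω, h⟩ : Form O p V)

theorem isForm {p : ℕ} {V : Opens X} (a : DRSec O (.ofNat p) V) : (val a).IsForm :=
  Subtype.property (p := fun ω => ω ∈ Form O p V) a

@[simp] theorem val_of {p : ℕ} {V : Opens X} (ω : PreForm O p V) (h : ω.IsForm) :
    val (of ω h) = ω := rfl

theorem ext {p : ℕ} {V : Opens X} {a b : DRSec O (.ofNat p) V} (h : val a = val b) : a = b :=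
  Subtype.ext (p := fun ω => ω ∈ Form O p V) h

/-- Restriction of forms. -/
def res : ∀ {i : ℤ} {V W : Opens X}, W ≤ V → DRSec O i V →ₗ[ℂ] DRSec O i W
  | .ofNat _, _, _, h =>
    { toFun := fun a => of (PreForm.res h (val a)) ((isForm a).res h)
      map_add' := fun _ _ => ext ((PreForm.res h).map_add _ _)
      map_smul' := fun _ _ => ext ((PreForm.res h).map_smul _ _) }
  | .negSucc _, _, _, _ => 0

/-- The exterior product of forms. -/
def mul : ∀ {V : Opens X} {i j k : ℤ}, i + j = k →
    DRSec O i V →ₗ[ℂ] DRSec O j V →ₗ[ℂ] DRSec O k V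
  | _, .ofNat _, .ofNat _, .ofNat r, h =>
    LinearMap.mk₂ ℂ
      (fun a b => of (PreForm.wedge r (val a) (val b))
        (PreForm.IsForm.wedge r (isForm a) (isForm b) (Int.ofNat.inj h)))
      (fun _ _ _ => ext (PreForm.wedge_add_left _ _ _ _))
      (fun _ _ _ => ext (PreForm.wedge_smul_left _ _ _ _))
      (fun _ _ _ => ext (PreForm.wedge_add_right _ _ _ _))
      (fun _ _ _ => ext (PreForm.wedge_smul_right _ _ _ _))
  | _, .ofNat _, .ofNat _, .negSucc _, _ => 0
  | _, .ofNat _, .negSucc _, _, _ => 0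
  | _, .negSucc _, _, _, _ => 0

/-- The de Rham differential, from degree `p` to degree `q = p + 1`. -/
def dForm {V : Opens X} {p : ℕ} : ∀ {q : ℕ}, p + 1 = q →
    DRSec O (.ofNat p) V →ₗ[ℂ] DRSec O (.ofNat q) V
  | _, rfl =>
    { toFun := fun a => of (PreForm.d (val a)) (isForm a).d
      map_add' := fun _ _ => ext (PreForm.d_add _ _)
      map_smul' := fun _ _ => ext (PreForm.d_smul _ _) }

/-- The de Rham differential. -/
def d : ∀ {V : Opens X} {i j : ℤ}, i + 1 = j → DRSec O i V →ₗ[ℂ] DRSec O j V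
  | _, .ofNat _, .ofNat _, h => dForm (Int.ofNat.inj h)
  | _, .ofNat _, .negSucc _, _ => 0
  | _, .negSucc _, _, _ => 0

theorem val_res {p : ℕ} {V W : Opens X} (h : W ≤ V) (a : DRSec O (.ofNat p) V) :
    val (res h a) = PreForm.res h (val a) := rfl

theorem val_mul {p q r : ℕ} {V : Opens X} (h : Int.ofNat p + Int.ofNat q = Int.ofNat r)
    (a : DRSec O (.ofNat p) V) (b : DRSec O (.ofNat q) V) :
    val (mul h a b) = PreForm.wedge r (val a) (val b) := rfl

theorem val_d {p : ℕ} {V : Opens X} (h : Int.ofNat p + 1 = Int.ofNat (p + 1))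
    (a : DRSec O (.ofNat p) V) : val (d h a) = PreForm.d (val a) := rfl

theorem mul_neg_left {n : ℕ} {j k : ℤ} {V : Opens X} (h : Int.negSucc n + j = k) :
    mul (O := O) (V := V) h = 0 := by simp [mul]

theorem mul_neg_right {n : ℕ} {i k : ℤ} {V : Opens X} (h : i + Int.negSucc n = k)
    (a : DRSec O i V) : mul (O := O) (V := V) h a = 0 := by
  cases i <;> simp [mul]

theorem sign_ofNat (p q : ℕ) : (-1 : ℂ) ^ (Int.ofNat p * Int.ofNat q) = (-1 : ℂ) ^ (p * q) :=
  zpow_natCast (-1 : ℂ) (p * q)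

theorem d_neg {n : ℕ} {j : ℤ} {V : Opens X} (h : Int.negSucc n + 1 = j) :
    d (O := O) (V := V) h = 0 := by simp [d]

end DRSec

/-- The sheaf of commutative differential graded algebras given by the de Rham complex of
`(X, O)`; this is the structure sheaf of the differential graded manifold `X^♯`. -/
def deRham : CdgaSheaf X where
  sec := DRSec O
  res := DRSec.res
  one V := DRSec.of (PreForm.ofFun 1) trivial
  mul := DRSec.mul
  d := DRSec.d
  res_self {i V} a := by
    cases i with
    | ofNat p => exact DRSec.ext (PreForm.res_self _)
    | negSucc n => exact Subsingleton.elim _ _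
  res_res {i V W Z} h h' a := by
    cases i with
    | ofNat p => exact DRSec.ext (PreForm.res_res _ _ _)
    | negSucc n => exact Subsingleton.elim _ _
  glue i := by
    cases i with
    | ofNat p =>
      intro V ι W hW cov s hs
      obtain ⟨t, ht, hts⟩ := PreForm.exists_glue hW cov (fun a => DRSec.val (s a))
        (fun a => DRSec.isForm (s a))
        (fun a b Z ha hb => congrArg DRSec.val (hs a b Z ha hb))
      refine ⟨DRSec.of t ht, fun a => DRSec.ext (hts a), fun t' ht' => DRSec.ext ?_⟩
      exact PreForm.separated hW cov (DRSec.isForm t') ht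
        fun a => (congrArg DRSec.val (ht' a)).trans (hts a).symm
    | negSucc n =>
      intro V ι W hW cov s hs
      exact ⟨0, fun a => Subsingleton.elim _ _, fun _ _ => Subsingleton.elim _ _⟩
  res_one {V W} h := DRSec.ext (congrArg PreForm.ofFun (map_one (O.res h)))
  res_mul {V W} hW {i j k} h a b := by
    rcases i with p | n
    · rcases j with q | n
      · rcases k with r | n
        · exact DRSec.ext (PreForm.res_wedge _ _ _ _)
        · exact Subsingleton.elim _ _
      · simp [DRSec.mul_neg_right]
    · simp [DRSec.mul_neg_left]
  res_d {V W} hW {i j} h a := by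
    rcases i with p | n
    · rcases j with q | n
      · obtain rfl : p + 1 = q := Int.ofNat.inj h
        exact DRSec.ext (PreForm.res_d _ _)
      · exact Subsingleton.elim _ _
    · simp [DRSec.d_neg]
  one_mul {V i} a := by
    cases i with
    | ofNat p =>
      exact DRSec.ext (PreForm.one_wedge _)
    | negSucc n => exact Subsingleton.elim _ _
  mul_comm {V i j k} h h' a b := by
    rcases i with p | n
    · rcases j with q | n
      · rcases k with r | n
        · refine DRSec.ext ?_
          rw [map_smul, DRSec.val_mul, DRSec.val_mul, DRSec.sign_ofNat]
          exact PreForm.wedge_comm _ _ _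
        · exact Subsingleton.elim _ _
      · simp [DRSec.mul_neg_right, DRSec.mul_neg_left]
    · simp [DRSec.mul_neg_left, DRSec.mul_neg_right]
  mul_assoc {V i j l m n k} h₁ h₂ h₃ h₄ a b c := by
    rcases i with p | i
    · rcases j with q | j
      · rcases l with s | l
        · obtain rfl : Int.ofNat (p + q) = m := h₁
          obtain rfl : Int.ofNat (q + s) = n := h₃
          obtain rfl : Int.ofNat (p + q + s) = k := h₂
          exact DRSec.ext (PreForm.wedge_assoc _ _ _ _ rfl rfl)
        · simp [DRSec.mul_neg_right]
      · simp [DRSec.mul_neg_right, DRSec.mul_neg_left]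
    · simp [DRSec.mul_neg_left]
  d_mul {V i j k i' j' k'} h hi hj hk h₁ h₂ a b := by
    rcases i with p | i
    · rcases j with q | j
      · obtain rfl : Int.ofNat (p + q) = k := h
        obtain rfl : Int.ofNat (p + 1) = i' := hi
        obtain rfl : Int.ofNat (q + 1) = j' := hj
        obtain rfl : Int.ofNat (p + q + 1) = k' := hk
        refine DRSec.ext ?_
        have e := PreForm.d_wedge (p + q) (DRSec.val a) (DRSec.val b) rfl
        rw [← zpow_natCast] at e
        exact e
      · obtain rfl : Int.ofNat (p + 1) = i' := hi
        rcases j with _ | j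
        · simp only [DRSec.mul_neg_right, Subsingleton.elim b 0, map_zero, smul_zero, add_zero]
        · simp only [DRSec.mul_neg_right, Subsingleton.elim b 0, map_zero, smul_zero, add_zero]
    · simp only [DRSec.mul_neg_left, Subsingleton.elim a 0, map_zero, smul_zero, add_zero,
        LinearMap.zero_apply]
  d_d {V i j k} h h' a := by
    rcases i with p | i
    · obtain rfl : Int.ofNat (p + 1) = j := h
      obtain rfl : Int.ofNat (p + 2) = k := h'
      exact DRSec.ext (PreForm.d_d (DRSec.isForm a))
    · simp only [Subsingleton.elim a 0, map_zero]

end DeRham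

section Tangent

variable (A : CdgaSheaf X)

/-- The graded derivations of degree `k` of the sheaf of graded algebras `A|_V`.  Such a derivation
consists of maps `A^i(W) → A^j(W)` for all `W ≤ V` and `i + k = j`. -/
def derSubmodule (k : ℤ) (V : Opens X) :
    Submodule ℂ (∀ (W : Set.Iic V) (i : ℤ) (j : {j : ℤ // i + k = j}),
      A.sec i W.1 →ₗ[ℂ] A.sec j.1 W.1) where
  carrier := {D |
    (∀ (W W' : Opens X) (h : W ≤ V) (h' : W' ≤ W) (i j : ℤ) (hj : i + k = j) (a : A.sec i W),
      A.res h' (D ⟨W, h⟩ i ⟨j, hj⟩ a) = D ⟨W', h'.trans h⟩ i ⟨j, hj⟩ (A.res h' a)) ∧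
    (∀ (W : Opens X) (h : W ≤ V) (i j l i' j' l' : ℤ) (hl : i + j = l) (hi' : i + k = i')
      (hj' : j + k = j') (hl' : l + k = l') (h₁ : i' + j = l') (h₂ : i + j' = l')
      (a : A.sec i W) (b : A.sec j W),
      D ⟨W, h⟩ l ⟨l', hl'⟩ (A.mul hl a b) =
        A.mul h₁ (D ⟨W, h⟩ i ⟨i', hi'⟩ a) b +
          (-1 : ℂ) ^ (k * i) • A.mul h₂ a (D ⟨W, h⟩ j ⟨j', hj'⟩ b))}
  add_mem' := by
    rintro D E ⟨hD, hD'⟩ ⟨hE, hE'⟩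
    refine ⟨fun W W' h h' i j hj a => ?_,
      fun W h i j l i' j' l' hl hi' hj' hl' h₁ h₂ a b => ?_⟩
    · simp only [Pi.add_apply, LinearMap.add_apply, map_add, hD W W' h h', hE W W' h h']
    · simp only [Pi.add_apply, LinearMap.add_apply, map_add, smul_add,
        hD' W h i j l i' j' l' hl hi' hj' hl' h₁ h₂, hE' W h i j l i' j' l' hl hi' hj' hl' h₁ h₂]
      abel
  zero_mem' := ⟨by intros; simp, by intros; simp⟩
  smul_mem' := by
    rintro c D ⟨hD, hD'⟩
    refine ⟨fun W W' h h' i j hj a => ?_,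
      fun W h i j l i' j' l' hl hi' hj' hl' h₁ h₂ a b => ?_⟩
    · simp only [Pi.smul_apply, LinearMap.smul_apply, map_smul, hD W W' h h']
    · simp only [Pi.smul_apply, LinearMap.smul_apply, map_smul, smul_add,
        hD' W h i j l i' j' l' hl hi' hj' hl' h₁ h₂, smul_comm c]

/-- The vector fields of degree `k` on the open set `V`, i.e. the sections of degree `k` of the
tangent sheaf of `(X, A)`: the graded derivations of degree `k` of `A|_V`. -/
def Der (k : ℤ) (V : Opens X) : Type u := derSubmodule A k V

instance (k : ℤ) (V : Opens X) : AddCommGroup (Der A k V) :=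
  inferInstanceAs (AddCommGroup (derSubmodule A k V))

instance (k : ℤ) (V : Opens X) : Module ℂ (Der A k V) :=
  inferInstanceAs (Module ℂ (derSubmodule A k V))

variable {A}

namespace Der

/-- The action of a vector field on the functions on a smaller open set. -/
def on {V W : Opens X} {k i j : ℤ} (D : Der A k V) (hW : W ≤ V) (h : i + k = j) :
    A.sec i W →ₗ[ℂ] A.sec j W := D.1 ⟨W, hW⟩ i ⟨j, h⟩

theorem res_on {V W W' : Opens X} {k i j : ℤ} (D : Der A k V) (hW : W ≤ V) (h' : W' ≤ W)
    (h : i + k = j) (a : A.sec i W) :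
    A.res h' (on D hW h a) = on D (h'.trans hW) h (A.res h' a) := D.2.1 W W' hW h' i j h a

theorem on_mul {V W : Opens X} {k i j l i' j' l' : ℤ} (D : Der A k V) (hW : W ≤ V)
    (hl : i + j = l) (hi' : i + k = i') (hj' : j + k = j') (hl' : l + k = l') (h₁ : i' + j = l')
    (h₂ : i + j' = l') (a : A.sec i W) (b : A.sec j W) :
    on D hW hl' (A.mul hl a b) = A.mul h₁ (on D hW hi' a) b +
      (-1 : ℂ) ^ (k * i) • A.mul h₂ a (on D hW hj' b) :=
  D.2.2 W hW i j l i' j' l' hl hi' hj' hl' h₁ h₂ a b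

/-- Construction of a vector field from its components. -/
def mk {V : Opens X} {k : ℤ}
    (F : ∀ {W : Opens X}, W ≤ V → ∀ {i j : ℤ}, i + k = j → A.sec i W →ₗ[ℂ] A.sec j W)
    (hF : ∀ {W W' : Opens X} (hW : W ≤ V) (h' : W' ≤ W) {i j : ℤ} (h : i + k = j)
      (a : A.sec i W), A.res h' (F hW h a) = F (h'.trans hW) h (A.res h' a))
    (hF' : ∀ {W : Opens X} (hW : W ≤ V) {i j l i' j' l' : ℤ} (hl : i + j = l) (hi' : i + k = i')
      (hj' : j + k = j') (hl' : l + k = l') (h₁ : i' + j = l') (h₂ : i + j' = l')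
      (a : A.sec i W) (b : A.sec j W),
      F hW hl' (A.mul hl a b) = A.mul h₁ (F hW hi' a) b +
        (-1 : ℂ) ^ (k * i) • A.mul h₂ a (F hW hj' b)) : Der A k V :=
  ⟨fun W _ j => F W.2 j.2, fun _ _ hW h' _ _ h a => hF hW h' h a,
    fun _ hW _ _ _ _ _ _ hl hi' hj' hl' h₁ h₂ a b => hF' hW hl hi' hj' hl' h₁ h₂ a b⟩

/-- The action of a vector field on functions. -/
def act {V : Opens X} {k i j : ℤ} (D : Der A k V) (h : i + k = j) : A.sec i V →ₗ[ℂ] A.sec j V :=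
  on D le_rfl h

/-- Restriction of a vector field to a smaller open set. -/
def res {k : ℤ} {V W : Opens X} (h : W ≤ V) : Der A k V →ₗ[ℂ] Der A k W where
  toFun D := mk (fun hZ _ _ hj => on D (hZ.trans h) hj) (fun _ _ _ _ _ _ => res_on D _ _ _ _)
    fun _ _ _ _ _ _ _ _ _ _ _ _ _ _ _ => on_mul D _ _ _ _ _ _ _ _ _
  map_add' _ _ := rfl
  map_smul' _ _ := rfl

theorem sign_mul_self (n : ℤ) : (-1 : ℂ) ^ n * (-1 : ℂ) ^ n = 1 := by
  rw [← mul_zpow]; norm_num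

/-- The product of a function `f` of degree `i` and a vector field: `(f D)(a) = f D(a)`. -/
def fsmul {V : Opens X} {i k l : ℤ} (h : i + k = l) (f : A.sec i V) (D : Der A k V) :
    Der A l V :=
  mk (fun hW p _ hq => A.mul (j := p + k) (by omega) (A.res hW f) ∘ₗ on D hW rfl)
    (fun hW h' _ _ hq a => by
      simp only [LinearMap.comp_apply, A.res_mul, res_on, A.res_res])
    (fun hW p q r p' q' r' hr hp' hq' hr' h₁ h₂ a b => by
      simp only [LinearMap.comp_apply]
      rw [on_mul D hW hr rfl rfl rfl (by omega) (by omega), map_add, map_smul]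
      congr 1
      · exact (A.mul_assoc _ _ _ _ _ _ _).symm
      · rw [← A.mul_assoc (i := i) (j := p) (l := q + k) (m := p + i) (n := r + k) (k := r') (by omega)
            (by omega) (by omega) (by omega),
          A.mul_comm _ rfl, map_smul, LinearMap.smul_apply, smul_smul,
          A.mul_assoc (n := q') rfl (by omega) (by omega) (by omega)]
        congr 1
        rw [← zpow_add₀ (by norm_num)]
        congr 1
        subst h
        ring)

/-- The graded commutator of vector fields `[D, E] = D E - (-1)^{|D||E|} E D`. -/
def bracket {V : Opens X} {k l m : ℤ} (h : k + l = m) (D : Der A k V) (E : Der A l V) :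
    Der A m V :=
  mk (fun hW p q hq => on D hW (i := p + l) (by omega) ∘ₗ on E hW rfl -
        (-1 : ℂ) ^ (k * l) • on E hW (i := p + k) (by omega) ∘ₗ on D hW rfl)
    (fun hW h' _ _ hq a => by
      simp only [LinearMap.sub_apply, LinearMap.smul_apply, LinearMap.comp_apply, map_sub, map_smul,
        res_on])
    (fun hW p q r p' q' r' hr hp' hq' hr' h₁ h₂ a b => by
      subst h
      simp only [LinearMap.sub_apply, LinearMap.smul_apply, LinearMap.comp_apply, map_sub, map_smul]
      rw [on_mul D hW hr rfl rfl rfl (by omega) (by omega),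
        on_mul E hW hr rfl rfl rfl (by omega) (by omega)]
      simp only [map_add, map_smul]
      rw [on_mul D hW (l' := r') (i' := p') (j' := q + k) (i := p + l) (j := q)
          (by omega) (by omega) rfl (by omega) (by omega) (by omega),
        on_mul D hW (l' := r') (i' := p + k) (j' := q') (i := p) (j := q + l)
          (by omega) rfl (by omega) (by omega) (by omega) (by omega),
        on_mul E hW (l' := r') (i' := p') (j' := q + l) (i := p + k) (j := q)
          (by omega) (by omega) rfl (by omega) (by omega) (by omega),
        on_mul E hW (l' := r') (i' := p + l) (j' := q') (i := p) (j := q + k)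
          (by omega) rfl (by omega) (by omega) (by omega) (by omega)]
      simp only [LinearMap.sub_apply, LinearMap.smul_apply, smul_add, smul_sub, smul_smul,
        mul_add, add_mul, zpow_add₀ (show (-1 : ℂ) ≠ 0 by norm_num)]
      have e : (-1 : ℂ) ^ (k * l) * (-1 : ℂ) ^ (k * l) = 1 := sign_mul_self _
      rw [mul_comm l k]
      generalize (-1 : ℂ) ^ (k * l) = s at *
      generalize (-1 : ℂ) ^ (k * p) = t at *
      generalize (-1 : ℂ) ^ (l * p) = t' at *
      match_scalars <;> first | ring1 | linear_combination (-t') * e)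

/-- The differential of the tangent complex: the graded commutator with the differential of the
structure sheaf, `D ↦ d D - (-1)^{|D|} D d`. -/
def diff {V : Opens X} {k l : ℤ} (h : k + 1 = l) (D : Der A k V) : Der A l V :=
  mk (fun hW p q hq => A.d (i := p + k) (by omega) ∘ₗ on D hW rfl -
        (-1 : ℂ) ^ k • on D hW (i := p + 1) (by omega) ∘ₗ A.d rfl)
    (fun hW h' _ _ hq a => by
      simp only [LinearMap.sub_apply, LinearMap.smul_apply, LinearMap.comp_apply, map_sub, map_smul,
        res_on, A.res_d])
    (fun hW p q r p' q' r' hr hp' hq' hr' h₁ h₂ a b => by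
      subst h
      simp only [LinearMap.sub_apply, LinearMap.smul_apply, LinearMap.comp_apply, map_sub, map_smul]
      rw [on_mul D hW hr rfl rfl rfl (by omega) (by omega),
        A.d_mul hr rfl rfl rfl (by omega) (by omega)]
      simp only [map_add, map_smul]
      rw [on_mul D hW (l' := r') (i' := p') (j' := q + k) (i := p + 1) (j := q)
          (by omega) (by omega) rfl (by omega) (by omega) (by omega),
        on_mul D hW (l' := r') (i' := p + k) (j' := q') (i := p) (j := q + 1)
          (by omega) rfl (by omega) (by omega) (by omega) (by omega),
        A.d_mul (k' := r') (i' := p') (j' := q + 1) (i := p + k) (j := q)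
          (by omega) (by omega) rfl (by omega) (by omega) (by omega),
        A.d_mul (k' := r') (i' := p + 1) (j' := q') (i := p) (j := q + k)
          (by omega) rfl (by omega) (by omega) (by omega) (by omega)]
      simp only [LinearMap.sub_apply, LinearMap.smul_apply, smul_add, smul_sub, smul_smul,
        mul_add, add_mul, mul_one, one_mul, zpow_add₀ (show (-1 : ℂ) ≠ 0 by norm_num)]
      have e : (-1 : ℂ) ^ k * (-1 : ℂ) ^ k = 1 := sign_mul_self _
      generalize (-1 : ℂ) ^ k = s at *
      generalize (-1 : ℂ) ^ (k * p) = t at *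
      generalize (-1 : ℂ) ^ p = t' at *
      match_scalars <;> first | ring1 | linear_combination (-t) * e)

end Der

end Tangent

section OneForms

variable (A : CdgaSheaf X)

/-- The graded `A|_V`-linear maps of degree `m` from the tangent sheaf to `A|_V`. -/
def oneFormSubmodule (m : ℤ) (V : Opens X) :
    Submodule ℂ (∀ (W : Set.Iic V) (k : ℤ) (j : {j : ℤ // m + k = j}),
      Der A k W.1 →ₗ[ℂ] A.sec j.1 W.1) where
  carrier := {φ |
    (∀ (W W' : Opens X) (h : W ≤ V) (h' : W' ≤ W) (k j : ℤ) (hj : m + k = j) (D : Der A k W),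
      A.res h' (φ ⟨W, h⟩ k ⟨j, hj⟩ D) = φ ⟨W', h'.trans h⟩ k ⟨j, hj⟩ (Der.res h' D)) ∧
    (∀ (W : Opens X) (h : W ≤ V) (i k l j n : ℤ) (hl : i + k = l) (hj : m + k = j)
      (hn : m + l = n) (hn' : i + j = n) (f : A.sec i W) (D : Der A k W),
      φ ⟨W, h⟩ l ⟨n, hn⟩ (Der.fsmul hl f D) =
        (-1 : ℂ) ^ (m * i) • A.mul hn' f (φ ⟨W, h⟩ k ⟨j, hj⟩ D))}
  add_mem' := by
    rintro φ ψ ⟨hφ, hφ'⟩ ⟨hψ, hψ'⟩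
    refine ⟨fun W W' h h' k j hj D => ?_, fun W h i k l j n hl hj hn hn' f D => ?_⟩
    · simp only [Pi.add_apply, LinearMap.add_apply, map_add, hφ W W' h h', hψ W W' h h']
    · simp only [Pi.add_apply, LinearMap.add_apply, map_add, smul_add,
        hφ' W h i k l j n hl hj hn hn', hψ' W h i k l j n hl hj hn hn']
  zero_mem' := ⟨by intros; simp, by intros; simp⟩
  smul_mem' := by
    rintro c φ ⟨hφ, hφ'⟩
    refine ⟨fun W W' h h' k j hj D => ?_, fun W h i k l j n hl hj hn hn' f D => ?_⟩
    · simp only [Pi.smul_apply, LinearMap.smul_apply, map_smul, hφ W W' h h']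
    · simp only [Pi.smul_apply, LinearMap.smul_apply, map_smul,
        hφ' W h i k l j n hl hj hn hn', smul_comm c]

/-- The one-forms of degree `m` on the open set `V`, i.e. the sections of degree `m` of the
cotangent sheaf of `(X, A)`: the graded `A|_V`-linear maps of degree `m` from the tangent sheaf to
`A|_V`. -/
def OneForm (m : ℤ) (V : Opens X) : Type u := oneFormSubmodule A m V

instance (m : ℤ) (V : Opens X) : AddCommGroup (OneForm A m V) :=
  inferInstanceAs (AddCommGroup (oneFormSubmodule A m V))

instance (m : ℤ) (V : Opens X) : Module ℂ (OneForm A m V) :=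
  inferInstanceAs (Module ℂ (oneFormSubmodule A m V))

variable {A}

namespace OneForm

/-- The value of a one-form on a vector field on a smaller open set. -/
def on {V W : Opens X} {m k j : ℤ} (φ : OneForm A m V) (hW : W ≤ V) (h : m + k = j) :
    Der A k W →ₗ[ℂ] A.sec j W := φ.1 ⟨W, hW⟩ k ⟨j, h⟩

/-- Construction of a one-form from its values. -/
def mk {V : Opens X} {m : ℤ}
    (F : ∀ {W : Opens X}, W ≤ V → ∀ {k j : ℤ}, m + k = j → Der A k W →ₗ[ℂ] A.sec j W)
    (hF : ∀ {W W' : Opens X} (hW : W ≤ V) (h' : W' ≤ W) {k j : ℤ} (h : m + k = j)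
      (D : Der A k W), A.res h' (F hW h D) = F (h'.trans hW) h (Der.res h' D))
    (hF' : ∀ {W : Opens X} (hW : W ≤ V) {i k l j n : ℤ} (hl : i + k = l) (hj : m + k = j)
      (hn : m + l = n) (hn' : i + j = n) (f : A.sec i W) (D : Der A k W),
      F hW hn (Der.fsmul hl f D) = (-1 : ℂ) ^ (m * i) • A.mul hn' f (F hW hj D)) :
    OneForm A m V :=
  ⟨fun W _ j => F W.2 j.2, fun _ _ hW h' _ _ h D => hF hW h' h D,
    fun _ hW _ _ _ _ _ hl hj hn hn' f D => hF' hW hl hj hn hn' f D⟩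

/-- Restriction of a one-form to a smaller open set. -/
def res {V W : Opens X} {m : ℤ} (h : W ≤ V) (φ : OneForm A m V) : OneForm A m W :=
  mk (fun hZ _ _ hj => on φ (hZ.trans h) hj) (fun hZ h' _ _ hj D => φ.2.1 _ _ (hZ.trans h) h' _ _ hj D)
    fun hZ _ _ _ _ _ hl hj hn hn' f D => φ.2.2 _ (hZ.trans h) _ _ _ _ _ hl hj hn hn' f D

/-- The product of a function `f` of degree `i` and a one-form: `(f φ)(D) = f φ(D)`. -/
def fsmul {V : Opens X} {i m l : ℤ} (h : i + m = l) (f : A.sec i V) (φ : OneForm A m V) :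
    OneForm A l V :=
  mk (fun hW k _ hj => A.mul (j := m + k) (by omega) (A.res hW f) ∘ₗ on φ hW rfl)
    (fun hW h' k j hj D => by
      simp only [LinearMap.comp_apply, A.res_mul, A.res_res]
      congr 1
      exact φ.2.1 _ _ hW h' _ _ rfl D)
    (fun {W} hW p k l' j n hl hj hn hn' g D => by
      have e : on φ hW (k := l') rfl (Der.fsmul hl g D) =
          (-1 : ℂ) ^ (m * p) • A.mul (by omega) g (on φ hW (k := k) rfl D) :=
        φ.2.2 W hW p k l' (m + k) (m + l') hl rfl rfl (by omega) g D
      simp only [LinearMap.comp_apply]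
      rw [e, map_smul, ← A.mul_assoc (i := i) (j := p) (l := m + k) (m := p + i) (n := m + l')
        (k := n) (by omega) (by omega) (by omega) (by omega),
        A.mul_comm _ rfl, map_smul, LinearMap.smul_apply, smul_smul,
        A.mul_assoc (n := j) rfl (by omega) (by omega) (by omega), ← zpow_add₀ (by norm_num)]
      congr 2
      subst h
      ring)

/-- The differential of a function `f` of degree `m`: `(df)(D) = (-1)^{|D| m} D(f)`. -/
def ofFun {V : Opens X} {m : ℤ} (f : A.sec m V) : OneForm A m V :=
  mk (fun hW k _ hj =>
      { toFun := fun D => (-1 : ℂ) ^ (k * m) • Der.act D hj (A.res hW f)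
        map_add' := fun D E => by
          rw [← smul_add]; rfl
        map_smul' := fun c D => by
          rw [RingHom.id_apply, smul_comm]; rfl })
    (fun hW h' k j hj D => by
      simp only [LinearMap.coe_mk, AddHom.coe_mk, map_smul, Der.act, Der.res_on]
      rw [A.res_res]
      rfl)
    (fun {W} hW p k l j n hl hj hn hn' g D => by
      have e : Der.act (Der.fsmul hl g D) hn (A.res hW f) =
          A.mul hn' g (Der.act D hj (A.res hW f)) := by
        subst hj
        exact congrArg (fun x => A.mul hn' x _) (A.res_self g)
      simp only [LinearMap.coe_mk, AddHom.coe_mk, e, map_smul, smul_smul]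
      rw [← zpow_add₀ (by norm_num)]
      congr 2
      subst hl
      ring)

end OneForm

end OneForms

section Courant

/-- The inclusion of the poset of open subsets of `U'` into that of `U`. -/
def incl {U U' : Opens X} (h : U' ≤ U) (V : Set.Iic U') : Set.Iic U :=
  ⟨V.1, Set.mem_Iic.2 ((Set.mem_Iic.1 V.2).trans h)⟩

variable (A : CdgaSheaf X) (U : Opens X)

/-- A sheaf of differential graded `A|_U`-modules on the open set `U`.  `sec i V` are the sections
of degree `i` over `V ≤ U`. -/
structure DGMod where
  sec : ℤ → Set.Iic U → Type u
  [grp : ∀ i V, AddCommGroup (sec i V)]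
  [mod : ∀ i V, Module ℂ (sec i V)]
  res : ∀ {i : ℤ} {V W : Set.Iic U}, W ≤ V → sec i V →ₗ[ℂ] sec i W
  smul : ∀ {V : Set.Iic U} {i j k : ℤ}, i + j = k → A.sec i V.1 →ₗ[ℂ] sec j V →ₗ[ℂ] sec k V
  d : ∀ {V : Set.Iic U} {i j : ℤ}, i + 1 = j → sec i V →ₗ[ℂ] sec j V
  res_self : ∀ {i : ℤ} {V : Set.Iic U} (q : sec i V), res (le_refl V) q = q
  res_res : ∀ {i : ℤ} {V W Z : Set.Iic U} (h : W ≤ V) (h' : Z ≤ W) (q : sec i V),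
    res h' (res h q) = res (h'.trans h) q
  glue : ∀ i : ℤ, UniqueGluing Subtype.val (sec i) fun h => res h
  res_smul : ∀ {V W : Set.Iic U} (hW : W ≤ V) {i j k : ℤ} (h : i + j = k) (f : A.sec i V.1)
    (q : sec j V), res hW (smul h f q) = smul h (A.res hW f) (res hW q)
  res_d : ∀ {V W : Set.Iic U} (hW : W ≤ V) {i j : ℤ} (h : i + 1 = j) (q : sec i V),
    res hW (d h q) = d h (res hW q)
  one_smul : ∀ {V : Set.Iic U} {i : ℤ} (q : sec i V), smul (zero_add i) (A.one V.1) q = q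
  mul_smul : ∀ {V : Set.Iic U} {i j l m n k : ℤ} (h₁ : i + j = m) (h₂ : m + l = k)
    (h₃ : j + l = n) (h₄ : i + n = k) (f : A.sec i V.1) (g : A.sec j V.1) (q : sec l V),
    smul h₂ (A.mul h₁ f g) q = smul h₄ f (smul h₃ g q)
  d_smul : ∀ {V : Set.Iic U} {i j k i' j' k' : ℤ} (h : i + j = k) (hi : i + 1 = i')
    (hj : j + 1 = j') (hk : k + 1 = k') (h₁ : i' + j = k') (h₂ : i + j' = k') (f : A.sec i V.1)
    (q : sec j V),
    d hk (smul h f q) = smul h₁ (A.d hi f) q + (-1 : ℂ) ^ i • smul h₂ f (d hj q)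
  d_d : ∀ {V : Set.Iic U} {i j k : ℤ} (h : i + 1 = j) (h' : j + 1 = k) (q : sec i V),
    d h' (d h q) = 0

attribute [instance] DGMod.grp DGMod.mod

/-- A differential graded module over `(U, A|_U)` with a bracket `br`, an anchor `anchor`, a pairing
`pair` and a map `der` from `A|_U`, all `ℂ`-linear of degree zero.  Their properties are listed in
the structures that follow; signs are given by the Koszul rule. -/
structure CourantData extends DGMod A U where
  br : ∀ {V : Set.Iic U} {i j k : ℤ}, i + j = k → sec i V →ₗ[ℂ] sec j V →ₗ[ℂ] sec k V
  anchor : ∀ {V : Set.Iic U} {i : ℤ}, sec i V →ₗ[ℂ] Der A i V.1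
  pair : ∀ {V : Set.Iic U} {i j k : ℤ}, i + j = k → sec i V →ₗ[ℂ] sec j V →ₗ[ℂ] A.sec k V.1
  der : ∀ {V : Set.Iic U} {i : ℤ}, A.sec i V.1 →ₗ[ℂ] sec i V

variable {A U}

namespace CourantData

/-- The structure maps are maps of sheaves. -/
structure Local (Q : CourantData A U) : Prop where
  res_br : ∀ {V W : Set.Iic U} (hW : W ≤ V) {i j k : ℤ} (h : i + j = k) (a : Q.sec i V)
    (b : Q.sec j V), Q.res hW (Q.br h a b) = Q.br h (Q.res hW a) (Q.res hW b)
  res_anchor : ∀ {V W : Set.Iic U} (hW : W ≤ V) {i : ℤ} (a : Q.sec i V),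
    Der.res hW (Q.anchor a) = Q.anchor (Q.res hW a)
  res_pair : ∀ {V W : Set.Iic U} (hW : W ≤ V) {i j k : ℤ} (h : i + j = k) (a : Q.sec i V)
    (b : Q.sec j V), A.res hW (Q.pair h a b) = Q.pair h (Q.res hW a) (Q.res hW b)
  res_der : ∀ {V W : Set.Iic U} (hW : W ≤ V) {i : ℤ} (f : A.sec i V.1),
    Q.res hW (Q.der f) = Q.der (A.res hW f)

/-- The structure maps are compatible with the differentials. -/
structure CommDiff (Q : CourantData A U) : Prop where
  d_br : ∀ {V : Set.Iic U} {i j k i' j' k' : ℤ} (h : i + j = k) (hi : i + 1 = i')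
    (hj : j + 1 = j') (hk : k + 1 = k') (h₁ : i' + j = k') (h₂ : i + j' = k') (a : Q.sec i V)
    (b : Q.sec j V),
    Q.d hk (Q.br h a b) = Q.br h₁ (Q.d hi a) b + (-1 : ℂ) ^ i • Q.br h₂ a (Q.d hj b)
  anchor_d : ∀ {V : Set.Iic U} {i j : ℤ} (h : i + 1 = j) (a : Q.sec i V),
    Q.anchor (Q.d h a) = Der.diff h (Q.anchor a)
  d_pair : ∀ {V : Set.Iic U} {i j k i' j' k' : ℤ} (h : i + j = k) (hi : i + 1 = i')
    (hj : j + 1 = j') (hk : k + 1 = k') (h₁ : i' + j = k') (h₂ : i + j' = k') (a : Q.sec i V)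
    (b : Q.sec j V),
    A.d hk (Q.pair h a b) = Q.pair h₁ (Q.d hi a) b + (-1 : ℂ) ^ i • Q.pair h₂ a (Q.d hj b)
  d_der : ∀ {V : Set.Iic U} {i j : ℤ} (h : i + 1 = j) (f : A.sec i V.1),
    Q.d h (Q.der f) = Q.der (A.d h f)

/-- The bracket is a Leibniz bracket, and the anchor is `A`-linear and preserves the brackets. -/
structure Anchored (Q : CourantData A U) : Prop where
  br_br : ∀ {V : Set.Iic U} {i j k l m n p : ℤ} (h₁ : j + k = l) (h₂ : i + l = p) (h₃ : i + j = m)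
    (h₄ : m + k = p) (h₅ : i + k = n) (h₆ : j + n = p) (a : Q.sec i V) (b : Q.sec j V) (c : Q.sec k V),
    Q.br h₂ a (Q.br h₁ b c) = Q.br h₄ (Q.br h₃ a b) c + (-1 : ℂ) ^ (i * j) • Q.br h₆ b (Q.br h₅ a c)
  anchor_smul : ∀ {V : Set.Iic U} {i j k : ℤ} (h : i + j = k) (f : A.sec i V.1) (a : Q.sec j V),
    Q.anchor (Q.smul h f a) = Der.fsmul h f (Q.anchor a)
  anchor_br : ∀ {V : Set.Iic U} {i j k : ℤ} (h : i + j = k) (a : Q.sec i V) (b : Q.sec j V),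
    Q.anchor (Q.br h a b) = Der.bracket h (Q.anchor a) (Q.anchor b)

/-- The pairing is symmetric and `A`-bilinear. -/
structure Paired (Q : CourantData A U) : Prop where
  pair_smul : ∀ {V : Set.Iic U} {i j k l m n : ℤ} (h₁ : i + j = l) (h₂ : l + k = n)
    (h₃ : j + k = m) (h₄ : i + m = n) (f : A.sec i V.1) (a : Q.sec j V) (b : Q.sec k V),
    Q.pair h₂ (Q.smul h₁ f a) b = A.mul h₄ f (Q.pair h₃ a b)
  pair_comm : ∀ {V : Set.Iic U} {i j k : ℤ} (h : i + j = k) (h' : j + i = k) (a : Q.sec i V)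
    (b : Q.sec j V), Q.pair h a b = (-1 : ℂ) ^ (i * j) • Q.pair h' b a

/-- The map `der` is a derivation: it satisfies the Leibniz rule and is the composition of the de
Rham differential with an `A`-linear map from the cotangent sheaf. -/
structure Derived (Q : CourantData A U) : Prop where
  der_mul : ∀ {V : Set.Iic U} {i j k : ℤ} (h : i + j = k) (h' : j + i = k) (f : A.sec i V.1)
    (g : A.sec j V.1),
    Q.der (A.mul h f g) = Q.smul h f (Q.der g) + (-1 : ℂ) ^ (i * j) • Q.smul h' g (Q.der f)
  der_factors : ∃ ι : ∀ (V : Set.Iic U) (i : ℤ), OneForm A i V.1 →ₗ[ℂ] Q.sec i V,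
    (∀ (V W : Set.Iic U) (hW : W ≤ V) (i : ℤ) (φ : OneForm A i V.1),
      Q.res hW (ι V i φ) = ι W i (OneForm.res hW φ)) ∧
    (∀ (V : Set.Iic U) (i j k : ℤ) (h : i + j = k) (f : A.sec i V.1) (φ : OneForm A j V.1),
      ι V k (OneForm.fsmul h f φ) = Q.smul h f (ι V j φ)) ∧
    (∀ (V : Set.Iic U) (i : ℤ) (f : A.sec i V.1), ι V i (OneForm.ofFun f) = Q.der f)

/-- The relations between the bracket, the anchor, the pairing and the derivation. -/
structure Relations (Q : CourantData A U) : Prop where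
  anchor_der : ∀ {V : Set.Iic U} {i : ℤ} (f : A.sec i V.1), Q.anchor (Q.der f) = 0
  br_smul : ∀ {V : Set.Iic U} {i j k l m n p : ℤ} (h₁ : j + k = l) (h₂ : i + l = n) (h₃ : i + k = m)
    (h₄ : j + m = n) (h₅ : j + i = p) (h₆ : p + k = n) (a : Q.sec i V) (f : A.sec j V.1)
    (b : Q.sec k V),
    Q.br h₂ a (Q.smul h₁ f b) =
      (-1 : ℂ) ^ (i * j) • Q.smul h₄ f (Q.br h₃ a b) + Q.smul h₆ (Der.act (Q.anchor a) h₅ f) b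
  pair_invariant : ∀ {V : Set.Iic U} {i j k l m n p : ℤ} (h₁ : i + j = l) (h₂ : l + k = p)
    (h₃ : i + k = m) (h₄ : j + m = p) (h₅ : j + k = n) (h₆ : n + i = p) (a : Q.sec i V)
    (b : Q.sec j V) (c : Q.sec k V),
    Q.pair h₂ (Q.br h₁ a b) c + (-1 : ℂ) ^ (i * j) • Q.pair h₄ b (Q.br h₃ a c) =
      Der.act (Q.anchor a) h₆ (Q.pair h₅ b c)
  br_der : ∀ {V : Set.Iic U} {i j k : ℤ} (h : i + j = k) (h' : j + i = k) (a : Q.sec i V)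
    (f : A.sec j V.1), Q.br h a (Q.der f) = Q.der (Der.act (Q.anchor a) h' f)
  pair_der : ∀ {V : Set.Iic U} {i j k : ℤ} (h : i + j = k) (h' : j + i = k) (a : Q.sec i V)
    (f : A.sec j V.1), Q.pair h a (Q.der f) = Der.act (Q.anchor a) h' f
  br_symm : ∀ {V : Set.Iic U} {i j k : ℤ} (h : i + j = k) (h' : j + i = k) (a : Q.sec i V)
    (b : Q.sec j V), Q.br h a b + (-1 : ℂ) ^ (i * j) • Q.br h' b a = Q.der (Q.pair h a b)

end CourantData

variable (A U)

/-- A (differential graded) Courant algebroid over `(U, A|_U)`. -/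
structure CourantAlgebroid extends CourantData A U where
  isLocal : toCourantData.Local
  commDiff : toCourantData.CommDiff
  anchored : toCourantData.Anchored
  paired : toCourantData.Paired
  derived : toCourantData.Derived
  relations : toCourantData.Relations

variable {A U}

namespace CourantAlgebroid

/-- `Ω_Q`, the `A`-submodule (sheaf) of `Q` generated by the image of the derivation: the section
`q` is locally a sum of sections of the form `f ∂(g)`. -/
def InOmega (Q : CourantAlgebroid A U) {i : ℤ} {V : Set.Iic U} (q : Q.sec i V) : Prop :=
  ∀ x ∈ V.1, ∃ (W : Set.Iic U) (h : W ≤ V), x ∈ W.1 ∧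
    Q.res h q ∈ AddSubgroup.closure {q' : Q.sec i W | ∃ (j k : ℤ) (hi : j + k = i)
      (f : A.sec j W.1) (g : A.sec k W.1), q' = Q.smul hi f (Q.der g)}

/-- `Q` is exact if the map from `Q / Ω_Q` to the tangent sheaf induced by the anchor is an
isomorphism of sheaves: the kernel of the anchor is `Ω_Q`, and the anchor is locally surjective. -/
structure IsExact (Q : CourantAlgebroid A U) : Prop where
  ker : ∀ {i : ℤ} {V : Set.Iic U} (q : Q.sec i V), Q.anchor q = 0 ↔ Q.InOmega q
  surj : ∀ {i : ℤ} {V : Set.Iic U} (D : Der A i V.1), ∀ x ∈ V.1,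
    ∃ (W : Set.Iic U) (h : W ≤ V), x ∈ W.1 ∧ ∃ q : Q.sec i W, Q.anchor q = Der.res h D

/-- A flat connection on `Q`: a morphism of differential graded modules from the tangent sheaf to
`Q` that is a section of the anchor and preserves the brackets. -/
@[ext]
structure FlatConnection (Q : CourantAlgebroid A U) where
  toFun : ∀ {V : Set.Iic U} {i : ℤ}, Der A i V.1 →ₗ[ℂ] Q.sec i V
  res_toFun : ∀ {V W : Set.Iic U} (hW : W ≤ V) {i : ℤ} (D : Der A i V.1),
    Q.res hW (toFun D) = toFun (Der.res hW D)
  toFun_smul : ∀ {V : Set.Iic U} {i j k : ℤ} (h : i + j = k) (f : A.sec i V.1) (D : Der A j V.1),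
    toFun (Der.fsmul h f D) = Q.smul h f (toFun D)
  toFun_diff : ∀ {V : Set.Iic U} {i j : ℤ} (h : i + 1 = j) (D : Der A i V.1),
    toFun (Der.diff h D) = Q.d h (toFun D)
  anchor_toFun : ∀ {V : Set.Iic U} {i : ℤ} (D : Der A i V.1), Q.anchor (toFun D) = D
  toFun_bracket : ∀ {V : Set.Iic U} {i j k : ℤ} (h : i + j = k) (D : Der A i V.1)
    (E : Der A j V.1), toFun (Der.bracket h D E) = Q.br h (toFun D) (toFun E)

/-- Morphisms of Courant algebroids. -/
@[ext]
structure Hom (Q Q' : CourantAlgebroid A U) where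
  toFun : ∀ {V : Set.Iic U} {i : ℤ}, Q.sec i V →ₗ[ℂ] Q'.sec i V
  res_toFun : ∀ {V W : Set.Iic U} (hW : W ≤ V) {i : ℤ} (q : Q.sec i V),
    Q'.res hW (toFun q) = toFun (Q.res hW q)
  toFun_smul : ∀ {V : Set.Iic U} {i j k : ℤ} (h : i + j = k) (f : A.sec i V.1) (q : Q.sec j V),
    toFun (Q.smul h f q) = Q'.smul h f (toFun q)
  toFun_d : ∀ {V : Set.Iic U} {i j : ℤ} (h : i + 1 = j) (q : Q.sec i V),
    toFun (Q.d h q) = Q'.d h (toFun q)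
  toFun_br : ∀ {V : Set.Iic U} {i j k : ℤ} (h : i + j = k) (a : Q.sec i V) (b : Q.sec j V),
    toFun (Q.br h a b) = Q'.br h (toFun a) (toFun b)
  anchor_toFun : ∀ {V : Set.Iic U} {i : ℤ} (q : Q.sec i V), Q'.anchor (toFun q) = Q.anchor q
  pair_toFun : ∀ {V : Set.Iic U} {i j k : ℤ} (h : i + j = k) (a : Q.sec i V) (b : Q.sec j V),
    Q'.pair h (toFun a) (toFun b) = Q.pair h a b
  toFun_der : ∀ {V : Set.Iic U} {i : ℤ} (f : A.sec i V.1), toFun (Q.der f) = Q'.der f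

/-- The identity morphism. -/
def Hom.id (Q : CourantAlgebroid A U) : Hom Q Q where
  toFun := LinearMap.id
  res_toFun _ _ _ := rfl
  toFun_smul _ _ _ := rfl
  toFun_d _ _ := rfl
  toFun_br _ _ _ := rfl
  anchor_toFun _ := rfl
  pair_toFun _ _ _ := rfl
  toFun_der _ := rfl

/-- Composition of morphisms. -/
def Hom.comp {Q Q' Q'' : CourantAlgebroid A U} (f : Hom Q Q') (g : Hom Q' Q'') : Hom Q Q'' where
  toFun := g.toFun ∘ₗ f.toFun
  res_toFun hW _ q := by simp [g.res_toFun, f.res_toFun]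
  toFun_smul h a q := by simp [g.toFun_smul, f.toFun_smul]
  toFun_d h q := by simp [g.toFun_d, f.toFun_d]
  toFun_br h a b := by simp [g.toFun_br, f.toFun_br]
  anchor_toFun q := by simp [g.anchor_toFun, f.anchor_toFun]
  pair_toFun h a b := by simp [g.pair_toFun, f.pair_toFun]
  toFun_der a := by simp [g.toFun_der, f.toFun_der]

instance : Category (CourantAlgebroid A U) where
  Hom := Hom
  id := Hom.id
  comp := Hom.comp

end CourantAlgebroid
end Courant

section Stack

variable {A : CdgaSheaf X}

/-- Restriction of a sheaf of differential graded modules to a smaller open set. -/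
def DGMod.restrict {U U' : Opens X} (h : U' ≤ U) (Q : DGMod A U) : DGMod A U' where
  sec i V := Q.sec i (incl h V)
  res {_ V W} hW := Q.res (V := incl h V) (W := incl h W) hW
  smul {V _ _ _} := Q.smul (V := incl h V)
  d {V _ _} := Q.d (V := incl h V)
  res_self {_ V} := Q.res_self (V := incl h V)
  res_res {_ V W Z} := Q.res_res (V := incl h V) (W := incl h W) (Z := incl h Z)
  glue i V ι W hW cov s hs := Q.glue i (incl h V) ι (fun a => incl h (W a)) hW cov s
    fun a b Z ha hb => hs a b ⟨Z.1, Set.mem_Iic.2 (le_trans (show Z.1 ≤ (W a).1 from ha) (W a).2)⟩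
      ha hb
  res_smul {V W} := Q.res_smul (V := incl h V) (W := incl h W)
  res_d {V W} := Q.res_d (V := incl h V) (W := incl h W)
  one_smul {V} := Q.one_smul (V := incl h V)
  mul_smul {V} := Q.mul_smul (V := incl h V)
  d_smul {V} := Q.d_smul (V := incl h V)
  d_d {V} := Q.d_d (V := incl h V)

/-- Restriction of the data of a Courant algebroid to a smaller open set. -/
def CourantData.restrict {U U' : Opens X} (h : U' ≤ U) (Q : CourantData A U) :
    CourantData A U' where
  toDGMod := Q.toDGMod.restrict h
  br {V _ _ _} := Q.br (V := incl h V)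
  anchor {V _} := Q.anchor (V := incl h V)
  pair {V _ _ _} := Q.pair (V := incl h V)
  der {V _} := Q.der (V := incl h V)

namespace CourantAlgebroid

/-- Restriction of a Courant algebroid to a smaller open set. -/
def restrict {U U' : Opens X} (h : U' ≤ U) (Q : CourantAlgebroid A U) :
    CourantAlgebroid A U' where
  toCourantData := Q.toCourantData.restrict h
  isLocal :=
    { res_br := fun {V W} => Q.isLocal.res_br (V := incl h V) (W := incl h W)
      res_anchor := fun {V W} => Q.isLocal.res_anchor (V := incl h V) (W := incl h W)
      res_pair := fun {V W} => Q.isLocal.res_pair (V := incl h V) (W := incl h W)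
      res_der := fun {V W} => Q.isLocal.res_der (V := incl h V) (W := incl h W) }
  commDiff :=
    { d_br := fun {V} => Q.commDiff.d_br (V := incl h V)
      anchor_d := fun {V} => Q.commDiff.anchor_d (V := incl h V)
      d_pair := fun {V} => Q.commDiff.d_pair (V := incl h V)
      d_der := fun {V} => Q.commDiff.d_der (V := incl h V) }
  anchored :=
    { br_br := fun {V} => Q.anchored.br_br (V := incl h V)
      anchor_smul := fun {V} => Q.anchored.anchor_smul (V := incl h V)
      anchor_br := fun {V} => Q.anchored.anchor_br (V := incl h V) }
  paired :=
    { pair_smul := fun {V} => Q.paired.pair_smul (V := incl h V)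
      pair_comm := fun {V} => Q.paired.pair_comm (V := incl h V) }
  derived :=
    { der_mul := fun {V} => Q.derived.der_mul (V := incl h V)
      der_factors := by
        obtain ⟨ι, h₁, h₂, h₃⟩ := Q.derived.der_factors
        exact ⟨fun V i => ι (incl h V) i, fun V W hW => h₁ (incl h V) (incl h W) hW,
          fun V => h₂ (incl h V), fun V => h₃ (incl h V)⟩ }
  relations :=
    { anchor_der := fun {V} => Q.relations.anchor_der (V := incl h V)
      br_smul := fun {V} => Q.relations.br_smul (V := incl h V)
      pair_invariant := fun {V} => Q.relations.pair_invariant (V := incl h V)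
      br_der := fun {V} => Q.relations.br_der (V := incl h V)
      pair_der := fun {V} => Q.relations.pair_der (V := incl h V)
      br_symm := fun {V} => Q.relations.br_symm (V := incl h V) }

theorem IsExact.restrict {U U' : Opens X} (h : U' ≤ U) {Q : CourantAlgebroid A U}
    (hQ : Q.IsExact) : (Q.restrict h).IsExact where
  ker {i V} q := by
    refine (hQ.ker (i := i) (V := incl h V) q).trans ⟨fun H x hx => ?_, fun H x hx => ?_⟩
    · obtain ⟨W, hW, hxW, e⟩ := H x hx
      exact ⟨⟨W.1, Set.mem_Iic.2 (le_trans (show W.1 ≤ V.1 from hW) V.2)⟩, hW, hxW, e⟩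
    · obtain ⟨W, hW, hxW, e⟩ := H x hx
      exact ⟨incl h W, hW, hxW, e⟩
  surj {i V} D x hx := by
    obtain ⟨W, hW, hxW, q, e⟩ := hQ.surj (V := incl h V) D x hx
    exact ⟨⟨W.1, Set.mem_Iic.2 (le_trans (show W.1 ≤ V.1 from hW) V.2)⟩, hW, hxW, q, e⟩

/-- Restriction of a morphism of Courant algebroids to a smaller open set. -/
def Hom.restrict {U U' : Opens X} (h : U' ≤ U) {Q Q' : CourantAlgebroid A U} (f : Hom Q Q') :
    Hom (Q.restrict h) (Q'.restrict h) where
  toFun {V _} := f.toFun (V := incl h V)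
  res_toFun {V W} := f.res_toFun (V := incl h V) (W := incl h W)
  toFun_smul {V} := f.toFun_smul (V := incl h V)
  toFun_d {V} := f.toFun_d (V := incl h V)
  toFun_br {V} := f.toFun_br (V := incl h V)
  anchor_toFun {V} := f.anchor_toFun (V := incl h V)
  pair_toFun {V} := f.pair_toFun (V := incl h V)
  toFun_der {V} := f.toFun_der (V := incl h V)

end CourantAlgebroid

variable (A) in
/-- Exact Courant algebroids over `(U, A|_U)`. -/
structure ExactCA (U : Opens X) where
  toCA : CourantAlgebroid A U
  exact : toCA.IsExact

namespace ExactCA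

instance (U : Opens X) : Category (ExactCA A U) where
  Hom Q Q' := CourantAlgebroid.Hom Q.toCA Q'.toCA
  id Q := CourantAlgebroid.Hom.id Q.toCA
  comp f g := CourantAlgebroid.Hom.comp f g

/-- The restriction functor. -/
def restrict {U U' : Opens X} (h : U' ≤ U) : ExactCA A U ⥤ ExactCA A U' where
  obj Q := ⟨Q.toCA.restrict h, Q.exact.restrict h⟩
  map f := CourantAlgebroid.Hom.restrict h f
  map_id _ := rfl
  map_comp _ _ := rfl

end ExactCA

variable (A) in
/-- The assignment `U ↦ ECA(U)` of the category of exact Courant algebroids over `(U, A|_U)` to an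
open set `U`, with the restriction functors (which are strictly functorial). -/
def ecaFunctor : (Opens X)ᵒᵖ ⥤ Cat.{u, u + 1} where
  obj U := Cat.of (ExactCA A U.unop)
  map f := (ExactCA.restrict f.unop.le).toCatHom
  map_id _ := rfl
  map_comp _ _ := rfl

variable (A) in
/-- The stack `ECA` of exact Courant algebroids over `(X, A)`, as a fibred category (pseudofunctor)
over the category of open subsets of `X`. -/
def ECA : Pseudofunctor (LocallyDiscrete (Opens X)ᵒᵖ) Cat.{u, u + 1} :=
  (ecaFunctor A).toPseudofunctor'

/-- The category `[0]` with one object and one morphism. -/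
def PointCat : Type (u + 1) := ULift.{u + 1} (Discrete PUnit.{u + 1})

instance : Category.{u} PointCat.{u} := uliftCategory _

variable (X) in
/-- The final stack on `X`, assigning the category `[0]` to each open subset. -/
def finalStack : Pseudofunctor (LocallyDiscrete (Opens X)ᵒᵖ) Cat.{u, u + 1} :=
  ((Functor.const (Opens X)ᵒᵖ).obj (Cat.of PointCat.{u})).toPseudofunctor'

end Stack

section Equivalence

open scoped Pseudofunctor.StrongTrans

/-- Two fibred categories (pseudofunctors) over the open subsets of `X` are equivalent: they are
equivalent objects of the bicategory of pseudofunctors, pseudonatural transformations and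
modifications. -/
def AreEquivalent (F G : Pseudofunctor (LocallyDiscrete (Opens X)ᵒᵖ) Cat.{u, u + 1}) : Prop :=
  Nonempty (Bicategory.Equivalence F G)

end Equivalence

section Manifolds

open scoped Manifold ContDiff

section Functions

variable {𝕜 : Type} [NontriviallyNormedField 𝕜] [NormedAlgebra 𝕜 ℂ]
  {E : Type} [NormedAddCommGroup E] [NormedSpace 𝕜 E]
  (M : Type u) [TopologicalSpace M] [ChartedSpace E M] (r : ℕ∞ω)

variable (𝕜 E) in
/-- The algebra of complex valued functions of class `C^r` (over the field `𝕜`) on an open set. -/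
def funAlgebra (V : Opens M) : Subalgebra ℂ (V → ℂ) where
  carrier := {f | ContMDiff 𝓘(𝕜, E) 𝓘(𝕜, ℂ) r f}
  mul_mem' hf hg := contDiff_mul.contMDiff.comp (ContMDiff.prodMk_space hf hg)
  add_mem' hf hg := ContMDiff.add hf hg
  algebraMap_mem' _ := contMDiff_const

variable (𝕜 E) in
theorem mem_of_locally {V : Opens M} (f : V → ℂ)
    (h : ∀ x : V, ∃ (W : Opens M) (hW : W ≤ V), x.1 ∈ W ∧
      (fun y : W => f ⟨y.1, hW y.2⟩) ∈ funAlgebra 𝕜 E M r W) : f ∈ funAlgebra 𝕜 E M r V := by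
  intro x
  obtain ⟨W, hW, hx, hf⟩ := h x
  have e : ∀ (y : V), Function.extend Subtype.val f 0 y.1 = f y := fun y =>
    Subtype.val_injective.extend_apply f 0 y
  have h₁ : ContMDiffAt 𝓘(𝕜, E) 𝓘(𝕜, ℂ) r (Function.extend Subtype.val f 0) x.1 := by
    have h₂ := hf ⟨x.1, hx⟩
    rw [show (fun y : W => f ⟨y.1, hW y.2⟩) =
      fun y : W => Function.extend Subtype.val f 0 y.1 from funext fun y => (e ⟨y.1, hW y.2⟩).symm]
      at h₂
    exact (contMDiffAt_subtype_iff (U := W) (x := ⟨x.1, hx⟩)).1 h₂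
  have h₃ := (contMDiffAt_subtype_iff (U := V) (x := x)).2 h₁
  simpa only [e] using h₃

variable (𝕜 E) in
/-- The sheaf of complex valued functions of class `C^r` (over the field `𝕜`) on `M`. -/
def funSheaf : AlgSheaf M where
  sec V := funAlgebra 𝕜 E M r V
  res {V W} h :=
    { toFun := fun f => ⟨fun x => f.1 ⟨x.1, h x.2⟩,
        ContMDiff.comp (g := f.1) f.2 (contMDiff_inclusion h)⟩
      map_one' := rfl
      map_mul' := fun _ _ => rfl
      map_zero' := rfl
      map_add' := fun _ _ => rfl
      commutes' := fun _ => rfl }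
  res_self _ := rfl
  res_res _ _ _ := rfl
  glue V ι W hW cov s hs := by
    choose a ha using fun x : V => cov x.1 x.2
    have key : ∀ (b : ι) (x : V) (hx : x.1 ∈ W b), (s (a x)).1 ⟨x.1, ha x⟩ = (s b).1 ⟨x.1, hx⟩ :=
      fun b x hx => congrFun (congrArg Subtype.val
        (hs (a x) b (W (a x) ⊓ W b) inf_le_left inf_le_right)) ⟨x.1, ha x, hx⟩
    refine ⟨⟨fun x => (s (a x)).1 ⟨x.1, ha x⟩, mem_of_locally 𝕜 E M r _ fun x =>
      ⟨W (a x), hW (a x), ha x, ?_⟩⟩, fun b => ?_, fun t ht => ?_⟩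
    · convert (s (a x)).2 using 1
      funext y
      exact key (a x) ⟨y.1, hW _ y.2⟩ y.2
    · apply Subtype.ext
      funext y
      exact key b ⟨y.1, hW _ y.2⟩ y.2
    · apply Subtype.ext
      funext x
      exact congrFun (congrArg Subtype.val (ht (a x))) ⟨x.1, ha x⟩

end Functions

open AlgebraicGeometry Opposite in
/-- The structure map from `ℂ` to the regular functions on an open subset of a scheme over `ℂ`. -/
def schemeAlgebraMap (X : Scheme.{u}) (f : X ⟶ Spec (CommRingCat.of (ULift.{u} ℂ)))
    (V : X.Opens) : ℂ →+* Γ(X, V) :=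
  (f.appLE ⊤ V le_top).hom.comp <|
    (Scheme.ΓSpecIso (CommRingCat.of (ULift.{u} ℂ))).inv.hom.comp
      (ULift.ringEquiv (R := ℂ)).symm.toRingHom

open AlgebraicGeometry Opposite in
/-- The structure sheaf of a scheme over `ℂ`. -/
def schemeSheaf (X : Scheme.{u}) (f : X ⟶ Spec (CommRingCat.of (ULift.{u} ℂ))) : AlgSheaf X :=
  letI : ∀ V : X.Opens, Algebra ℂ Γ(X, V) := fun V => (schemeAlgebraMap X f V).toAlgebra
  { sec := fun V => Γ(X, V)
    res := fun {V W} h =>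
      { (X.presheaf.map (homOfLE h).op).hom with
        commutes' := fun c => by
          have e := f.appLE_map (U := ⊤) (V := V) le_top (homOfLE h).op
          exact congrArg (fun g : Γ(Spec (CommRingCat.of (ULift.{u} ℂ)), ⊤) ⟶ Γ(X, W) =>
            g.hom ((Scheme.ΓSpecIso (CommRingCat.of (ULift.{u} ℂ))).inv.hom (ULift.up c))) e }
    res_self := fun {V} s => by
      have e := X.presheaf.map_id (op V)
      exact congrArg (fun g : Γ(X, V) ⟶ Γ(X, V) => g.hom s) e
    res_res := fun {V W Z} h h' s => by
      have e := X.presheaf.map_comp (homOfLE h).op (homOfLE h').op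
      exact (congrArg (fun g : Γ(X, V) ⟶ Γ(X, Z) => g.hom s) e).symm
    glue := fun V ι W hW cov s hs => by
      refine X.sheaf.existsUnique_gluing' W V (fun a => homOfLE (hW a)) ?_ s ?_
      · intro x hx
        obtain ⟨a, ha⟩ := cov x hx
        exact Opens.mem_iSup.2 ⟨a, ha⟩
      · intro a b
        exact hs a b _ inf_le_left inf_le_right }

open AlgebraicGeometry in
/-- A "manifold" `X` of one of three kinds: a `C^∞`-manifold, a complex manifold or a smooth
variety over `ℂ`. -/
inductive Manifold : Type (u + 1)
  | smooth (n : ℕ) (M : Type u) [TopologicalSpace M] [ChartedSpace (EuclideanSpace ℝ (Fin n)) M]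
      [IsManifold 𝓘(ℝ, EuclideanSpace ℝ (Fin n)) ∞ M]
  | complex (n : ℕ) (M : Type u) [TopologicalSpace M] [ChartedSpace (EuclideanSpace ℂ (Fin n)) M]
      [IsManifold 𝓘(ℂ, EuclideanSpace ℂ (Fin n)) ω M]
  | algebraic (X : Scheme.{u}) (f : X ⟶ Spec (CommRingCat.of (ULift.{u} ℂ))) [Smooth f]

namespace Manifold

/-- The underlying set of a manifold. -/
def carrier : Manifold.{u} → Type u
  | smooth _ M => M
  | complex _ M => M
  | algebraic X _ => X

instance : ∀ X : Manifold.{u}, TopologicalSpace X.carrier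
  | smooth _ M => inferInstanceAs (TopologicalSpace M)
  | complex _ M => inferInstanceAs (TopologicalSpace M)
  | algebraic X _ => inferInstanceAs (TopologicalSpace X)

/-- The structure sheaf `O_X`: the sheaf of complex valued `C^∞`-functions, holomorphic functions,
or regular functions, respectively. -/
def structureSheaf : ∀ X : Manifold.{u}, AlgSheaf X.carrier
  | smooth n M => funSheaf ℝ (EuclideanSpace ℝ (Fin n)) M ∞
  | complex n M => funSheaf ℂ (EuclideanSpace ℂ (Fin n)) M ω
  | algebraic X f => schemeSheaf X f

/-- The structure sheaf of the differential graded manifold `X^♯` with underlying space `X`: the de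
Rham complex of `X`. -/
def sharp (X : Manifold.{u}) : CdgaSheaf X.carrier := deRham X.structureSheaf

end Manifold

end Manifolds

end DRCourant

end

/-!
Write `X♯` for the DG manifold, `T` for its tangent module and `Ω` for the dual of `T`.

In all three geometric settings the manifold has, locally, coordinates `x_a` together with vector
fields `∂_a` dual to them: for `C^∞` and holomorphic functions by Hadamard's lemma, for smooth
schemes by a standard smooth presentation (`hasCoords_structureSheaf`). Every derivation of the
de Rham complex is determined by its values on the `x_a` and the `dx_a`, so `T` is locally free on
the contractions `I_a = ι(∂_a)`, of degree `-1`, and the Lie derivatives `[d, I_a]`, of degree `0`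
(`HasCoords.hasFrames`). The rest of the argument uses only this local frame and the fact that the
de Rham complex lives in degrees `≥ 0`.

Let `Q` be an exact Courant algebroid. Since `Ω` lives in degrees `≥ 0`, the anchor is an
isomorphism `Q → T` in degree `-1`. A bracket-preserving splitting compatible with `d` therefore has
no freedom: its value on `I_a` is the unique lift `r` of `I_a`, and its value on `[d, I_a]` is the
differential of `r`. Conversely, the submodule generated by the sections `r` of degree `-1` and
their differentials (`IsLag`) is isotropic and closed under the bracket, because every obstruction
lies in a degree where the de Rham complex or `Ω` vanishes, or is the differential of such an
obstruction (`IsLag.pair_eq_zero`, `IsLag.br`). It maps isomorphically to `T`, and the inverse is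
the unique flat connection (`nonempty_unique_flatConnection`); uniqueness is what lets local
connections glue.

The flat connection identifies `Q` with the standard Courant algebroid `T ⊕ Ω` with the Dorfman
bracket (`ofStd`), and a morphism of exact Courant algebroids is determined by the flat connections
and by `∂` (`Hom.eq_of_isExact`). Hence over every open set there is an exact Courant algebroid and
any two are joined by exactly one morphism (`isContractible_exactCA`). A prestack whose fibre
categories are all contractible is a stack, equivalent to the final one
(`isStack_and_areEquivalent`).
-/

/-! ### Pseudofunctors with contractible values -/

namespace DRCourant
section ContractibleFibres

open Opposite Bicategory
open scoped Pseudofunctor.StrongTrans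

universe v w v' u'

/-- Every two objects of the category are related by exactly one morphism, and there is an
object: the category is equivalent to `[0]`. -/
structure IsContractible (C : Type w) [Category.{v} C] : Prop where
  nonempty : Nonempty C
  nonempty_hom : ∀ M N : C, Nonempty (M ⟶ N)
  hom_ext : ∀ {M N : C} (f g : M ⟶ N), f = g

namespace IsContractible

variable {C : Type w} [Category.{v} C]

/-- The unique isomorphism between two objects. -/
noncomputable def iso (hC : IsContractible C) (M N : C) : M ≅ N where
  hom := (hC.nonempty_hom M N).some
  inv := (hC.nonempty_hom N M).some
  hom_inv_id := hC.hom_ext _ _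
  inv_hom_id := hC.hom_ext _ _

/-- The unique isomorphism between two functors with values in a contractible category. -/
noncomputable def natIso (hC : IsContractible C) {D : Type u'} [Category.{v'} D]
    (F G : D ⥤ C) : F ≅ G :=
  NatIso.ofComponents (fun _ => hC.iso _ _) fun _ => hC.hom_ext _ _

end IsContractible

theorem cat_hom₂_ext {C D : Cat.{v, w}} (hD : IsContractible D) {F G : C ⟶ D} (α β : F ⟶ G) :
    α = β := by
  ext M
  exact hD.hom_ext _ _

/-- The unique 2-isomorphism between two functors with contractible target. -/
noncomputable def catIso {C D : Cat.{v, w}} (hD : IsContractible D) (F G : C ⟶ D) : F ≅ G where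
  hom := ((hD.natIso F.toFunctor G.toFunctor).hom).toCatHom₂
  inv := ((hD.natIso F.toFunctor G.toFunctor).inv).toCatHom₂
  hom_inv_id := cat_hom₂_ext hD _ _
  inv_hom_id := cat_hom₂_ext hD _ _

/-- Descent data with values in contractible categories are all isomorphic, and so are all objects, by
unique isomorphisms: descent is automatic. -/
theorem isStack_of_isContractible {C : Type w} [Category.{v} C] (J : GrothendieckTopology C)
    (F : Pseudofunctor (LocallyDiscrete Cᵒᵖ) Cat.{v', u'})
    (hF : ∀ S, IsContractible (F.obj S)) : F.IsStack J := by
  refine Pseudofunctor.IsStack.of_isStackFor fun S R _ => ⟨?_⟩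
  have hff : (F.toDescentData (fun f : R.arrows.category => f.obj.hom)).FullyFaithful :=
    { preimage := fun {M N} _ => ((hF _).nonempty_hom M N).some
      map_preimage := fun f => Pseudofunctor.DescentData.hom_ext fun i => (hF _).hom_ext _ _
      preimage_map := fun f => (hF _).hom_ext _ _ }
  have := hff.full
  have := hff.faithful
  refine { essSurj := ⟨fun D => ?_⟩ }
  obtain ⟨M⟩ := (hF (.mk (op S))).nonempty
  exact ⟨M, ⟨Pseudofunctor.DescentData.isoMk (fun i => (hF _).iso _ _)
    (fun _ _ _ _ _ _ _ _ => (hF _).hom_ext _ _)⟩⟩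

/-- The pseudonatural transformation with arbitrary components to a pseudofunctor with contractible
values. -/
noncomputable def strongTransOfContractible {B : Type u'} [Bicategory.{v, v'} B]
    {F G : Pseudofunctor B Cat.{v, w}} (hG : ∀ S, IsContractible (G.obj S))
    (app : ∀ S, F.obj S ⟶ G.obj S) : F ⟶ G where
  app := app
  naturality _ := catIso (hG _) _ _
  naturality_naturality _ := cat_hom₂_ext (hG _) _ _
  naturality_id _ := cat_hom₂_ext (hG _) _ _
  naturality_comp _ _ := cat_hom₂_ext (hG _) _ _

theorem modification_ext {B : Type u'} [Bicategory.{v, v'} B]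
    {F G : Pseudofunctor B Cat.{v, w}} (hG : ∀ S, IsContractible (G.obj S)) {η θ : F ⟶ G}
    (α β : η ⟶ θ) : α = β := by
  ext S M
  exact (hG S).hom_ext _ _

/-- The unique invertible modification between two pseudonatural transformations to a pseudofunctor
with contractible values. -/
noncomputable def modificationIso {B : Type u'} [Bicategory.{v, v'} B]
    {F G : Pseudofunctor B Cat.{v, w}} (hG : ∀ S, IsContractible (G.obj S)) (η θ : F ⟶ G) :
    η ≅ θ where
  hom := ⟨⟨fun S => (catIso (hG S) (η.app S) (θ.app S)).hom, fun _ => cat_hom₂_ext (hG _) _ _⟩⟩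
  inv := ⟨⟨fun S => (catIso (hG S) (θ.app S) (η.app S)).hom, fun _ => cat_hom₂_ext (hG _) _ _⟩⟩
  hom_inv_id := modification_ext hG _ _
  inv_hom_id := modification_ext hG _ _

/-- Pseudofunctors with contractible values are equivalent. -/
theorem nonempty_equivalence_of_isContractible {B : Type u'} [Bicategory.{v, v'} B]
    {F G : Pseudofunctor B Cat.{v, w}} (hF : ∀ S, IsContractible (F.obj S))
    (hG : ∀ S, IsContractible (G.obj S)) : Nonempty (Bicategory.Equivalence F G) := by
  refine ⟨⟨
    strongTransOfContractible hG fun S => ((Functor.const _).obj (hG S).nonempty.some).toCatHom,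
    strongTransOfContractible hF fun S => ((Functor.const _).obj (hF S).nonempty.some).toCatHom,
    modificationIso hF _ _, modificationIso hG _ _, ?_⟩⟩
  ext : 1
  exact modification_ext hG _ _

theorem isContractible_pointCat : IsContractible PointCat.{u} where
  nonempty := ⟨⟨⟨PUnit.unit⟩⟩⟩
  nonempty_hom _ _ := ⟨ULift.up ⟨Subsingleton.elim _ _⟩⟩
  hom_ext f g := Subsingleton.elim (α := ULift (PLift _)) f g

end ContractibleFibres

/-- If over every open set there is exactly one exact Courant algebroid up to unique isomorphism, the
exact Courant algebroids form a stack, equivalent to the final one. -/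
theorem isStack_and_areEquivalent {X : Type u} [TopologicalSpace X] (A : CdgaSheaf X)
    (hA : ∀ U, IsContractible (ExactCA A U)) :
    (ECA A).IsStack (Opens.grothendieckTopology X) ∧ AreEquivalent (ECA A) (finalStack X) :=
  ⟨isStack_of_isContractible _ _ fun S => hA S.as.unop,
    nonempty_equivalence_of_isContractible (fun S => hA S.as.unop)
      fun _ => isContractible_pointCat⟩
end DRCourant

/-! ### Derivations of a sheaf of differential graded algebras -/

noncomputable section
namespace DRCourant

variable {X : Type u} [TopologicalSpace X] {A : CdgaSheaf X}

theorem neg_one_zpow_eq_or (n : ℤ) : (-1 : ℂ) ^ n = 1 ∨ (-1 : ℂ) ^ n = -1 := by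
  rcases Int.even_or_odd n with h | h
  · exact Or.inl h.neg_one_zpow
  · exact Or.inr h.neg_one_zpow

namespace CdgaSheaf

theorem eq_of_cover {i : ℤ} {V : Opens X} {ι : Type u} {W : ι → Opens X} (hW : ∀ a, W a ≤ V)
    (cov : ∀ x ∈ V, ∃ a, x ∈ W a) {s t : A.sec i V} (h : ∀ a, A.res (hW a) s = A.res (hW a) t) :
    s = t := by
  obtain ⟨r, _, hr⟩ := A.glue i V ι W hW cov (fun a => A.res (hW a) s) fun a b Z ha hb =>
      (A.res_res _ _ s).trans (A.res_res _ _ s).symm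
  exact (hr s fun a => rfl).trans (hr t fun a => (h a).symm).symm

/-- Linear maps to the sections over the members of a cover, compatible on overlaps, glue. -/
theorem exists_linear_glue {M : Type*} [AddCommGroup M] [Module ℂ M] {i : ℤ} {V : Opens X}
    {ι : Type u} {W : ι → Opens X} (hW : ∀ a, W a ≤ V) (cov : ∀ x ∈ V, ∃ a, x ∈ W a)
    (F : ∀ a, M →ₗ[ℂ] A.sec i (W a))
    (hF : ∀ (a b : ι) (Z : Opens X) (ha : Z ≤ W a) (hb : Z ≤ W b) (m : M),
      A.res ha (F a m) = A.res hb (F b m)) :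
    ∃ G : M →ₗ[ℂ] A.sec i V, ∀ a m, A.res (hW a) (G m) = F a m := by
  have key : ∀ m, ∃ t : A.sec i V, ∀ a, A.res (hW a) t = F a m := fun m =>
    (A.glue i V ι W hW cov (fun a => F a m) fun a b Z ha hb => hF a b Z ha hb m).exists
  choose G hG using key
  refine ⟨{ toFun := G, map_add' := fun m n => ?_, map_smul' := fun c m => ?_ },
    fun a m => hG m a⟩
  · exact eq_of_cover hW cov fun a => by rw [map_add, hG, hG, hG, map_add]
  · exact eq_of_cover hW cov fun a => by rw [RingHom.id_apply, map_smul, hG, hG, map_smul]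

theorem d_one (V : Opens X) : A.d (zero_add 1) (A.one V) = 0 := by
  have h := A.d_mul (zero_add 0) (zero_add 1) (zero_add 1) (zero_add 1) (add_zero 1) (zero_add 1)
    (A.one V) (A.one V)
  rw [A.one_mul, A.one_mul, zpow_zero, one_smul,
    A.mul_comm (add_zero 1) (zero_add 1), A.one_mul, mul_zero, zpow_zero, one_smul] at h
  exact left_eq_add.mp h

end CdgaSheaf

theorem cover_inf {V Z : Opens X} {ι : Type u} {W : ι → Opens X}
    (cov : ∀ x ∈ V, ∃ a, x ∈ W a) (hZ : Z ≤ V) : ∀ x ∈ Z, ∃ a, x ∈ Z ⊓ W a := fun x hx => by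
  obtain ⟨a, ha⟩ := cov x (hZ hx)
  exact ⟨a, hx, ha⟩

namespace Der

variable {V W Z : Opens X} {k l m : ℤ}

theorem ext_on {D E : Der A k V}
    (h : ∀ (W : Opens X) (hW : W ≤ V) (i j : ℤ) (hj : i + k = j) (a : A.sec i W),
      on D hW hj a = on E hW hj a) : D = E := by
  refine Subtype.ext ?_
  funext W i j
  exact LinearMap.ext fun a => h W.1 W.2 i j.1 j.2 a

@[simp] theorem on_mk
    (F : ∀ {W : Opens X}, W ≤ V → ∀ {i j : ℤ}, i + k = j → A.sec i W →ₗ[ℂ] A.sec j W)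
    (hF hF') (hW : W ≤ V) {i j : ℤ} (h : i + k = j) :
    on (mk F hF hF') hW h = F hW h := rfl

@[simp] theorem on_add (D E : Der A k V) (hW : W ≤ V) {i j : ℤ} (h : i + k = j) (a : A.sec i W) :
    on (D + E) hW h a = on D hW h a + on E hW h a := rfl

@[simp] theorem on_sub (D E : Der A k V) (hW : W ≤ V) {i j : ℤ} (h : i + k = j) (a : A.sec i W) :
    on (D - E) hW h a = on D hW h a - on E hW h a := rfl

@[simp] theorem on_zero (hW : W ≤ V) {i j : ℤ} (h : i + k = j) (a : A.sec i W) :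
    on (0 : Der A k V) hW h a = 0 := rfl

@[simp] theorem on_smul (c : ℂ) (D : Der A k V) (hW : W ≤ V) {i j : ℤ} (h : i + k = j)
    (a : A.sec i W) : on (c • D) hW h a = c • on D hW h a := rfl

@[simp] theorem on_res (h : W ≤ V) (D : Der A k V) (hZ : Z ≤ W) {i j : ℤ} (hj : i + k = j) :
    on (res h D) hZ hj = on D (hZ.trans h) hj := rfl

theorem res_res (h : W ≤ V) (h' : Z ≤ W) (D : Der A k V) :
    res h' (res h D) = res (h'.trans h) D := rfl

theorem res_self (D : Der A k V) : res le_rfl D = D := rfl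

theorem on_fsmul {i : ℤ} (h : i + k = l) (f : A.sec i V) (D : Der A k V) (hW : W ≤ V) {p q r : ℤ}
    (hq : p + l = q) (hr : p + k = r) (hq' : i + r = q) (a : A.sec p W) :
    on (fsmul h f D) hW hq a = A.mul hq' (A.res hW f) (on D hW hr a) := by
  subst hr; rfl

theorem on_bracket (h : k + l = m) (D : Der A k V) (E : Der A l V) (hW : W ≤ V) {p q r s : ℤ}
    (hq : p + m = q) (hr : p + l = r) (hs : p + k = s) (h₁ : r + k = q) (h₂ : s + l = q)
    (a : A.sec p W) :
    on (bracket h D E) hW hq a =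
      on D hW h₁ (on E hW hr a) - (-1 : ℂ) ^ (k * l) • on E hW h₂ (on D hW hs a) := by
  subst hr hs; rfl

theorem on_diff (h : k + 1 = l) (D : Der A k V) (hW : W ≤ V) {p q r s : ℤ}
    (hq : p + l = q) (hr : p + k = r) (hs : p + 1 = s) (h₁ : r + 1 = q) (h₂ : s + k = q)
    (a : A.sec p W) :
    on (diff h D) hW hq a = A.d h₁ (on D hW hr a) - (-1 : ℂ) ^ k • on D hW h₂ (A.d hs a) := by
  subst hr hs; rfl

/-- The differential of the structure sheaf, as a derivation of degree `1`. -/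
def δ (V : Opens X) : Der A 1 V :=
  mk (fun _ _ _ h => A.d h) (fun _ h' _ _ h a => A.res_d h' h a)
    (fun _ i _ _ _ _ _ hl hi' hj' hl' h₁ h₂ a b => by
      rw [A.d_mul hl hi' hj' hl' h₁ h₂, one_mul])

@[simp] theorem on_δ (hW : W ≤ V) {i j : ℤ} (h : i + 1 = j) (a : A.sec i W) :
    on (δ V : Der A 1 V) hW h a = A.d h a := rfl

theorem res_δ (h : W ≤ V) : res h (δ V : Der A 1 V) = δ W := rfl

theorem diff_eq_bracket (h : k + 1 = l) (h' : 1 + k = l) (D : Der A k V) :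
    diff h D = bracket h' (δ V) D :=
  ext_on fun W hW p q hq a => by
    rw [on_diff h D hW hq rfl rfl (by omega) (by omega),
      on_bracket h' _ D hW hq rfl rfl (by omega) (by omega), one_mul, on_δ, on_δ]

theorem res_fsmul {i : ℤ} (h : i + k = l) (f : A.sec i V) (D : Der A k V) (hW : W ≤ V) :
    res hW (fsmul h f D) = fsmul h (A.res hW f) (res hW D) :=
  ext_on fun Z hZ p q hq a => by
    rw [on_res, on_fsmul h f D _ hq rfl (by omega), on_fsmul h _ _ _ hq rfl (by omega), A.res_res,
      on_res]

theorem res_bracket (h : k + l = m) (D : Der A k V) (E : Der A l V) (hW : W ≤ V) :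
    res hW (bracket h D E) = bracket h (res hW D) (res hW E) := rfl

theorem res_diff (h : k + 1 = l) (D : Der A k V) (hW : W ≤ V) :
    res hW (diff h D) = diff h (res hW D) := rfl

variable (A V) in
/-- Multiplication of vector fields by functions, as a bilinear map. -/
def fsmulₗ {i : ℤ} (h : i + k = l) : A.sec i V →ₗ[ℂ] Der A k V →ₗ[ℂ] Der A l V :=
  LinearMap.mk₂ ℂ (fsmul h)
    (fun f g D => ext_on fun W hW p q hq a => by
      simp only [on_add, on_fsmul h _ D hW hq rfl (show i + (p + k) = q by omega), map_add,
        LinearMap.add_apply])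
    (fun c f D => ext_on fun W hW p q hq a => by
      simp only [on_smul, on_fsmul h _ D hW hq rfl (show i + (p + k) = q by omega), map_smul,
        LinearMap.smul_apply])
    (fun f D E => ext_on fun W hW p q hq a => by
      simp only [on_add, on_fsmul h f _ hW hq rfl (show i + (p + k) = q by omega), map_add])
    (fun c f D => ext_on fun W hW p q hq a => by
      simp only [on_smul, on_fsmul h f _ hW hq rfl (show i + (p + k) = q by omega), map_smul])

@[simp] theorem fsmulₗ_apply {i : ℤ} (h : i + k = l) (f : A.sec i V) (D : Der A k V) :
    fsmulₗ A V h f D = fsmul h f D := rfl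

variable (A V) in
/-- The commutator of vector fields, as a bilinear map. -/
def bracketₗ (h : k + l = m) : Der A k V →ₗ[ℂ] Der A l V →ₗ[ℂ] Der A m V :=
  LinearMap.mk₂ ℂ (bracket h)
    (fun D D' E => ext_on fun W hW p q hq a => by
      simp only [on_add, on_bracket h _ _ hW hq rfl rfl (show p + l + k = q by omega)
        (show p + k + l = q by omega), map_add, smul_add]
      abel)
    (fun c D E => ext_on fun W hW p q hq a => by
      simp only [on_smul, on_bracket h _ _ hW hq rfl rfl (show p + l + k = q by omega)
        (show p + k + l = q by omega), map_smul, smul_sub, smul_comm c])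
    (fun D E E' => ext_on fun W hW p q hq a => by
      simp only [on_add, on_bracket h _ _ hW hq rfl rfl (show p + l + k = q by omega)
        (show p + k + l = q by omega), map_add, smul_add]
      abel)
    (fun c D E => ext_on fun W hW p q hq a => by
      simp only [on_smul, on_bracket h _ _ hW hq rfl rfl (show p + l + k = q by omega)
        (show p + k + l = q by omega), map_smul, smul_sub, smul_comm c])

@[simp] theorem bracketₗ_apply (h : k + l = m) (D : Der A k V) (E : Der A l V) :
    bracketₗ A V h D E = bracket h D E := rfl

theorem one_fsmul (D : Der A k V) : fsmul (zero_add k) (A.one V) D = D :=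
  ext_on fun W hW p q hq a => by
    rw [on_fsmul _ _ D hW hq hq (zero_add q), A.res_one, A.one_mul]

theorem mul_fsmul {i j n : ℤ} (h₁ : i + j = m) (h₂ : m + l = k) (h₃ : j + l = n)
    (h₄ : i + n = k) (f : A.sec i V) (g : A.sec j V) (D : Der A l V) :
    fsmul h₂ (A.mul h₁ f g) D = fsmul h₄ f (fsmul h₃ g D) :=
  ext_on fun W hW p q hq a => by
    rw [on_fsmul h₂ _ D hW hq rfl (by omega), on_fsmul h₄ f _ hW hq rfl (by omega),
      on_fsmul h₃ g D hW rfl rfl (by omega), A.res_mul,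
      A.mul_assoc h₁ (show m + (p + l) = q by omega) (show j + (p + l) = p + n by omega)
        (show i + (p + n) = q by omega)]

theorem bracket_symm (h : k + l = m) (h' : l + k = m) (D : Der A k V) (E : Der A l V) :
    bracket h D E + (-1 : ℂ) ^ (k * l) • bracket h' E D = 0 :=
  ext_on fun W hW p q hq a => by
    rw [on_add, on_smul, on_bracket h _ _ hW hq rfl rfl (by omega) (by omega),
      on_bracket h' _ _ hW hq rfl rfl (by omega) (by omega), mul_comm l k]
    rcases neg_one_zpow_eq_or (k * l) with e | e <;> rw [e] <;> simp

theorem jacobi {i j n p : ℤ} (h₁ : j + k = l) (h₂ : i + l = p) (h₃ : i + j = m)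
    (h₄ : m + k = p) (h₅ : i + k = n) (h₆ : j + n = p) (D : Der A i V) (E : Der A j V)
    (F : Der A k V) :
    bracket h₂ D (bracket h₁ E F) =
      bracket h₄ (bracket h₃ D E) F + (-1 : ℂ) ^ (i * j) • bracket h₆ E (bracket h₅ D F) :=
  ext_on fun W hW r q hq a => by
    obtain ⟨ri, hi⟩ : ∃ x, r + i = x := ⟨_, rfl⟩
    obtain ⟨rj, hj⟩ : ∃ x, r + j = x := ⟨_, rfl⟩
    obtain ⟨rk, hk⟩ : ∃ x, r + k = x := ⟨_, rfl⟩
    obtain ⟨rm, hm⟩ : ∃ x, r + m = x := ⟨_, rfl⟩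
    obtain ⟨rn, hn⟩ : ∃ x, r + n = x := ⟨_, rfl⟩
    obtain ⟨rl, hl⟩ : ∃ x, r + l = x := ⟨_, rfl⟩
    rw [on_add, on_smul, on_bracket h₂ _ _ hW hq hl hi (by omega) (by omega),
      on_bracket h₄ _ _ hW hq hk hm (by omega) (by omega),
      on_bracket h₆ _ _ hW hq hn hj (by omega) (by omega),
      on_bracket h₁ _ _ hW hl hk hj (by omega) (by omega),
      on_bracket h₁ _ _ hW (p := ri) (q := q) (r := rn) (s := rm) (by omega) (by omega) (by omega)
        (by omega) (by omega),
      on_bracket h₃ _ _ hW hm hj hi (by omega) (by omega),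
      on_bracket h₃ _ _ hW (p := rk) (q := q) (r := rl) (s := rn) (by omega) (by omega) (by omega)
        (by omega) (by omega),
      on_bracket h₅ _ _ hW hn hk hi (by omega) (by omega),
      on_bracket h₅ _ _ hW (p := rj) (q := q) (r := rl) (s := rm) (by omega) (by omega) (by omega)
        (by omega) (by omega)]
    subst h₁ h₃ h₅
    simp only [map_sub, map_smul, smul_sub, smul_smul, mul_add, add_mul,
      zpow_add₀ (show (-1 : ℂ) ≠ 0 by norm_num), mul_comm j i]
    rcases neg_one_zpow_eq_or (i * j) with e₁ | e₁ <;>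
      rcases neg_one_zpow_eq_or (i * k) with e₂ | e₂ <;>
      rcases neg_one_zpow_eq_or (j * k) with e₃ | e₃ <;>
      simp only [e₁, e₂, e₃] <;> module

theorem bracket_fsmul {i j n p : ℤ} (h₁ : j + k = l) (h₂ : i + l = n) (h₃ : i + k = m)
    (h₄ : j + m = n) (h₅ : j + i = p) (h₆ : p + k = n) (D : Der A i V) (f : A.sec j V)
    (E : Der A k V) :
    bracket h₂ D (fsmul h₁ f E) =
      (-1 : ℂ) ^ (i * j) • fsmul h₄ f (bracket h₃ D E) + fsmul h₆ (act D h₅ f) E :=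
  ext_on fun W hW r q hq a => by
    obtain ⟨ri, hi⟩ : ∃ x, r + i = x := ⟨_, rfl⟩
    obtain ⟨rk, hk⟩ : ∃ x, r + k = x := ⟨_, rfl⟩
    obtain ⟨rl, hl⟩ : ∃ x, r + l = x := ⟨_, rfl⟩
    obtain ⟨rm, hm⟩ : ∃ x, r + m = x := ⟨_, rfl⟩
    rw [on_add, on_smul, on_bracket h₂ _ _ hW hq hl hi (by omega) (by omega),
      on_fsmul h₁ f E hW hl hk (by omega),
      on_fsmul h₁ f E hW (p := ri) (q := q) (r := rm) (by omega) (by omega) (by omega),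
      on_fsmul h₄ f _ hW hq hm (by omega),
      on_fsmul h₆ _ E hW hq hk (by omega),
      on_mul D hW (l := rl) (i := j) (j := rk) (i' := p) (j' := rm) (l' := q) (by omega) h₅
        (by omega) (by omega) (by omega) (by omega),
      on_bracket h₃ _ _ hW hm hk hi (by omega) (by omega), act, res_on]
    subst h₁
    simp only [map_sub, map_smul, smul_sub, smul_smul, mul_add, add_mul,
      zpow_add₀ (show (-1 : ℂ) ≠ 0 by norm_num)]
    abel

end Der
end DRCourant
end

/-! ### One-forms and the Lie derivative -/

noncomputable section
namespace DRCourant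

variable {X : Type u} [TopologicalSpace X] {A : CdgaSheaf X}

namespace OneForm

variable {V W Z : Opens X} {m n : ℤ}

theorem ext_on {φ ψ : OneForm A m V}
    (h : ∀ (W : Opens X) (hW : W ≤ V) (k j : ℤ) (hj : m + k = j) (D : Der A k W),
      on φ hW hj D = on ψ hW hj D) : φ = ψ := by
  refine Subtype.ext ?_
  funext W k j
  exact LinearMap.ext fun D => h W.1 W.2 k j.1 j.2 D

@[simp] theorem on_mk
    (F : ∀ {W : Opens X}, W ≤ V → ∀ {k j : ℤ}, m + k = j → Der A k W →ₗ[ℂ] A.sec j W)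
    (hF hF') (hW : W ≤ V) {k j : ℤ} (h : m + k = j) :
    on (mk F hF hF') hW h = F hW h := rfl

@[simp] theorem on_add (φ ψ : OneForm A m V) (hW : W ≤ V) {k j : ℤ} (h : m + k = j)
    (D : Der A k W) : on (φ + ψ) hW h D = on φ hW h D + on ψ hW h D := rfl

@[simp] theorem on_sub (φ ψ : OneForm A m V) (hW : W ≤ V) {k j : ℤ} (h : m + k = j)
    (D : Der A k W) : on (φ - ψ) hW h D = on φ hW h D - on ψ hW h D := rfl

@[simp] theorem on_smul (c : ℂ) (φ : OneForm A m V) (hW : W ≤ V) {k j : ℤ} (h : m + k = j)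
    (D : Der A k W) : on (c • φ) hW h D = c • on φ hW h D := rfl

@[simp] theorem on_zero (hW : W ≤ V) {k j : ℤ} (h : m + k = j) (D : Der A k W) :
    on (0 : OneForm A m V) hW h D = 0 := rfl

@[simp] theorem on_res (h : W ≤ V) (φ : OneForm A m V) (hZ : Z ≤ W) {k j : ℤ} (hj : m + k = j) :
    on (res h φ) hZ hj = on φ (hZ.trans h) hj := rfl

theorem res_on (φ : OneForm A m V) (hW : W ≤ V) (h' : Z ≤ W) {k j : ℤ} (h : m + k = j)
    (D : Der A k W) : A.res h' (on φ hW h D) = on φ (h'.trans hW) h (Der.res h' D) :=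
  φ.2.1 W Z hW h' k j h D

theorem on_fsmul_right (φ : OneForm A m V) (hW : W ≤ V) {i k l j n : ℤ} (hl : i + k = l)
    (hj : m + k = j) (hn : m + l = n) (hn' : i + j = n) (f : A.sec i W) (D : Der A k W) :
    on φ hW hn (Der.fsmul hl f D) = (-1 : ℂ) ^ (m * i) • A.mul hn' f (on φ hW hj D) :=
  φ.2.2 W hW i k l j n hl hj hn hn' f D

theorem on_fsmul {i l : ℤ} (h : i + m = l) (f : A.sec i V) (φ : OneForm A m V) (hW : W ≤ V)
    {k j p : ℤ} (hj : l + k = j) (hp : m + k = p) (hj' : i + p = j) (D : Der A k W) :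
    on (fsmul h f φ) hW hj D = A.mul hj' (A.res hW f) (on φ hW hp D) := by
  subst hp; rfl

theorem on_ofFun (f : A.sec m V) (hW : W ≤ V) {k j : ℤ} (h : m + k = j) (D : Der A k W) :
    on (ofFun f) hW h D = (-1 : ℂ) ^ (k * m) • Der.act D h (A.res hW f) := rfl

/-- Restriction of one-forms as a linear map. -/
def resₗ (h : W ≤ V) : OneForm A m V →ₗ[ℂ] OneForm A m W where
  toFun := res h
  map_add' _ _ := rfl
  map_smul' _ _ := rfl

@[simp] theorem resₗ_apply (h : W ≤ V) (φ : OneForm A m V) : resₗ h φ = res h φ := rfl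

variable (A V) in
/-- Multiplication of one-forms by functions, as a bilinear map. -/
def fsmulₗ {i l : ℤ} (h : i + m = l) : A.sec i V →ₗ[ℂ] OneForm A m V →ₗ[ℂ] OneForm A l V :=
  LinearMap.mk₂ ℂ (fsmul h)
    (fun f g φ => ext_on fun W hW p q hq a => by
      simp only [on_add, on_fsmul h _ φ hW hq rfl (show i + (m + p) = q by omega), map_add,
        LinearMap.add_apply])
    (fun c f φ => ext_on fun W hW p q hq a => by
      simp only [on_smul, on_fsmul h _ φ hW hq rfl (show i + (m + p) = q by omega), map_smul,
        LinearMap.smul_apply])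
    (fun f φ ψ => ext_on fun W hW p q hq a => by
      simp only [on_add, on_fsmul h f _ hW hq rfl (show i + (m + p) = q by omega), map_add])
    (fun c f φ => ext_on fun W hW p q hq a => by
      simp only [on_smul, on_fsmul h f _ hW hq rfl (show i + (m + p) = q by omega), map_smul])

@[simp] theorem fsmulₗ_apply {i l : ℤ} (h : i + m = l) (f : A.sec i V) (φ : OneForm A m V) :
    fsmulₗ A V h f φ = fsmul h f φ := rfl

variable (A V m) in
/-- The universal derivation as a linear map. -/
def ofFunₗ : A.sec m V →ₗ[ℂ] OneForm A m V where
  toFun := ofFun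
  map_add' f g := ext_on fun W hW p q hq a => by
    simp only [on_add, on_ofFun, map_add, smul_add]
  map_smul' c f := ext_on fun W hW p q hq a => by
    simp only [on_smul, on_ofFun, map_smul, RingHom.id_apply, smul_comm c]

@[simp] theorem ofFunₗ_apply (f : A.sec m V) : ofFunₗ A V m f = ofFun f := rfl

theorem ofFun_smul (c : ℂ) (f : A.sec m V) : ofFun (c • f) = c • ofFun f :=
  (ofFunₗ A V m).map_smul c f

theorem res_ofFun (f : A.sec m V) (h : W ≤ V) : res h (ofFun f) = ofFun (A.res h f) :=
  ext_on fun Z hZ k j hj D => by rw [on_res, on_ofFun, on_ofFun, A.res_res]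

theorem res_fsmul {i l : ℤ} (h : i + m = l) (f : A.sec i V) (φ : OneForm A m V) (hW : W ≤ V) :
    res hW (fsmul h f φ) = fsmul h (A.res hW f) (res hW φ) :=
  ext_on fun Z hZ k j hj D => by
    rw [on_res, on_fsmul h f φ _ hj rfl (by omega), on_fsmul h _ _ _ hj rfl (by omega), A.res_res,
      on_res]

theorem one_fsmul (φ : OneForm A m V) : fsmul (zero_add m) (A.one V) φ = φ :=
  ext_on fun W hW p q hq a => by
    rw [on_fsmul _ _ φ hW hq hq (zero_add q), A.res_one, A.one_mul]

theorem mul_fsmul {i j l n k : ℤ} (h₁ : i + j = m) (h₂ : m + l = k) (h₃ : j + l = n)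
    (h₄ : i + n = k) (f : A.sec i V) (g : A.sec j V) (φ : OneForm A l V) :
    fsmul h₂ (A.mul h₁ f g) φ = fsmul h₄ f (fsmul h₃ g φ) :=
  ext_on fun W hW p q hq a => by
    rw [on_fsmul h₂ _ φ hW hq rfl (by omega), on_fsmul h₄ f _ hW hq rfl (by omega),
      on_fsmul h₃ g φ hW rfl rfl (by omega), A.res_mul,
      A.mul_assoc h₁ (show m + (l + p) = q by omega) (show j + (l + p) = n + p by omega)
        (show i + (n + p) = q by omega)]

/-- The universal derivation satisfies the Leibniz rule. -/
theorem ofFun_mul {i j k : ℤ} (h : i + j = k) (h' : j + i = k) (f : A.sec i V) (g : A.sec j V) :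
    ofFun (A.mul h f g) = fsmul h f (ofFun g) + (-1 : ℂ) ^ (i * j) • fsmul h' g (ofFun f) :=
  ext_on fun W hW p q hq D => by
    obtain ⟨ip, hi⟩ : ∃ x, i + p = x := ⟨_, rfl⟩
    obtain ⟨jp, hj⟩ : ∃ x, j + p = x := ⟨_, rfl⟩
    rw [on_add, on_smul, on_ofFun, on_fsmul h f _ hW hq hj (by omega),
      on_fsmul h' g _ hW hq hi (by omega), on_ofFun, on_ofFun, A.res_mul, Der.act,
      Der.on_mul D _ h hi hj hq (by omega) (by omega),
      A.mul_comm (show ip + j = q by omega) (show j + ip = q by omega)]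
    subst h hi
    simp only [map_smul, smul_add, smul_smul, mul_add, add_mul, Der.act,
      zpow_add₀ (show (-1 : ℂ) ≠ 0 by norm_num), mul_comm j i, mul_comm j p, mul_comm i p]
    rcases neg_one_zpow_eq_or (i * j) with e₁ | e₁ <;>
      rcases neg_one_zpow_eq_or (p * i) with e₂ | e₂ <;>
      rcases neg_one_zpow_eq_or (p * j) with e₃ | e₃ <;>
      simp only [e₁, e₂, e₃] <;> module

/-- The Lie derivative of one-forms along vector fields:
`(L_D φ)(E) = D(φ(E)) - (-1)^{|D||φ|} φ([D, E])`. -/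
def lie {k n : ℤ} (h : k + m = n) (D : Der A k V) (φ : OneForm A m V) : OneForm A n V :=
  mk (fun {W} hW p q hq =>
      Der.on D hW (i := m + p) (by omega) ∘ₗ on φ hW rfl -
        (-1 : ℂ) ^ (k * m) • on φ hW (k := k + p) (by omega) ∘ₗ
          Der.bracketₗ A W rfl (Der.res hW D))
    (fun hW h' p q hq E => by
      simp only [LinearMap.sub_apply, LinearMap.smul_apply, LinearMap.comp_apply, map_sub, map_smul,
        Der.res_on, res_on, Der.bracketₗ_apply, Der.res_bracket, Der.res_res])
    (fun {W} hW i p l j r hl hj hr hr' f E => by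
      obtain ⟨ik, hik⟩ : ∃ x, i + k = x := ⟨_, rfl⟩
      obtain ⟨mp, hmp⟩ : ∃ x, m + p = x := ⟨_, rfl⟩
      obtain ⟨ml, hml⟩ : ∃ x, m + l = x := ⟨_, rfl⟩
      obtain ⟨kp, hkp⟩ : ∃ x, k + p = x := ⟨_, rfl⟩
      obtain ⟨kl, hkl⟩ : ∃ x, k + l = x := ⟨_, rfl⟩
      subst hmp hkp hml hkl
      simp only [LinearMap.sub_apply, LinearMap.smul_apply, LinearMap.comp_apply,
        Der.bracketₗ_apply]
      rw [on_fsmul_right φ hW hl rfl rfl (by omega), map_smul,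
        Der.on_mul D hW (i := i) (j := m + p) (i' := ik) (j' := j) (by omega) hik
          (by omega) (by omega) (by omega) (by omega),
        Der.bracket_fsmul hl rfl rfl (show i + (k + p) = k + l by omega) hik (by omega), map_add,
        map_smul, on_fsmul_right φ hW (j := j) _ (by omega) _ (by omega),
        on_fsmul_right φ hW _ rfl _ (show ik + (m + p) = r by omega)]
      subst hik h
      simp only [map_sub, map_smul, smul_sub, smul_add, smul_smul, mul_add, add_mul, Der.act,
        Der.on_res, zpow_add₀ (show (-1 : ℂ) ≠ 0 by norm_num), mul_comm i k, mul_comm i m,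
        mul_comm m k]
      rcases neg_one_zpow_eq_or (k * i) with e₁ | e₁ <;>
        rcases neg_one_zpow_eq_or (k * m) with e₂ | e₂ <;>
        rcases neg_one_zpow_eq_or (m * i) with e₃ | e₃ <;>
        simp only [e₁, e₂, e₃] <;> module)

theorem on_lie {k n : ℤ} (h : k + m = n) (D : Der A k V) (φ : OneForm A m V) (hW : W ≤ V)
    {p q r s : ℤ} (hq : n + p = q) (hr : m + p = r) (hq' : r + k = q) (hs : k + p = s)
    (hq'' : m + s = q) (E : Der A p W) :
    on (lie h D φ) hW hq E = Der.on D hW hq' (on φ hW hr E) -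
      (-1 : ℂ) ^ (k * m) • on φ hW hq'' (Der.bracket hs (Der.res hW D) E) := by
  subst hr hs; rfl

variable (A V) in
/-- The Lie derivative, as a bilinear map. -/
def lieₗ {k n : ℤ} (h : k + m = n) : Der A k V →ₗ[ℂ] OneForm A m V →ₗ[ℂ] OneForm A n V :=
  LinearMap.mk₂ ℂ (lie h)
    (fun D D' φ => ext_on fun W hW p q hq E => by
      simp only [on_add, Der.on_add, on_lie h _ φ hW hq rfl (show m + p + k = q by omega) rfl
        (show m + (k + p) = q by omega), map_add, ← Der.bracketₗ_apply, LinearMap.add_apply,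
        smul_add]
      abel)
    (fun c D φ => ext_on fun W hW p q hq E => by
      simp only [on_smul, Der.on_smul, on_lie h _ φ hW hq rfl (show m + p + k = q by omega) rfl
        (show m + (k + p) = q by omega), map_smul, ← Der.bracketₗ_apply, LinearMap.smul_apply,
        smul_sub, smul_comm c])
    (fun D φ ψ => ext_on fun W hW p q hq E => by
      simp only [on_add, on_lie h D _ hW hq rfl (show m + p + k = q by omega) rfl
        (show m + (k + p) = q by omega), map_add, smul_add]
      abel)
    (fun c D φ => ext_on fun W hW p q hq E => by
      simp only [on_smul, on_lie h D _ hW hq rfl (show m + p + k = q by omega) rfl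
        (show m + (k + p) = q by omega), map_smul, smul_sub, smul_comm c])

@[simp] theorem lieₗ_apply {k n : ℤ} (h : k + m = n) (D : Der A k V) (φ : OneForm A m V) :
    lieₗ A V h D φ = lie h D φ := rfl

theorem res_lie {k n : ℤ} (h : k + m = n) (D : Der A k V) (φ : OneForm A m V) (hW : W ≤ V) :
    res hW (lie h D φ) = lie h (Der.res hW D) (res hW φ) := rfl

/-- `L_D` commutes with the universal derivation. -/
theorem lie_ofFun {k n : ℤ} (h : k + m = n) (h' : m + k = n) (D : Der A k V) (f : A.sec m V) :
    lie h D (ofFun f) = ofFun (Der.act D h' f) :=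
  ext_on fun W hW p q hq E => by
    obtain ⟨mp, hp⟩ : ∃ x, m + p = x := ⟨_, rfl⟩
    obtain ⟨kp, hkp⟩ : ∃ x, k + p = x := ⟨_, rfl⟩
    rw [on_lie h D _ hW hq hp (by omega) hkp (by omega), on_ofFun, on_ofFun, on_ofFun]
    simp only [Der.act]
    rw [Der.on_bracket _ _ E _ _ hp h' (by omega) (by omega), Der.res_on]
    subst h hkp
    simp only [Der.on_res, map_sub, map_smul, smul_sub, smul_add, smul_smul, mul_add, add_mul,
      zpow_add₀ (show (-1 : ℂ) ≠ 0 by norm_num), mul_comm p m, mul_comm p k]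
    rcases neg_one_zpow_eq_or (m * p) with e₁ | e₁ <;>
      rcases neg_one_zpow_eq_or (k * m) with e₂ | e₂ <;>
      rcases neg_one_zpow_eq_or (k * p) with e₃ | e₃ <;>
      simp only [e₁, e₂, e₃] <;> module

theorem lie_fsmul {i j k l n r s : ℤ} (h₁ : j + k = l) (h₂ : i + l = n) (h₃ : i + k = r)
    (h₄ : j + r = n) (h₅ : j + i = s) (h₆ : s + k = n) (D : Der A i V) (f : A.sec j V)
    (φ : OneForm A k V) :
    lie h₂ D (fsmul h₁ f φ) =
      (-1 : ℂ) ^ (i * j) • fsmul h₄ f (lie h₃ D φ) + fsmul h₆ (Der.act D h₅ f) φ :=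
  ext_on fun W hW p q hq E => by
    obtain ⟨kp, hkp⟩ : ∃ x, k + p = x := ⟨_, rfl⟩
    obtain ⟨ip, hip⟩ : ∃ x, i + p = x := ⟨_, rfl⟩
    obtain ⟨lp, hlp⟩ : ∃ x, l + p = x := ⟨_, rfl⟩
    obtain ⟨rp, hrp⟩ : ∃ x, r + p = x := ⟨_, rfl⟩
    rw [on_lie h₂ D _ hW hq hlp (by omega) hip (by omega), on_add, on_smul,
      on_fsmul h₁ f φ hW hlp hkp (by omega), on_fsmul h₁ f φ hW _ (p := rp) (by omega) (by omega),
      on_fsmul h₄ f _ hW hq hrp (by omega), on_fsmul h₆ _ φ hW hq hkp (by omega),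
      on_lie h₃ D φ hW hrp hkp (by omega) hip (by omega),
      Der.on_mul D hW (j' := rp) _ h₅ (by omega) _ (by omega) (by omega), Der.act, Der.res_on]
    subst h₁
    simp only [map_sub, map_smul, smul_sub, smul_add, smul_smul, mul_add, add_mul,
      zpow_add₀ (show (-1 : ℂ) ≠ 0 by norm_num)]
    rcases neg_one_zpow_eq_or (i * j) with e₁ | e₁ <;>
      rcases neg_one_zpow_eq_or (i * k) with e₂ | e₂ <;>
      simp only [e₁, e₂] <;> module

/-- The Lie derivative along the product of a function and a vector field. -/
theorem fsmul_lie {i j k l n r s : ℤ} (h₁ : j + k = l) (h₂ : l + i = n) (h₃ : k + i = r)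
    (h₄ : j + r = n) (h₅ : i + k = s) (h₆ : s + j = n) (f : A.sec j V) (E : Der A k V)
    (φ : OneForm A i V) :
    lie h₂ (Der.fsmul h₁ f E) φ =
      fsmul h₄ f (lie h₃ E φ) + (-1 : ℂ) ^ (l * i + j * k) •
        fsmul h₆ (on φ le_rfl h₅ E) (ofFun f) :=
  ext_on fun W hW p q hq F => by
    obtain ⟨ip, hip⟩ : ∃ x, i + p = x := ⟨_, rfl⟩
    obtain ⟨lp, hlp⟩ : ∃ x, l + p = x := ⟨_, rfl⟩
    obtain ⟨kp, hkp⟩ : ∃ x, k + p = x := ⟨_, rfl⟩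
    obtain ⟨rp, hrp⟩ : ∃ x, r + p = x := ⟨_, rfl⟩
    obtain ⟨jp, hjp⟩ : ∃ x, j + p = x := ⟨_, rfl⟩
    have e : Der.bracket hlp (Der.fsmul h₁ (A.res hW f) (Der.res hW E)) F =
        Der.fsmul (show j + kp = lp by omega) (A.res hW f) (Der.bracket hkp (Der.res hW E) F) -
          (-1 : ℂ) ^ (l * p) • Der.fsmul (show jp + k = lp by omega)
            (Der.act F hjp (A.res hW f)) (Der.res hW E) := by
      have e₁ := Der.bracket_symm hlp (show p + l = lp by omega)
        (Der.fsmul h₁ (A.res hW f) (Der.res hW E)) F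
      rw [Der.bracket_fsmul h₁ _ (show p + k = kp by omega) (by omega) hjp (by omega)] at e₁
      rw [eq_neg_of_add_eq_zero_left e₁,
        eq_neg_of_add_eq_zero_left (Der.bracket_symm hkp (show p + k = kp by omega) _ F),
        ← Der.fsmulₗ_apply, ← Der.fsmulₗ_apply, ← Der.fsmulₗ_apply, map_neg, map_smul]
      subst h₁
      simp only [smul_add, smul_smul, add_mul, zpow_add₀ (show (-1 : ℂ) ≠ 0 by norm_num),
        mul_comm p j]
      rcases neg_one_zpow_eq_or (j * p) with e₁ | e₁ <;>
        rcases neg_one_zpow_eq_or (k * p) with e₂ | e₂ <;>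
        simp only [e₁, e₂] <;> module
    rw [on_lie h₂ _ φ hW hq hip (by omega) hlp (by omega), Der.res_fsmul, e, map_sub, map_smul,
      on_fsmul_right φ hW (j := rp) _ (by omega) _ (by omega),
      on_fsmul_right φ hW (j := s) _ (by omega) _ (by omega),
      Der.on_fsmul h₁ f E hW _ (r := rp) (by omega) (by omega), on_add, on_smul,
      on_fsmul h₄ f _ hW hq hrp (by omega), on_fsmul h₆ _ _ hW hq hjp (by omega),
      on_lie h₃ E φ hW hrp hip (by omega) hkp (by omega), on_ofFun, res_on,
      A.mul_comm (show jp + s = q by omega) (show s + jp = q by omega)]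
    subst h₁ hjp h₅
    simp only [map_sub, map_smul, smul_sub, smul_add, smul_smul, mul_add, add_mul,
      zpow_add₀ (show (-1 : ℂ) ≠ 0 by norm_num), mul_comm p j, mul_comm p i, mul_comm p k,
      mul_comm k i, mul_comm j i, mul_comm k j]
    rcases neg_one_zpow_eq_or (j * p) with e₁ | e₁ <;>
      rcases neg_one_zpow_eq_or (k * p) with e₂ | e₂ <;>
      rcases neg_one_zpow_eq_or (i * p) with e₃ | e₃ <;>
      rcases neg_one_zpow_eq_or (i * j) with e₄ | e₄ <;>
      rcases neg_one_zpow_eq_or (i * k) with e₅ | e₅ <;>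
      rcases neg_one_zpow_eq_or (j * k) with e₆ | e₆ <;>
      simp only [e₁, e₂, e₃, e₄, e₅, e₆] <;> module

theorem lie_lie {i j k l n p r : ℤ} (h₁ : j + k = l) (h₂ : i + l = n) (h₃ : i + j = p)
    (h₄ : p + k = n) (h₅ : i + k = r) (h₆ : j + r = n) (D : Der A i V) (E : Der A j V)
    (φ : OneForm A k V) :
    lie h₂ D (lie h₁ E φ) =
      lie h₄ (Der.bracket h₃ D E) φ + (-1 : ℂ) ^ (i * j) • lie h₆ E (lie h₅ D φ) :=
  ext_on fun W hW t q hq F => by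
    obtain ⟨it, hit⟩ : ∃ x, i + t = x := ⟨_, rfl⟩
    obtain ⟨jt, hjt⟩ : ∃ x, j + t = x := ⟨_, rfl⟩
    obtain ⟨kt, hkt⟩ : ∃ x, k + t = x := ⟨_, rfl⟩
    obtain ⟨lt, hlt⟩ : ∃ x, l + t = x := ⟨_, rfl⟩
    obtain ⟨pt, hpt⟩ : ∃ x, p + t = x := ⟨_, rfl⟩
    obtain ⟨rt, hrt⟩ : ∃ x, r + t = x := ⟨_, rfl⟩
    rw [on_lie h₂ D _ hW hq hlt (by omega) hit (by omega), on_add, on_smul,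
      on_lie h₄ _ φ hW hq hkt (by omega) hpt (by omega),
      on_lie h₆ E _ hW hq hrt (by omega) hjt (by omega),
      on_lie h₁ E φ hW hlt hkt (by omega) hjt (by omega),
      on_lie h₁ E φ hW (r := rt) (s := pt) _ (by omega) (by omega) (by omega) (by omega),
      on_lie h₅ D φ hW hrt hkt (by omega) hit (by omega),
      on_lie h₅ D φ hW (r := lt) (s := pt) _ (by omega) (by omega) (by omega) (by omega),
      Der.on_bracket h₃ D E hW _ (r := lt) (s := rt) (by omega) (by omega) (by omega) (by omega),
      Der.res_bracket, Der.jacobi hjt (show i + jt = pt by omega) h₃ hpt hit (by omega)]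
    subst h₁ h₃ h₅
    simp only [map_sub, map_add, map_smul, smul_sub, smul_add, smul_smul, mul_add, add_mul,
      zpow_add₀ (show (-1 : ℂ) ≠ 0 by norm_num), mul_comm j i]
    rcases neg_one_zpow_eq_or (i * j) with e₁ | e₁ <;>
      rcases neg_one_zpow_eq_or (i * k) with e₂ | e₂ <;>
      rcases neg_one_zpow_eq_or (j * k) with e₃ | e₃ <;>
      simp only [e₁, e₂, e₃] <;> module

end OneForm
end DRCourant
end

/-! ### The standard Courant algebroid -/

noncomputable section
namespace DRCourant

variable {X : Type u} [TopologicalSpace X] {A : CdgaSheaf X}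

theorem Der.uniqueGluing (k : ℤ) : UniqueGluing (X := X) id (Der A k) fun h => Der.res h := by
  intro V ι W hW cov s hs
  have hs' : ∀ (a b : ι) (Z : Opens X) (ha : Z ≤ W a) (hb : Z ≤ W b) {i j : ℤ} (h : i + k = j),
      Der.on (s a) ha h = Der.on (s b) hb h := fun a b Z ha hb i j h =>
    congrArg (fun D => Der.on D (le_refl Z) h) (hs a b Z ha hb)
  have key : ∀ {Z : Opens X} (hZ : Z ≤ V) {i j : ℤ} (h : i + k = j),
      ∃ G : A.sec i Z →ₗ[ℂ] A.sec j Z, ∀ a x, A.res (inf_le_left : Z ⊓ W a ≤ Z) (G x) =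
        Der.on (s a) inf_le_right h (A.res inf_le_left x) := by
    intro Z hZ i j h
    obtain ⟨G, hG⟩ := CdgaSheaf.exists_linear_glue (A := A) (M := A.sec i Z) (V := Z)
      (W := fun a => Z ⊓ W a) (fun a => inf_le_left) (cover_inf cov hZ)
      (fun a => Der.on (s a) inf_le_right h ∘ₗ A.res inf_le_left) fun a b Z' ha hb x => by
        simp only [LinearMap.comp_apply, Der.res_on, A.res_res]
        rw [hs' a b Z' _ (hb.trans inf_le_right) h]
    exact ⟨G, fun a x => hG a x⟩
  choose G hG using @key
  refine ⟨Der.mk (fun hZ _ _ h => G hZ h) ?_ ?_, ?_, ?_⟩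
  · intro Z Z' hZ h' i j h x
    refine CdgaSheaf.eq_of_cover (fun a => inf_le_left) (cover_inf cov (h'.trans hZ)) fun a => ?_
    have e := congrArg (A.res (inf_le_inf_right (W a) h')) (hG hZ h a x)
    rw [A.res_res, Der.res_on, A.res_res] at e
    rw [hG, A.res_res, A.res_res]
    exact e
  · intro Z hZ i j l i' j' l' hl hi' hj' hl' h₁ h₂ x y
    refine CdgaSheaf.eq_of_cover (fun a => inf_le_left) (cover_inf cov hZ) fun a => ?_
    simp only [hG, A.res_mul, map_add, map_smul]
    exact Der.on_mul _ _ hl hi' hj' hl' h₁ h₂ _ _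
  · intro a
    refine Der.ext_on fun Z hZ i j h x => ?_
    refine CdgaSheaf.eq_of_cover (fun b => inf_le_left) (cover_inf cov (hZ.trans (hW a)))
      fun b => ?_
    rw [Der.on_res, Der.on_mk, hG, Der.res_on, hs' a b _ _ inf_le_right]
  · intro t ht
    refine Der.ext_on fun Z hZ i j h x => ?_
    refine CdgaSheaf.eq_of_cover (fun b => inf_le_left) (cover_inf cov hZ) fun b => ?_
    rw [Der.on_mk, hG, Der.res_on, ← ht b]
    rfl

theorem OneForm.uniqueGluing (m : ℤ) :
    UniqueGluing (X := X) id (OneForm A m) fun h => OneForm.res h := by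
  intro V ι W hW cov s hs
  have hs' : ∀ (a b : ι) (Z : Opens X) (ha : Z ≤ W a) (hb : Z ≤ W b) {i j : ℤ} (h : m + i = j),
      OneForm.on (s a) ha h = OneForm.on (s b) hb h := fun a b Z ha hb i j h =>
    congrArg (fun D => OneForm.on D (le_refl Z) h) (hs a b Z ha hb)
  have key : ∀ {Z : Opens X} (hZ : Z ≤ V) {i j : ℤ} (h : m + i = j),
      ∃ G : Der A i Z →ₗ[ℂ] A.sec j Z, ∀ a D, A.res (inf_le_left : Z ⊓ W a ≤ Z) (G D) =
        OneForm.on (s a) inf_le_right h (Der.res inf_le_left D) := by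
    intro Z hZ i j h
    obtain ⟨G, hG⟩ := CdgaSheaf.exists_linear_glue (A := A) (M := Der A i Z) (V := Z)
      (W := fun a => Z ⊓ W a) (fun a => inf_le_left) (cover_inf cov hZ)
      (fun a => OneForm.on (s a) inf_le_right h ∘ₗ Der.res inf_le_left) fun a b Z' ha hb x => by
        simp only [LinearMap.comp_apply, OneForm.res_on, Der.res_res]
        rw [hs' a b Z' _ (hb.trans inf_le_right) h]
    exact ⟨G, fun a x => hG a x⟩
  choose G hG using @key
  refine ⟨OneForm.mk (fun hZ _ _ h => G hZ h) ?_ ?_, ?_, ?_⟩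
  · intro Z Z' hZ h' i j h x
    refine CdgaSheaf.eq_of_cover (fun a => inf_le_left) (cover_inf cov (h'.trans hZ)) fun a => ?_
    have e := congrArg (A.res (inf_le_inf_right (W a) h')) (hG hZ h a x)
    rw [A.res_res, OneForm.res_on, Der.res_res] at e
    rw [hG, A.res_res, Der.res_res]
    exact e
  · intro Z hZ i k l j n hl hj hn hn' f D
    refine CdgaSheaf.eq_of_cover (fun a => inf_le_left) (cover_inf cov hZ) fun a => ?_
    rw [hG, Der.res_fsmul, OneForm.on_fsmul_right _ _ hl hj hn hn', map_smul, A.res_mul, hG]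
  · intro a
    refine OneForm.ext_on fun Z hZ i j h x => ?_
    refine CdgaSheaf.eq_of_cover (fun b => inf_le_left) (cover_inf cov (hZ.trans (hW a)))
      fun b => ?_
    rw [OneForm.on_res, OneForm.on_mk, hG, OneForm.res_on, hs' a b _ _ inf_le_right]
  · intro t ht
    refine OneForm.ext_on fun Z hZ i j h x => ?_
    refine CdgaSheaf.eq_of_cover (fun b => inf_le_left) (cover_inf cov hZ) fun b => ?_
    rw [OneForm.on_mk, hG, OneForm.res_on, ← ht b]
    rfl

variable (A) in
/-- The sections of degree `i` of the standard Courant algebroid, the direct sum of the tangent and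
the cotangent sheaf. -/
abbrev StdSec (i : ℤ) (V : Opens X) : Type u := Der A i V × OneForm A i V

namespace StdSec

variable {V W : Opens X} {i j k l m n p : ℤ}

/-- Restriction to a smaller open set. -/
def res (h : W ≤ V) : StdSec A i V →ₗ[ℂ] StdSec A i W := (Der.res h).prodMap (OneForm.resₗ h)

/-- Multiplication by functions. -/
def smul (h : i + j = k) : A.sec i V →ₗ[ℂ] StdSec A j V →ₗ[ℂ] StdSec A k V :=
  LinearMap.mk₂ ℂ (fun f q => (Der.fsmulₗ A V h f q.1, OneForm.fsmulₗ A V h f q.2))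
    (fun _ _ _ => by simp only [map_add, LinearMap.add_apply]; rfl)
    (fun _ _ _ => by simp only [map_smul, LinearMap.smul_apply]; rfl)
    (fun _ _ _ => by simp only [Prod.fst_add, Prod.snd_add, map_add]; rfl)
    (fun _ _ _ => by simp only [Prod.smul_fst, Prod.smul_snd, map_smul]; rfl)

theorem smul_apply (h : i + j = k) (f : A.sec i V) (q : StdSec A j V) :
    smul h f q = (Der.fsmul h f q.1, OneForm.fsmul h f q.2) := rfl

/-- The pairing `⟨(D, φ), (E, ψ)⟩ = φ(E) + (-1)^{|D||E|} ψ(D)`. -/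
def pair (h : i + j = k) : StdSec A i V →ₗ[ℂ] StdSec A j V →ₗ[ℂ] A.sec k V :=
  LinearMap.mk₂ ℂ (fun a b => OneForm.on a.2 le_rfl h b.1 +
      (-1 : ℂ) ^ (i * j) • OneForm.on b.2 le_rfl (show j + i = k by omega) a.1)
    (fun _ _ _ => by simp only [Prod.fst_add, Prod.snd_add, map_add, OneForm.on_add]; module)
    (fun _ _ _ => by simp only [Prod.smul_fst, Prod.smul_snd, map_smul, OneForm.on_smul]; module)
    (fun _ _ _ => by simp only [Prod.fst_add, Prod.snd_add, map_add, OneForm.on_add]; module)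
    (fun _ _ _ => by simp only [Prod.smul_fst, Prod.smul_snd, map_smul, OneForm.on_smul]; module)

theorem pair_apply (h : i + j = k) (h' : j + i = k) (a : StdSec A i V) (b : StdSec A j V) :
    pair h a b = OneForm.on a.2 le_rfl h b.1 + (-1 : ℂ) ^ (i * j) • OneForm.on b.2 le_rfl h' a.1 :=
  rfl

/-- The derivation `f ↦ (0, df)`. -/
def der : A.sec i V →ₗ[ℂ] StdSec A i V :=
  (0 : A.sec i V →ₗ[ℂ] Der A i V).prod (OneForm.ofFunₗ A V i)

theorem der_apply (f : A.sec i V) : der f = (0, OneForm.ofFun f) := rfl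

/-- The (graded) Dorfman bracket
`[(D, φ), (E, ψ)] = ([D, E], L_D ψ - (-1)^{|D||E|} L_E φ + d(φ(E)))`. -/
def br (h : i + j = k) : StdSec A i V →ₗ[ℂ] StdSec A j V →ₗ[ℂ] StdSec A k V :=
  LinearMap.mk₂ ℂ (fun a b => (Der.bracketₗ A V h a.1 b.1,
      OneForm.lieₗ A V h a.1 b.2 -
        (-1 : ℂ) ^ (i * j) • OneForm.lieₗ A V (show j + i = k by omega) b.1 a.2 +
        OneForm.ofFunₗ A V k (OneForm.on a.2 le_rfl h b.1)))
    (fun _ _ _ => Prod.ext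
      (by simp only [Prod.fst_add, map_add, LinearMap.add_apply])
      (by
        simp only [Prod.fst_add, Prod.snd_add, map_add, LinearMap.add_apply, OneForm.on_add]
        module))
    (fun _ _ _ => Prod.ext
      (by simp only [Prod.smul_fst, map_smul, LinearMap.smul_apply])
      (by
        simp only [Prod.smul_fst, Prod.smul_snd, map_smul, LinearMap.smul_apply, OneForm.on_smul]
        module))
    (fun _ _ _ => Prod.ext
      (by simp only [Prod.fst_add, map_add, LinearMap.add_apply])
      (by
        simp only [Prod.fst_add, Prod.snd_add, map_add, LinearMap.add_apply, OneForm.on_add]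
        module))
    (fun _ _ _ => Prod.ext
      (by simp only [Prod.smul_fst, map_smul, LinearMap.smul_apply])
      (by
        simp only [Prod.smul_fst, Prod.smul_snd, map_smul, LinearMap.smul_apply, OneForm.on_smul]
        module))

theorem br_fst (h : i + j = k) (a : StdSec A i V) (b : StdSec A j V) :
    (br h a b).1 = Der.bracket h a.1 b.1 := rfl

theorem br_snd (h : i + j = k) (h' : j + i = k) (a : StdSec A i V) (b : StdSec A j V) :
    (br h a b).2 = OneForm.lieₗ A V h a.1 b.2 -
        (-1 : ℂ) ^ (i * j) • OneForm.lieₗ A V h' b.1 a.2 +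
        OneForm.ofFunₗ A V k (OneForm.on a.2 le_rfl h b.1) := rfl

/-- The differential of the structure sheaf, as a section of the standard Courant algebroid. -/
def δ (V : Opens X) : StdSec A 1 V := (Der.δ V, 0)

/-- The differential, which is the bracket with `δ`. -/
def d (h : i + 1 = j) : StdSec A i V →ₗ[ℂ] StdSec A j V := br (show 1 + i = j by omega) (δ V)

theorem d_apply (h : i + 1 = j) (h' : 1 + i = j) (q : StdSec A i V) : d h q = br h' (δ V) q := rfl

theorem d_fst (h : i + 1 = j) (q : StdSec A i V) : (d h q).1 = Der.diff h q.1 :=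
  (Der.diff_eq_bracket h (show 1 + i = j by omega) q.1).symm

theorem res_br (h : i + j = k) (a : StdSec A i V) (b : StdSec A j V) (hW : W ≤ V) :
    res hW (br h a b) = br h (res hW a) (res hW b) := by
  refine Prod.ext rfl (OneForm.ext_on fun Z hZ p q hq D => ?_)
  change OneForm.on (OneForm.res hW (br h a b).2) hZ hq D = _
  rw [br_snd h (by omega), br_snd h (by omega)]
  simp only [← OneForm.resₗ_apply, map_add, map_sub, map_smul]
  simp only [OneForm.resₗ_apply, OneForm.lieₗ_apply, OneForm.ofFunₗ_apply, OneForm.res_lie,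
    OneForm.res_ofFun, OneForm.res_on]
  rfl

/-- The Jacobi identity for the Dorfman bracket, from the Cartan calculus of one-forms. -/
theorem br_br (h₁ : j + k = l) (h₂ : i + l = p) (h₃ : i + j = m)
    (h₄ : m + k = p) (h₅ : i + k = n) (h₆ : j + n = p) (a : StdSec A i V) (b : StdSec A j V)
    (c : StdSec A k V) :
    br h₂ a (br h₁ b c) = br h₄ (br h₃ a b) c + (-1 : ℂ) ^ (i * j) • br h₆ b (br h₅ a c) := by
  refine Prod.ext (Der.jacobi h₁ h₂ h₃ h₄ h₅ h₆ _ _ _) ?_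
  obtain ⟨D, φ⟩ := a
  obtain ⟨E, ψ⟩ := b
  obtain ⟨F, χ⟩ := c
  rw [Prod.snd_add, Prod.smul_snd, br_snd h₂ (show l + i = p by omega),
    br_snd h₄ (show k + m = p by omega), br_snd h₆ (show n + j = p by omega),
    br_snd h₁ (show k + j = l by omega), br_snd h₃ (show j + i = m by omega),
    br_snd h₅ (show k + i = n by omega)]
  simp only [br_fst, map_add, map_sub, map_smul, OneForm.on_add, OneForm.on_sub, OneForm.on_smul]
  simp only [OneForm.lieₗ_apply, OneForm.ofFunₗ_apply]
  rw [OneForm.lie_lie h₁ h₂ h₃ h₄ h₅ h₆ D E χ,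
    OneForm.lie_lie (show k + j = l by omega) h₂ h₅ (show n + j = p by omega) h₃
      (show k + m = p by omega) D F ψ]
  have e₁ := OneForm.lie_lie (show k + i = n by omega) h₆ h₁ (show l + i = p by omega)
    (show j + i = m by omega) (show k + m = p by omega) E F φ
  rw [← sub_eq_iff_eq_add] at e₁
  rw [← e₁, OneForm.lie_ofFun h₂ (show l + i = p by omega),
    OneForm.lie_ofFun (show k + m = p by omega) h₄, OneForm.lie_ofFun h₆ (show n + j = p by omega),
    OneForm.on_lie h₃ D ψ le_rfl h₄ h₁ (show l + i = p by omega) h₅ h₆,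
    OneForm.on_lie (show j + i = m by omega) E φ le_rfl h₄ h₅ (show n + j = p by omega) h₁ h₂,
    OneForm.on_ofFun, A.res_self]
  simp only [← OneForm.ofFunₗ_apply, map_add, map_sub, map_smul, Der.act, Der.res_self]
  subst h₁ h₃ h₅
  simp only [smul_add, smul_sub, smul_smul, mul_add, add_mul,
    zpow_add₀ (show (-1 : ℂ) ≠ 0 by norm_num), mul_comm j i, mul_comm k i, mul_comm k j]
  rcases neg_one_zpow_eq_or (i * j) with e₁ | e₁ <;>
    rcases neg_one_zpow_eq_or (i * k) with e₂ | e₂ <;>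
    rcases neg_one_zpow_eq_or (j * k) with e₃ | e₃ <;>
    simp only [e₁, e₂, e₃] <;> module

theorem br_smul (h₁ : j + k = l) (h₂ : i + l = n) (h₃ : i + k = m) (h₄ : j + m = n)
    (h₅ : j + i = p) (h₆ : p + k = n) (a : StdSec A i V) (f : A.sec j V) (b : StdSec A k V) :
    br h₂ a (smul h₁ f b) =
      (-1 : ℂ) ^ (i * j) • smul h₄ f (br h₃ a b) + smul h₆ (Der.act a.1 h₅ f) b := by
  refine Prod.ext (Der.bracket_fsmul h₁ h₂ h₃ h₄ h₅ h₆ _ _ _) ?_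
  obtain ⟨D, φ⟩ := a
  obtain ⟨E, ψ⟩ := b
  rw [Prod.snd_add, Prod.smul_snd, br_snd h₂ (show l + i = n by omega)]
  simp only [smul_apply]
  rw [br_snd h₃ (show k + i = m by omega)]
  simp only [← OneForm.fsmulₗ_apply, map_add, map_sub, map_smul]
  simp only [OneForm.lieₗ_apply, OneForm.ofFunₗ_apply, OneForm.fsmulₗ_apply]
  obtain ⟨s, hs⟩ : ∃ s, m + j = s := ⟨_, rfl⟩
  rw [OneForm.lie_fsmul h₁ h₂ h₃ h₄ h₅ h₆,
    OneForm.fsmul_lie h₁ (show l + i = n by omega) (show k + i = m by omega) h₄ h₃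
      (show m + j = n by omega),
    OneForm.on_fsmul_right φ le_rfl h₁ h₃ h₂ h₄, OneForm.ofFun_smul,
    OneForm.ofFun_mul h₄ (show m + j = n by omega)]
  subst h₁ h₃
  simp only [smul_add, smul_sub, smul_smul, mul_add, add_mul,
    zpow_add₀ (show (-1 : ℂ) ≠ 0 by norm_num), mul_comm j i, mul_comm k i, mul_comm k j]
  rcases neg_one_zpow_eq_or (i * j) with e₁ | e₁ <;>
    rcases neg_one_zpow_eq_or (i * k) with e₂ | e₂ <;>
    rcases neg_one_zpow_eq_or (j * k) with e₃ | e₃ <;>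
    simp only [e₁, e₂, e₃] <;> module

theorem pair_smul (h₁ : i + j = l) (h₂ : l + k = n) (h₃ : j + k = m) (h₄ : i + m = n)
    (f : A.sec i V) (a : StdSec A j V) (b : StdSec A k V) :
    pair h₂ (smul h₁ f a) b = A.mul h₄ f (pair h₃ a b) := by
  rw [pair_apply h₂ (show k + l = n by omega), pair_apply h₃ (show k + j = m by omega),
    smul_apply, OneForm.on_fsmul h₁ f _ _ h₂ h₃ h₄,
    OneForm.on_fsmul_right _ _ h₁ (show k + j = m by omega) _ h₄, map_add, map_smul, A.res_self]
  subst h₁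
  simp only [smul_add, smul_sub, smul_smul, mul_add, add_mul,
    zpow_add₀ (show (-1 : ℂ) ≠ 0 by norm_num), mul_comm k i]
  rcases neg_one_zpow_eq_or (i * k) with e₁ | e₁ <;> simp only [e₁] <;> module

theorem pair_comm (h : i + j = k) (h' : j + i = k) (a : StdSec A i V) (b : StdSec A j V) :
    pair h a b = (-1 : ℂ) ^ (i * j) • pair h' b a := by
  rw [pair_apply h h', pair_apply h' h, mul_comm j i]
  rcases neg_one_zpow_eq_or (i * j) with e₁ | e₁ <;> simp only [e₁] <;> module

theorem pair_invariant (h₁ : i + j = l) (h₂ : l + k = p) (h₃ : i + k = m) (h₄ : j + m = p)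
    (h₅ : j + k = n) (h₆ : n + i = p) (a : StdSec A i V) (b : StdSec A j V) (c : StdSec A k V) :
    pair h₂ (br h₁ a b) c + (-1 : ℂ) ^ (i * j) • pair h₄ b (br h₃ a c) =
      Der.act a.1 h₆ (pair h₅ b c) := by
  obtain ⟨D, φ⟩ := a
  obtain ⟨E, ψ⟩ := b
  obtain ⟨F, χ⟩ := c
  rw [pair_apply h₂ (show k + l = p by omega), pair_apply h₄ (show m + j = p by omega),
    pair_apply h₅ (show k + j = n by omega), br_snd h₁ (show j + i = l by omega),
    br_snd h₃ (show k + i = m by omega)]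
  simp only [br_fst, OneForm.on_add, OneForm.on_sub, OneForm.on_smul]
  simp only [OneForm.lieₗ_apply, OneForm.ofFunₗ_apply, map_add, map_smul]
  rw [OneForm.on_lie h₁ D ψ le_rfl h₂ h₅ h₆ h₃ h₄,
    OneForm.on_lie (show j + i = l by omega) E φ le_rfl h₂ h₃ (show m + j = p by omega) h₅
      (show i + n = p by omega),
    OneForm.on_lie h₃ D χ le_rfl (show m + j = p by omega) (show k + j = n by omega) h₆ h₁
      (show k + l = p by omega),
    OneForm.on_lie (show k + i = m by omega) F φ le_rfl (show m + j = p by omega) h₁ h₂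
      (show k + j = n by omega) (show i + n = p by omega), OneForm.on_ofFun, OneForm.on_ofFun,
    A.res_self, A.res_self, eq_neg_of_add_eq_zero_left (Der.bracket_symm h₅
      (show k + j = n by omega) (Der.res le_rfl E) F)]
  simp only [Der.act, Der.res_self, map_neg, map_smul]
  subst h₁ h₃
  simp only [smul_add, smul_sub, smul_smul, mul_add, add_mul,
    zpow_add₀ (show (-1 : ℂ) ≠ 0 by norm_num), mul_comm j i, mul_comm k i, mul_comm k j]
  rcases neg_one_zpow_eq_or (i * j) with e₁ | e₁ <;>
    rcases neg_one_zpow_eq_or (i * k) with e₂ | e₂ <;>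
    rcases neg_one_zpow_eq_or (j * k) with e₃ | e₃ <;>
    simp only [e₁, e₂, e₃] <;> module

theorem br_der (h : i + j = k) (h' : j + i = k) (a : StdSec A i V) (f : A.sec j V) :
    br h a (der f) = der (Der.act a.1 h' f) := by
  refine Prod.ext ?_ ?_
  · exact (Der.bracketₗ A V h a.1).map_zero
  · rw [br_snd h h', der_apply, der_apply]
    simp only [map_zero, LinearMap.zero_apply, smul_zero, sub_zero, add_zero]
    exact OneForm.lie_ofFun h h' _ _

theorem pair_der (h : i + j = k) (h' : j + i = k) (a : StdSec A i V) (f : A.sec j V) :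
    pair h a (der f) = Der.act a.1 h' f := by
  rw [pair_apply h h', der_apply, map_zero, zero_add, OneForm.on_ofFun, A.res_self, smul_smul,
    ← mul_zpow]
  simp

theorem br_symm (h : i + j = k) (h' : j + i = k) (a : StdSec A i V) (b : StdSec A j V) :
    br h a b + (-1 : ℂ) ^ (i * j) • br h' b a = der (pair h a b) := by
  refine Prod.ext (Der.bracket_symm h h' _ _) ?_
  rw [Prod.snd_add, Prod.smul_snd, br_snd h h', br_snd h' h, der_apply, pair_apply h h',
    ← OneForm.ofFunₗ_apply, map_add, map_smul, mul_comm j i]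
  rcases neg_one_zpow_eq_or (i * j) with e₁ | e₁ <;> simp only [e₁] <;> module

theorem act_δ (h : i + 1 = j) (f : A.sec i V) : Der.act (δ V : StdSec A 1 V).1 h f = A.d h f := rfl

/-- The differential is the bracket with `δ`, and `[δ, δ] = 0`, so it squares to zero by the Jacobi
identity. -/
theorem d_d (h : i + 1 = j) (h' : j + 1 = k) (q : StdSec A i V) : d h' (d h q) = 0 := by
  have e := br_br (show 1 + i = j by omega) (show 1 + j = k by omega) (one_add_one_eq_two)
    (show 2 + i = k by omega) (show 1 + i = j by omega) (show 1 + j = k by omega)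
    (δ V : StdSec A 1 V) (δ V) q
  have e' : br (one_add_one_eq_two) (δ V) (δ V : StdSec A 1 V) = 0 := by
    refine Prod.ext (Der.ext_on fun W hW p q hq a => ?_) ?_
    · rw [br_fst, Der.on_bracket _ _ _ hW hq rfl rfl (by omega) (by omega)]
      simp only [δ, Der.on_δ, A.d_d]
      simp
    · rw [br_snd _ one_add_one_eq_two, show (δ V : StdSec A 1 V).2 = 0 from rfl]
      simp only [map_zero, OneForm.on_zero, smul_zero, sub_zero, add_zero]
      rfl
  rw [e', map_zero, LinearMap.zero_apply, zero_add, mul_one, zpow_one, neg_one_smul] at e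
  rw [d_apply h' (show 1 + j = k by omega), d_apply h (show 1 + i = j by omega)]
  have e₂ : (2 : ℂ) • br (show 1 + j = k by omega) (δ V)
      (br (show 1 + i = j by omega) (δ V) q) = 0 := by
    rw [two_smul]
    exact add_eq_zero_iff_eq_neg.mpr e
  exact (smul_eq_zero_iff_right two_ne_zero).mp e₂

end StdSec

section StdCourant

variable (A) (U : Opens X)

/-- The standard differential graded module `T ⊕ Ω¹`. -/
def stdModule : DGMod A U where
  sec i V := StdSec A i V.1
  res h := StdSec.res h
  smul h := StdSec.smul h
  d h := StdSec.d h
  res_self _ := rfl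
  res_res _ _ _ := rfl
  glue i V ι W hW cov s hs := by
    have hs' : ∀ (a b : ι) (Z : Opens X) (ha : Z ≤ (W a).1) (hb : Z ≤ (W b).1),
        StdSec.res ha (s a) = StdSec.res hb (s b) := fun a b Z ha hb =>
      hs a b ⟨Z, Set.mem_Iic.2 (ha.trans (W a).2)⟩ ha hb
    obtain ⟨D, hD, hD'⟩ := Der.uniqueGluing (A := A) i V.1 ι (fun a => (W a).1) hW cov
      (fun a => (s a).1) fun a b Z ha hb => congrArg Prod.fst (hs' a b Z ha hb)
    obtain ⟨φ, hφ, hφ'⟩ := OneForm.uniqueGluing (A := A) i V.1 ι (fun a => (W a).1) hW cov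
      (fun a => (s a).2) fun a b Z ha hb => congrArg Prod.snd (hs' a b Z ha hb)
    exact ⟨(D, φ), fun a => Prod.ext (hD a) (hφ a), fun t ht => Prod.ext
      (hD' t.1 fun a => congrArg Prod.fst (ht a)) (hφ' t.2 fun a => congrArg Prod.snd (ht a))⟩
  res_smul {_ _} hW {i j k} h f q :=
    Prod.ext (Der.res_fsmul h f q.1 hW) (OneForm.res_fsmul h f q.2 hW)
  res_d {_ _} hW {i j} h q := StdSec.res_br _ _ q hW
  one_smul q := Prod.ext (Der.one_fsmul q.1) (OneForm.one_fsmul q.2)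
  mul_smul h₁ h₂ h₃ h₄ f g q :=
    Prod.ext (Der.mul_fsmul h₁ h₂ h₃ h₄ f g q.1) (OneForm.mul_fsmul h₁ h₂ h₃ h₄ f g q.2)
  d_smul {V i j k i' j' k'} h hi hj hk h₁ h₂ f q := by
    rw [StdSec.d_apply hk (show 1 + k = k' by omega), StdSec.d_apply hj (show 1 + j = j' by omega),
      StdSec.br_smul h (show 1 + k = k' by omega) (show 1 + j = j' by omega) h₂ hi h₁,
      StdSec.act_δ, one_mul, add_comm]
  d_d h h' q := StdSec.d_d h h' q

/-- The structure maps of the standard Courant algebroid. -/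
def stdData : CourantData A U where
  toDGMod := stdModule A U
  br h := StdSec.br h
  anchor {V i} := LinearMap.fst ℂ (Der A i V.1) (OneForm A i V.1)
  pair h := StdSec.pair h
  der := StdSec.der

/-- The standard Courant algebroid `T ⊕ Ω¹`. -/
def stdCourant : CourantAlgebroid A U where
  toCourantData := stdData A U
  isLocal :=
    { res_br := fun hW _ _ _ h a b => StdSec.res_br h a b hW
      res_anchor := fun _ _ _ => rfl
      res_pair := fun {V W} hW i j k h a b => by
        have h' : j + i = k := by omega
        refine (congrArg (A.res hW) (StdSec.pair_apply h h' a b)).trans ?_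
        rw [map_add, map_smul, OneForm.res_on, OneForm.res_on]
        rfl
      res_der := fun hW _ f => Prod.ext rfl (OneForm.res_ofFun f hW) }
  commDiff :=
    { d_br := fun {V i j k i' j' k'} h hi hj hk h₁ h₂ a b => by
        refine (StdSec.br_br h (show 1 + k = k' by omega) (show 1 + i = i' by omega) h₁
          (show 1 + j = j' by omega) h₂ (StdSec.δ V.1) a b).trans ?_
        rw [one_mul]
        rfl
      anchor_d := fun h q => StdSec.d_fst h q
      d_pair := fun {V i j k i' j' k'} h hi hj hk h₁ h₂ a b => by
        refine (StdSec.pair_invariant (show 1 + i = i' by omega) h₁ (show 1 + j = j' by omega) h₂ h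
          hk (StdSec.δ V.1) a b).symm.trans ?_
        rw [one_mul]
        rfl
      d_der := fun {V i j} h f => StdSec.br_der (show 1 + i = j by omega) h _ f }
  anchored :=
    { br_br := StdSec.br_br
      anchor_smul := fun _ _ _ => rfl
      anchor_br := fun _ _ _ => rfl }
  paired :=
    { pair_smul := StdSec.pair_smul
      pair_comm := StdSec.pair_comm }
  derived :=
    { der_mul := fun {V i j k} h h' f g => by
        refine Prod.ext (α := Der A k V.1) ?_ (OneForm.ofFun_mul h h' f g)
        refine Eq.symm ((congrArg₂ (· + ·) ((Der.fsmulₗ A V.1 h f).map_zero)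
          (congrArg ((-1 : ℂ) ^ (i * j) • ·) ((Der.fsmulₗ A V.1 h' g).map_zero))).trans ?_)
        simp only [smul_zero, add_zero]
        rfl
      der_factors := ⟨fun V i => LinearMap.inr ℂ (Der A i V.1) (OneForm A i V.1),
        fun _ _ _ _ _ => rfl,
        fun V i j k h f φ => Prod.ext ((Der.fsmulₗ A V.1 h f).map_zero).symm rfl,
        fun _ _ _ => rfl⟩ }
  relations :=
    { anchor_der := fun _ => rfl
      br_smul := StdSec.br_smul
      pair_invariant := StdSec.pair_invariant
      br_der := StdSec.br_der
      pair_der := StdSec.pair_der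
      br_symm := StdSec.br_symm }

end StdCourant
end DRCourant
end

/-! ### Local properties of sections -/

noncomputable section
namespace DRCourant

variable {X : Type u} [TopologicalSpace X]

namespace UniqueGluing

variable {P : Type u} [Preorder P] {o : P → Opens X} {sec : P → Type u}
  {res : ∀ {V W : P}, W ≤ V → sec V → sec W}

/-- Sections of a sheaf are equal if they are equal locally. -/
theorem eq_of_local (hg : UniqueGluing o sec fun h => res h)
    (hres : ∀ {V W Z : P} (h : W ≤ V) (h' : Z ≤ W) (s : sec V),
      res h' (res h s) = res (h'.trans h) s)
    {V : P} {s t : sec V}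
    (h : ∀ x ∈ o V, ∃ (W : P) (hW : W ≤ V), x ∈ o W ∧ res hW s = res hW t) : s = t := by
  choose W hW hx hst using fun x : o V => h x.1 x.2
  obtain ⟨r, _, hr⟩ := hg V (o V) W hW (fun x hx' => ⟨⟨x, hx'⟩, hx _⟩) (fun a => res (hW a) s)
    fun a b Z ha hb => (hres _ _ _).trans (hres _ _ _).symm
  exact (hr s fun a => rfl).trans (hr t fun a => (hst a).symm).symm

/-- A section with a property that determines it uniquely exists if it exists locally. -/
theorem exists_of_local (hg : UniqueGluing o sec fun h => res h)
    {V : P} {Φ : ∀ W : P, W ≤ V → sec W → Prop}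
    (huniq : ∀ {W : P} (hW : W ≤ V) {s t : sec W}, Φ W hW s → Φ W hW t → s = t)
    (hΦ : ∀ {W Z : P} (hW : W ≤ V) (hZ : Z ≤ W) {s : sec W}, Φ W hW s →
      Φ Z (hZ.trans hW) (res hZ s))
    (h : ∀ x ∈ o V, ∃ (W : P) (hW : W ≤ V), x ∈ o W ∧ ∃ s, Φ W hW s) :
    ∃ t : sec V, ∀ x ∈ o V, ∃ (W : P) (hW : W ≤ V), x ∈ o W ∧ Φ W hW (res hW t) := by
  choose W hW hx s hs using fun x : o V => h x.1 x.2
  obtain ⟨t, ht, _⟩ := hg V (o V) W hW (fun x hx' => ⟨⟨x, hx'⟩, hx _⟩) s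
    fun a b Z ha hb => huniq _ (hΦ (hW a) ha (hs a)) (hΦ (hW b) hb (hs b))
  exact ⟨t, fun x hx' => ⟨W ⟨x, hx'⟩, hW _, hx _,
    (show res _ t = s ⟨x, hx'⟩ from ht _) ▸ hs ⟨x, hx'⟩⟩⟩

end UniqueGluing

variable {A : CdgaSheaf X} {U : Opens X}

theorem CdgaSheaf.eq_of_local {i : ℤ} {V : Opens X} {s t : A.sec i V}
    (h : ∀ x ∈ V, ∃ (W : Opens X) (hW : W ≤ V), x ∈ W ∧ A.res hW s = A.res hW t) : s = t :=
  UniqueGluing.eq_of_local (A.glue i) A.res_res h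

theorem DGMod.eq_of_local (Q : DGMod A U) {i : ℤ} {V : Set.Iic U} {s t : Q.sec i V}
    (h : ∀ x ∈ V.1, ∃ (W : Set.Iic U) (hW : W ≤ V), x ∈ W.1 ∧ Q.res hW s = Q.res hW t) : s = t :=
  UniqueGluing.eq_of_local (Q.glue i) Q.res_res h

theorem Der.eq_of_local {i : ℤ} {V : Opens X} {s t : Der A i V}
    (h : ∀ x ∈ V, ∃ (W : Opens X) (hW : W ≤ V), x ∈ W ∧ Der.res hW s = Der.res hW t) : s = t :=
  UniqueGluing.eq_of_local (Der.uniqueGluing i) Der.res_res h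

/-- An open subset of `U`, as an open subset of an open subset `V` of `U`. -/
def sub {V : Set.Iic U} {W : Opens X} (h : W ≤ V.1) : Set.Iic U :=
  ⟨W, Set.mem_Iic.2 (h.trans V.2)⟩

/-! ### Frames -/

variable (A) in
/-- A frame of the tangent sheaf on the open set `W`: functions `y a` of degree `0` and vector fields
`I a` of degree `-1` such that every vector field `D` on a smaller open set is
`∑ D(y a) [d, I a] + ∑ D(d (y a)) I a`. -/
structure Frame (W : Opens X) where
  n : ℕ
  I : Fin n → Der A (-1) W
  y : Fin n → A.sec 0 W
  expand : ∀ {Z : Opens X} (hZ : Z ≤ W) {k l : ℤ} (h : 0 + k = k) (h' : 1 + k = l)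
    (h₁ : k + 0 = k) (h₂ : l + -1 = k) (D : Der A k Z),
    D = ∑ a, (Der.fsmul h₁ (Der.act D h (A.res hZ (y a)))
        (Der.diff (neg_add_cancel 1) (Der.res hZ (I a))) +
      Der.fsmul h₂ (Der.act D h' (A.d (zero_add 1) (A.res hZ (y a)))) (Der.res hZ (I a)))

variable (A) in
/-- The differential graded algebra `A` is concentrated in non-negative degrees, and frames of the
tangent sheaf exist locally. -/
structure HasFrames : Prop where
  eq_zero_of_neg : ∀ {i : ℤ} {V : Opens X} (f : A.sec i V), i < 0 → f = 0
  exists_frame : ∀ {V : Opens X} (x), x ∈ V → ∃ W ≤ V, x ∈ W ∧ Nonempty (Frame A W)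

namespace Frame

/-- On the domain of a frame, the one-forms are spanned by the `f dg`. -/
theorem oneForm_eq {W : Opens X} (F : Frame A W) {m m' : ℤ} (h₀ : m + 0 = m) (h : m + -1 = m')
    (h' : m' + 1 = m) (φ : OneForm A m W) :
    φ = ∑ a, (OneForm.fsmul h₀ (OneForm.on φ le_rfl h₀ (Der.diff (neg_add_cancel 1) (F.I a)))
        (OneForm.ofFun (F.y a)) -
      OneForm.fsmul h' (OneForm.on φ le_rfl h (F.I a))
        (OneForm.ofFun (A.d (zero_add 1) (F.y a)))) := by
  refine OneForm.ext_on fun Z hZ k j hj D => ?_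
  have e : ∀ (ψ : Fin F.n → OneForm A m W), OneForm.on (∑ a, ψ a) hZ hj D =
      ∑ a, OneForm.on (ψ a) hZ hj D := fun ψ =>
    map_sum (⟨⟨fun χ : OneForm A m W => OneForm.on χ hZ hj D, rfl⟩, fun _ _ => rfl⟩ :
      OneForm A m W →+ A.sec j Z) ψ Finset.univ
  obtain ⟨l, hl⟩ : ∃ l, 1 + k = l := ⟨_, rfl⟩
  conv_lhs => rw [F.expand hZ (zero_add k) hl (add_zero k) (by omega) D]
  rw [e, map_sum]
  refine Finset.sum_congr rfl fun a _ => ?_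
  rw [map_add, OneForm.on_fsmul_right φ hZ (add_zero k) h₀ hj (show k + m = j by omega),
    OneForm.on_fsmul_right φ hZ _ h hj (show l + m' = j by omega), OneForm.on_sub,
    OneForm.on_fsmul _ _ _ hZ hj (zero_add k) (show m + k = j by omega),
    OneForm.on_fsmul _ _ _ hZ hj hl (show m' + l = j by omega),
    OneForm.on_ofFun, OneForm.on_ofFun, OneForm.res_on, OneForm.res_on, A.res_d, mul_zero, zpow_zero,
    one_smul, A.mul_comm (show k + m = j by omega) (show m + k = j by omega),
    A.mul_comm (show l + m' = j by omega) (show m' + l = j by omega), Der.res_diff]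
  subst hl h
  simp only [map_smul, smul_smul, mul_add, add_mul, mul_one, one_mul, mul_neg, neg_mul,
    zpow_add₀ (show (-1 : ℂ) ≠ 0 by norm_num), zpow_neg, zpow_one, mul_comm k m]
  rcases neg_one_zpow_eq_or (m * k) with e₁ | e₁ <;>
    rcases neg_one_zpow_eq_or m with e₂ | e₂ <;>
    rcases neg_one_zpow_eq_or k with e₃ | e₃ <;>
    simp only [e₁, e₂, e₃] <;> norm_num <;> module

end Frame

/-- To prove a local and additive property of one-forms, it suffices to consider the forms `f dg`. -/
theorem OneForm.local_induction (hA : HasFrames A) {i : ℤ} {V₀ : Opens X}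
    {P : ∀ V : Opens X, V ≤ V₀ → OneForm A i V → Prop}
    (loc : ∀ {V : Opens X} (hV : V ≤ V₀) (φ : OneForm A i V),
      (∀ x ∈ V, ∃ (W : Opens X) (hW : W ≤ V), x ∈ W ∧ P W (hW.trans hV) (OneForm.res hW φ)) →
        P V hV φ)
    (zero : ∀ {V : Opens X} (hV : V ≤ V₀), P V hV 0)
    (add : ∀ {V : Opens X} (hV : V ≤ V₀) (φ ψ : OneForm A i V), P V hV φ → P V hV ψ →
      P V hV (φ + ψ))
    (gen : ∀ {V : Opens X} (hV : V ≤ V₀) {j k : ℤ} (h : j + k = i) (f : A.sec j V) (g : A.sec k V),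
      P V hV (OneForm.fsmul h f (OneForm.ofFun g)))
    {V : Opens X} (hV : V ≤ V₀) (φ : OneForm A i V) : P V hV φ := by
  refine loc hV φ fun x hx => ?_
  obtain ⟨W, hW, hxW, ⟨F⟩⟩ := hA.exists_frame x hx
  refine ⟨W, hW, hxW, ?_⟩
  rw [F.oneForm_eq (add_zero i) rfl (neg_add_cancel_right i 1) (OneForm.res hW φ)]
  refine Finset.sum_induction _ (P W _) (fun φ ψ => add _ φ ψ) (zero _) fun a _ => ?_
  rw [sub_eq_add_neg]
  refine add _ _ _ (gen _ _ _ _) ?_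
  have e := LinearMap.map_neg₂ (OneForm.fsmulₗ A W (neg_add_cancel_right i 1))
    (OneForm.on (OneForm.res hW φ) le_rfl rfl (F.I a)) (OneForm.ofFun (A.d (zero_add 1) (F.y a)))
  rw [OneForm.fsmulₗ_apply, OneForm.fsmulₗ_apply] at e
  rw [← e]
  exact gen _ _ _ _

/-! ### The lift of the tangent sheaf -/

namespace CourantAlgebroid

variable (Q : CourantAlgebroid A U)

/-- The generators of the lift of the tangent sheaf: the products `f r` and `f d(r)` for sections `r`
of degree `-1`. -/
inductive LagGen {i : ℤ} {V : Set.Iic U} : Q.sec i V → Prop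
  | base {j : ℤ} (h : j + -1 = i) (f : A.sec j V.1) (r : Q.sec (-1) V) : LagGen (Q.smul h f r)
  | diff (h : i + 0 = i) (f : A.sec i V.1) (r : Q.sec (-1) V) :
      LagGen (Q.smul h f (Q.d (neg_add_cancel 1) r))

/-- The lift of the tangent sheaf to `Q`: the sections that are locally sums of products `f r` and
`f d(r)` for sections `r` of degree `-1`. It is a Lagrangian subsheaf, on which the
anchor is an isomorphism. -/
def IsLag {i : ℤ} {V : Set.Iic U} (q : Q.sec i V) : Prop :=
  ∀ x ∈ V.1, ∃ (W : Set.Iic U) (h : W ≤ V), x ∈ W.1 ∧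
    Q.res h q ∈ Submodule.span ℂ {q' : Q.sec i W | Q.LagGen q'}

variable {Q}

theorem LagGen.res {i : ℤ} {V W : Set.Iic U} (h : W ≤ V) {q : Q.sec i V} (hq : Q.LagGen q) :
    Q.LagGen (Q.res h q) := by
  cases hq with
  | base hj f r => rw [Q.res_smul]; exact .base hj _ _
  | diff hj f r => rw [Q.res_smul, Q.res_d]; exact .diff hj _ _

theorem span_lagGen_res {i : ℤ} {V W : Set.Iic U} (h : W ≤ V) {q : Q.sec i V}
    (hq : q ∈ Submodule.span ℂ {q' : Q.sec i V | Q.LagGen q'}) :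
    Q.res h q ∈ Submodule.span ℂ {q' : Q.sec i W | Q.LagGen q'} := by
  have := Submodule.mem_map_of_mem (f := Q.res h) hq
  rw [Submodule.map_span] at this
  refine Submodule.span_mono ?_ this
  rintro _ ⟨q', hq', rfl⟩
  exact LagGen.res h hq'

namespace IsLag

variable {i j k : ℤ} {V W : Set.Iic U}

theorem of_gen {q : Q.sec i V} (hq : Q.LagGen q) : Q.IsLag q := fun x hx =>
  ⟨V, le_rfl, hx, by rw [Q.res_self]; exact Submodule.subset_span hq⟩

theorem of_local {q : Q.sec i V} (h : ∀ x ∈ V.1, ∃ (W : Set.Iic U) (hW : W ≤ V), x ∈ W.1 ∧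
    Q.IsLag (Q.res hW q)) : Q.IsLag q := fun x hx => by
  obtain ⟨W, hW, hxW, hq⟩ := h x hx
  obtain ⟨Z, hZ, hxZ, hq⟩ := hq x hxW
  exact ⟨Z, hZ.trans hW, hxZ, by rwa [Q.res_res] at hq⟩

theorem res (h : W ≤ V) {q : Q.sec i V} (hq : Q.IsLag q) : Q.IsLag (Q.res h q) := fun x hx => by
  obtain ⟨Z, hZ, hxZ, hq⟩ := hq x (h hx)
  refine ⟨⟨W.1 ⊓ Z.1, Set.mem_Iic.2 (inf_le_left.trans W.2)⟩, inf_le_left (a := W.1), ⟨hx, hxZ⟩, ?_⟩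
  rw [Q.res_res]
  have := span_lagGen_res (W := ⟨W.1 ⊓ Z.1, Set.mem_Iic.2 (inf_le_left.trans W.2)⟩)
    (show _ ≤ Z.1 from inf_le_right) hq
  rwa [Q.res_res] at this

theorem zero : Q.IsLag (0 : Q.sec i V) := fun x hx =>
  ⟨V, le_rfl, hx, by rw [map_zero]; exact Submodule.zero_mem _⟩

theorem add {q q' : Q.sec i V} (hq : Q.IsLag q) (hq' : Q.IsLag q') :
    Q.IsLag (q + q') := fun x hx => by
  obtain ⟨Z, hZ, hxZ, h⟩ := hq x hx
  obtain ⟨Z', hZ', hxZ', h'⟩ := hq'.res hZ x hxZ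
  refine ⟨Z', hZ'.trans hZ, hxZ', ?_⟩
  rw [map_add, ← Q.res_res hZ hZ', ← Q.res_res hZ hZ']
  exact Submodule.add_mem _ (span_lagGen_res hZ' h) h'

theorem const_smul (c : ℂ) {q : Q.sec i V} (hq : Q.IsLag q) : Q.IsLag (c • q) := fun x hx => by
  obtain ⟨Z, hZ, hxZ, h⟩ := hq x hx
  exact ⟨Z, hZ, hxZ, by rw [map_smul]; exact Submodule.smul_mem _ c h⟩

theorem sub {q q' : Q.sec i V} (hq : Q.IsLag q) (hq' : Q.IsLag q') : Q.IsLag (q - q') := by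
  rw [sub_eq_add_neg, ← neg_one_smul ℂ q']
  exact hq.add (hq'.const_smul _)

/-- Sections of degree `-1` belong to the lift of the tangent sheaf. -/
theorem of_neg_one (r : Q.sec (-1) V) : Q.IsLag r := by
  have := of_gen (LagGen.base (zero_add (-1)) (A.one V.1) r)
  rwa [Q.one_smul] at this

theorem of_d (r : Q.sec (-1) V) : Q.IsLag (Q.d (neg_add_cancel 1) r) := by
  have := of_gen (LagGen.diff (add_zero 0) (A.one V.1) r)
  rwa [Q.one_smul (Q.d (neg_add_cancel 1) r)] at this

/-- To prove a local and linear property of the sections of the lift of the tangent sheaf, it suffices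
to consider the generators. -/
theorem induction {V₀ : Set.Iic U} {P : ∀ V : Set.Iic U, V ≤ V₀ → Q.sec i V → Prop}
    (loc : ∀ {V : Set.Iic U} (hV : V ≤ V₀) (q : Q.sec i V),
      (∀ x ∈ V.1, ∃ (W : Set.Iic U) (hW : W ≤ V), x ∈ W.1 ∧ P W (hW.trans hV) (Q.res hW q)) →
        P V hV q)
    (zero : ∀ {V : Set.Iic U} (hV : V ≤ V₀), P V hV 0)
    (add : ∀ {V : Set.Iic U} (hV : V ≤ V₀) (q q' : Q.sec i V), P V hV q → P V hV q' →
      P V hV (q + q'))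
    (const_smul : ∀ {V : Set.Iic U} (hV : V ≤ V₀) (c : ℂ) (q : Q.sec i V), P V hV q →
      P V hV (c • q))
    (gen : ∀ {V : Set.Iic U} (hV : V ≤ V₀) (q : Q.sec i V), Q.LagGen q → P V hV q)
    {V : Set.Iic U} (hV : V ≤ V₀) {q : Q.sec i V} (hq : Q.IsLag q) : P V hV q := by
  refine loc hV q fun x hx => ?_
  obtain ⟨W, hW, hxW, h⟩ := hq x hx
  refine ⟨W, hW, hxW, ?_⟩
  exact Submodule.span_induction (p := fun q _ => P W (hW.trans hV) q) (fun q hq => gen _ q hq)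
    (zero _) (fun _ _ _ _ => add _ _ _) (fun c _ _ => const_smul _ c _) h

theorem smul (h : i + j = k) (f : A.sec i V.1) {q : Q.sec j V} (hq : Q.IsLag q) :
    Q.IsLag (Q.smul h f q) := by
  refine induction (V₀ := V) (P := fun W hW q => ∀ f : A.sec i W.1, Q.IsLag (Q.smul h f q))
    (fun hV q H f => of_local fun x hx => ?_) (fun _ f => ?_) (fun _ q q' H H' f => ?_)
    (fun _ c q H f => ?_) (fun _ q H f => ?_) le_rfl hq f
  · obtain ⟨W, hW, hxW, H⟩ := H x hx
    exact ⟨W, hW, hxW, by rw [Q.res_smul]; exact H _⟩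
  · rw [map_zero]; exact zero
  · rw [map_add]; exact (H f).add (H' f)
  · rw [map_smul]; exact (H f).const_smul c
  · cases H with
    | base hj g r =>
      rw [← Q.mul_smul (m := k + 1) (by omega) (by omega)]
      exact of_gen (.base _ _ _)
    | diff hj g r =>
      rw [← Q.mul_smul (m := k) (by omega) (by omega)]
      exact of_gen (.diff _ _ _)

theorem d (h : i + 1 = j) {q : Q.sec i V} (hq : Q.IsLag q) : Q.IsLag (Q.d h q) := by
  refine induction (V₀ := V) (P := fun W hW q => Q.IsLag (Q.d h q))
    (fun hV q H => of_local fun x hx => ?_) (fun _ => ?_) (fun _ q q' H H' => ?_)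
    (fun _ c q H => ?_) (fun _ q H => ?_) le_rfl hq
  · obtain ⟨W, hW, hxW, H⟩ := H x hx
    exact ⟨W, hW, hxW, by rw [Q.res_d]; exact H⟩
  · rw [map_zero]; exact zero
  · rw [map_add]; exact H.add H'
  · rw [map_smul]; exact H.const_smul c
  · cases H with
    | @base l hj g r =>
      rw [Q.d_smul hj rfl (neg_add_cancel 1) h (show l + 1 + -1 = j by omega)
        (show l + 0 = j by omega)]
      exact (smul _ _ (of_neg_one r)).add ((smul _ _ (of_d r)).const_smul _)
    | diff hj g r =>
      rw [Q.d_smul hj h (zero_add 1) h (show j + 0 = j by omega) (show i + 1 = j by omega), Q.d_d,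
        map_zero, smul_zero, add_zero]
      exact smul _ _ (of_d r)

end IsLag

end CourantAlgebroid

end DRCourant
end

/-! ### The lift of the tangent sheaf is isotropic and involutive -/

noncomputable section
namespace DRCourant

variable {X : Type u} [TopologicalSpace X] {A : CdgaSheaf X} {U : Opens X}

/-- There are no vector fields of degree less than `-1`, as the frames are concentrated in the degrees
`-1` and `0`. -/
theorem Der.eq_zero_of_lt (hA : HasFrames A) {i : ℤ} (hi : i < -1) {V : Opens X} (D : Der A i V) :
    D = 0 := by
  refine Der.eq_of_local fun x hx => ?_
  obtain ⟨W, hW, hxW, ⟨F⟩⟩ := hA.exists_frame x hx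
  refine ⟨W, hW, hxW, ?_⟩
  rw [F.expand le_rfl (zero_add i) rfl (add_zero i) (by omega) (Der.res hW D), map_zero]
  refine Finset.sum_eq_zero fun a _ => ?_
  rw [hA.eq_zero_of_neg (Der.act _ (zero_add i) _) (by omega),
    hA.eq_zero_of_neg (Der.act _ (rfl : 1 + i = 1 + i) _) (by omega), ← Der.fsmulₗ_apply,
    ← Der.fsmulₗ_apply, map_zero, map_zero]
  simp

namespace CourantAlgebroid

variable {Q : CourantAlgebroid A U} {V : Set.Iic U} {i j k : ℤ}

/-- To prove a local and additive property of the sections of `Ω_Q`, it suffices to consider the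
generators `f ∂(g)`. -/
theorem InOmega.induction {V₀ : Set.Iic U} {P : ∀ V : Set.Iic U, V ≤ V₀ → Q.sec i V → Prop}
    (loc : ∀ {V : Set.Iic U} (hV : V ≤ V₀) (q : Q.sec i V),
      (∀ x ∈ V.1, ∃ (W : Set.Iic U) (hW : W ≤ V), x ∈ W.1 ∧ P W (hW.trans hV) (Q.res hW q)) →
        P V hV q)
    (zero : ∀ {V : Set.Iic U} (hV : V ≤ V₀), P V hV 0)
    (add : ∀ {V : Set.Iic U} (hV : V ≤ V₀) (q q' : Q.sec i V), P V hV q → P V hV q' →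
      P V hV (q + q'))
    (gen : ∀ {V : Set.Iic U} (hV : V ≤ V₀) {j k : ℤ} (h : j + k = i) (f : A.sec j V.1)
      (g : A.sec k V.1), P V hV (Q.smul h f (Q.der g)))
    {V : Set.Iic U} (hV : V ≤ V₀) {q : Q.sec i V} (hq : Q.InOmega q) : P V hV q := by
  refine loc hV q fun x hx => ?_
  obtain ⟨W, hW, hxW, h⟩ := hq x hx
  refine ⟨W, hW, hxW, ?_⟩
  rw [← AddSubgroup.mem_toAddSubmonoid, AddSubgroup.closure_toAddSubmonoid] at h
  refine AddSubmonoid.closure_induction (motive := fun q _ => P W (hW.trans hV) q) (fun q hq => ?_)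
    (zero _) (fun _ _ _ _ => add _ _ _) h
  rcases hq with ⟨j, k, hi, f, g, rfl⟩ | ⟨j, k, hi, f, g, hq⟩
  · exact gen _ hi f g
  · have e : q = Q.smul hi (-f) (Q.der g) := by
      rw [LinearMap.map_neg₂, ← hq, neg_neg]
    rw [e]
    exact gen _ hi _ g

/-- In negative degrees the anchor is injective, as the `f ∂(g)` have non-negative degrees. -/
theorem IsExact.eq_zero_of_neg (hA : HasFrames A) (hQ : Q.IsExact) (hi : i < 0) {q : Q.sec i V}
    (hq : Q.anchor q = 0) : q = 0 := by
  refine InOmega.induction (V₀ := V) (P := fun W _ q => q = 0)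
    (fun hV q H => Q.eq_of_local fun x hx => ?_) (fun _ => rfl) ?_ ?_ le_rfl ((hQ.ker q).1 hq)
  · obtain ⟨W, hW, hxW, e⟩ := H x hx
    exact ⟨W, hW, hxW, by rw [e, map_zero]⟩
  · rintro _ _ _ _ rfl rfl
    exact add_zero 0
  · intro W hW j k h f g
    by_cases hj : j < 0
    · rw [hA.eq_zero_of_neg f hj, map_zero, LinearMap.zero_apply]
    · rw [hA.eq_zero_of_neg g (by omega), map_zero, map_zero]

theorem IsExact.eq_zero_of_lt (hA : HasFrames A) (hQ : Q.IsExact) (hi : i < -1) (q : Q.sec i V) :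
    q = 0 :=
  hQ.eq_zero_of_neg hA (by omega) (Der.eq_zero_of_lt hA hi _)

/-- Locally, every vector field is the image of a section of the lift of the tangent sheaf. -/
theorem IsExact.exists_isLag_local (hA : HasFrames A) (hQ : Q.IsExact) (D : Der A i V.1) :
    ∀ x ∈ V.1, ∃ (W : Set.Iic U) (h : W ≤ V), x ∈ W.1 ∧ ∃ q : Q.sec i W, Q.IsLag q ∧
      Q.anchor q = Der.res h D := by
  intro x hx
  obtain ⟨W, hW, hxW, ⟨F⟩⟩ := hA.exists_frame x hx
  -- The vector fields on `W` that lift near `x` contain the frame and are closed under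
  -- the operations used in the expansion with respect to the frame.
  let P : ∀ {j : ℤ}, Der A j W → Prop := fun {j} D => ∃ (Z : Set.Iic U) (h : Z.1 ≤ W), x ∈ Z.1 ∧
    ∃ q : Q.sec j Z, Q.IsLag q ∧ Q.anchor q = Der.res h D
  have hadd : ∀ {j : ℤ} (D E : Der A j W), P D → P E → P (D + E) := by
    rintro j D E ⟨Z, hZ, hxZ, q, hq, e⟩ ⟨Z', hZ', hxZ', q', hq', e'⟩
    let Y : Set.Iic U := ⟨Z.1 ⊓ Z'.1, Set.mem_Iic.2 (inf_le_left.trans Z.2)⟩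
    have hY : Y ≤ Z := inf_le_left (a := Z.1)
    have hY' : Y ≤ Z' := inf_le_right (a := Z.1)
    refine ⟨Y, le_trans (show Y.1 ≤ Z.1 from hY) hZ, ⟨hxZ, hxZ'⟩, Q.res hY q + Q.res hY' q',
      (hq.res _).add (hq'.res _), ?_⟩
    rw [map_add, map_add, ← Q.isLocal.res_anchor, ← Q.isLocal.res_anchor, e, e']
    rfl
  have hzero : ∀ {j : ℤ}, P (0 : Der A j W) := fun {j} =>
    ⟨⟨W, Set.mem_Iic.2 (hW.trans V.2)⟩, le_rfl, hxW, 0, IsLag.zero, by rw [map_zero, map_zero]⟩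
  have hsmul : ∀ {j l m : ℤ} (h : l + j = m) (f : A.sec l W) (D : Der A j W), P D →
      P (Der.fsmul h f D) := by
    rintro j l m h f D ⟨Z, hZ, hxZ, q, hq, e⟩
    refine ⟨Z, hZ, hxZ, Q.smul h (A.res hZ f) q, hq.smul h _, ?_⟩
    rw [Q.anchored.anchor_smul, e, Der.res_fsmul]
  have hI : ∀ a, P (F.I a) := by
    intro a
    obtain ⟨Z, hZ, hxZ, q, hq⟩ := hQ.surj (V := ⟨W, Set.mem_Iic.2 (hW.trans V.2)⟩) (F.I a) x hxW
    exact ⟨Z, hZ, hxZ, q, .of_neg_one q, hq⟩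
  have hI' : ∀ a, P (Der.diff (neg_add_cancel 1) (F.I a)) := by
    intro a
    obtain ⟨Z, hZ, hxZ, q, hq, e⟩ := hI a
    refine ⟨Z, hZ, hxZ, Q.d (neg_add_cancel 1) q, hq.d _, ?_⟩
    rw [Q.commDiff.anchor_d, e, Der.res_diff]
  have key : P (Der.res hW D) := by
    rw [F.expand le_rfl (zero_add i) rfl (add_zero i) (by omega) (Der.res hW D)]
    exact Finset.sum_induction _ P hadd hzero fun a _ =>
      hadd _ _ (hsmul _ _ _ (hI' a)) (hsmul _ _ _ (hI a))
  obtain ⟨Z, hZ, hxZ, q, hq, e⟩ := key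
  exact ⟨Z, hZ.trans hW, hxZ, q, hq, e⟩

/-- The lift of the tangent sheaf is isotropic: for sections `r`, `r'` of degree `-1`, the pairings of
`r` with `r'` and with `d(r')` have negative degree, and `⟨d(r), d(r')⟩ = d⟨r, d(r')⟩`. -/
theorem IsLag.pair_eq_zero (hA : HasFrames A) {p : Q.sec i V} {q : Q.sec j V} (hp : Q.IsLag p)
    (hq : Q.IsLag q) (h : i + j = k) : Q.pair h p q = 0 := by
  have z : ∀ {W : Set.Iic U} {l m n : ℤ} (h : l + m = n) (a : Q.sec l W) (b : Q.sec m W), n < 0 →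
      Q.pair h a b = 0 := fun h a b hn => hA.eq_zero_of_neg _ hn
  have dd : ∀ {W : Set.Iic U} (r r' : Q.sec (-1) W),
      Q.pair (add_zero 0) (Q.d (neg_add_cancel 1) r) (Q.d (neg_add_cancel 1) r') = 0 := by
    intro W r r'
    have e := Q.commDiff.d_pair (add_zero (-1)) (neg_add_cancel 1) (zero_add 1) (neg_add_cancel 1)
      (add_zero 0) (neg_add_cancel 1) r (Q.d (neg_add_cancel 1) r')
    rw [z _ _ _ (by omega), map_zero, Q.d_d, map_zero, smul_zero, add_zero] at e
    exact e.symm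
  -- Sections of the lift pair to zero with the generators.
  have key : ∀ {i : ℤ} {V : Set.Iic U} {q : Q.sec i V}, Q.IsLag q → ∀ {l : ℤ} (h : i + -1 = l)
      (h' : i + 0 = i) (r : Q.sec (-1) V), Q.pair h q r = 0 ∧
        Q.pair h' q (Q.d (neg_add_cancel 1) r) = 0 := by
    intro i V q hq l h h'
    refine IsLag.induction (V₀ := V) (P := fun W _ q => ∀ r : Q.sec (-1) W, Q.pair h q r = 0 ∧
        Q.pair h' q (Q.d (neg_add_cancel 1) r) = 0) (fun hV q H r => ?_) (fun _ r => ?_)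
        (fun _ q q' H H' r => ?_) (fun _ c q H r => ?_) (fun _ q hq r => ?_) le_rfl hq
    · refine ⟨CdgaSheaf.eq_of_local fun x hx => ?_, CdgaSheaf.eq_of_local fun x hx => ?_⟩
      · obtain ⟨W, hW, hxW, H⟩ := H x hx
        refine ⟨W.1, hW, hxW, ?_⟩
        rw [Q.isLocal.res_pair hW, map_zero]
        exact (H _).1
      · obtain ⟨W, hW, hxW, H⟩ := H x hx
        refine ⟨W.1, hW, hxW, ?_⟩
        rw [Q.isLocal.res_pair hW, map_zero, Q.res_d]
        exact (H _).2
    · simp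
    · simp [(H r).1, (H r).2, (H' r).1, (H' r).2]
    · simp [(H r).1, (H r).2]
    · cases hq with
      | @base m hj g r' =>
        rw [Q.paired.pair_smul hj h (show -1 + -1 = -2 by norm_num) (by omega),
          Q.paired.pair_smul hj h' (add_zero (-1)) (by omega), z _ _ _ (by omega),
          z _ _ _ (by omega), map_zero, map_zero]
        exact ⟨rfl, rfl⟩
      | diff hj g r' =>
        rw [Q.paired.pair_smul hj h (zero_add (-1)) h,
          Q.paired.pair_smul hj h' (add_zero 0) hj, z _ _ _ (by omega), dd, map_zero, map_zero]
        exact ⟨rfl, rfl⟩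
  refine IsLag.induction (V₀ := V) (P := fun W _ p => ∀ q : Q.sec j W, Q.IsLag q →
    Q.pair h p q = 0) (fun hV p H q hq => CdgaSheaf.eq_of_local fun x hx => ?_) (fun _ q hq => ?_)
    (fun _ p p' H H' q hq => ?_) (fun _ c p H q hq => ?_) (fun _ p hp q hq => ?_) le_rfl hp q hq
  · obtain ⟨W, hW, hxW, H⟩ := H x hx
    refine ⟨W.1, hW, hxW, ?_⟩
    rw [Q.isLocal.res_pair hW, map_zero]
    exact H _ (hq.res hW)
  · simp
  · simp [H q hq, H' q hq]
  · simp [H q hq]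
  · cases hp with
    | @base m hj g r =>
      rw [Q.paired.pair_smul hj h rfl (by omega), Q.paired.pair_comm rfl (add_comm _ _),
        (key hq _ (add_zero j) r).1, smul_zero, map_zero]
    | diff hj g r =>
      rw [Q.paired.pair_smul hj h (zero_add j) h, Q.paired.pair_comm _ (add_zero j),
        (key hq rfl (add_zero j) r).2, smul_zero, map_zero]

theorem br_eq_neg_of_pair_eq_zero (h : i + j = k) (h' : j + i = k) {p : Q.sec i V} {q : Q.sec j V}
    (e : Q.pair h p q = 0) : Q.br h p q = -((-1 : ℂ) ^ (i * j) • Q.br h' q p) := by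
  have := Q.relations.br_symm h h' p q
  rw [e, map_zero] at this
  exact eq_neg_of_add_eq_zero_left this

/-- The lift of the tangent sheaf is closed under the bracket: for sections `r`, `r'` of degree `-1`,
`[r, r']` has degree `-2` and vanishes, `[d(r), r']` has degree `-1`, and `[d(r), d(r')]` is the
differential of `[r, d(r')]`. -/
theorem IsLag.br (hA : HasFrames A) (hQ : Q.IsExact) {p : Q.sec i V} {q : Q.sec j V}
    (hp : Q.IsLag p) (hq : Q.IsLag q) (h : i + j = k) : Q.IsLag (Q.br h p q) := by
  have dd : ∀ {W : Set.Iic U} (r r' : Q.sec (-1) W),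
      Q.IsLag (Q.br (add_zero 0) (Q.d (neg_add_cancel 1) r) (Q.d (neg_add_cancel 1) r')) := by
    intro W r r'
    have e := Q.commDiff.d_br (add_zero (-1)) (neg_add_cancel 1) (zero_add 1) (neg_add_cancel 1)
      (add_zero 0) (neg_add_cancel 1) r (Q.d (neg_add_cancel 1) r')
    rw [Q.d_d, map_zero, smul_zero, add_zero] at e
    rw [← e]
    exact .of_d _
  -- The bracket with a generator preserves the lift.
  have key : ∀ {i : ℤ} {V : Set.Iic U} {q : Q.sec i V}, Q.IsLag q → ∀ {l : ℤ} (h : -1 + i = l)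
      (h' : 0 + i = i) (r : Q.sec (-1) V), Q.IsLag (Q.br h r q) ∧
        Q.IsLag (Q.br h' (Q.d (neg_add_cancel 1) r) q) := by
    intro i V q hq l h h'
    refine IsLag.induction (V₀ := V) (P := fun W _ q => ∀ r : Q.sec (-1) W, Q.IsLag (Q.br h r q) ∧
        Q.IsLag (Q.br h' (Q.d (neg_add_cancel 1) r) q)) (fun hV q H r => ?_) (fun _ r => ?_)
        (fun _ q q' H H' r => ?_) (fun _ c q H r => ?_) (fun _ q hq r => ?_) le_rfl hq
    · refine ⟨.of_local fun x hx => ?_, .of_local fun x hx => ?_⟩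
      · obtain ⟨W, hW, hxW, H⟩ := H x hx
        refine ⟨W, hW, hxW, ?_⟩
        rw [Q.isLocal.res_br hW]
        exact (H _).1
      · obtain ⟨W, hW, hxW, H⟩ := H x hx
        refine ⟨W, hW, hxW, ?_⟩
        rw [Q.isLocal.res_br hW, Q.res_d]
        exact (H _).2
    · simp only [map_zero]; exact ⟨.zero, .zero⟩
    · simp only [map_add]; exact ⟨(H r).1.add (H' r).1, (H r).2.add (H' r).2⟩
    · simp only [map_smul]; exact ⟨(H r).1.const_smul c, (H r).2.const_smul c⟩
    · cases hq with
      | @base m hj g r' =>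
        rw [Q.relations.br_smul hj h (show -1 + -1 = -2 by norm_num) (by omega) rfl (by omega),
          Q.relations.br_smul hj h' (zero_add (-1)) (by omega) (add_zero m) (by omega),
          hQ.eq_zero_of_lt hA (by norm_num) (Q.br _ r r'), map_zero, smul_zero, zero_add]
        exact ⟨.smul _ _ (.of_neg_one _),
          .add (.const_smul _ (.smul _ _ (.of_neg_one _))) (.smul _ _ (.of_neg_one _))⟩
      | diff hj g r' =>
        rw [Q.relations.br_smul hj h (add_zero (-1)) (by omega) (show i + -1 = l by omega)
            (by omega),
          Q.relations.br_smul hj h' (zero_add 0) (by omega) (add_zero i) (by omega)]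
        exact ⟨.add (.const_smul _ (.smul _ _ (.of_neg_one _))) (.smul _ _ (.of_d _)),
          .add (.const_smul _ (.smul _ _ (dd _ _))) (.smul _ _ (.of_d _))⟩
  refine IsLag.induction (V₀ := V) (P := fun W _ q => ∀ p : Q.sec i W, Q.IsLag p →
    Q.IsLag (Q.br h p q)) (fun hV q H p hp => .of_local fun x hx => ?_) (fun _ q hq => ?_)
    (fun _ q q' H H' p hp => ?_) (fun _ c q H p hp => ?_) (fun _ q hq p hp => ?_) le_rfl hq p hp
  · obtain ⟨W, hW, hxW, H⟩ := H x hx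
    refine ⟨W, hW, hxW, ?_⟩
    rw [Q.isLocal.res_br hW]
    exact H _ (hp.res hW)
  · rw [map_zero]; exact .zero
  · rw [map_add]; exact (H p hp).add (H' p hp)
  · rw [map_smul]; exact (H p hp).const_smul c
  · have hneg : ∀ {l : ℤ} {W : Set.Iic U} {q : Q.sec l W}, Q.IsLag q → Q.IsLag (-q) := fun hq => by
      rw [← zero_sub]; exact IsLag.zero.sub hq
    cases hq with
    | @base m hj g r =>
      rw [Q.relations.br_smul hj h rfl (by omega) rfl (by omega),
        br_eq_neg_of_pair_eq_zero rfl (add_comm _ _) (hp.pair_eq_zero hA (.of_neg_one r) _)]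
      exact .add (.const_smul _ (.smul _ _ (hneg (.const_smul _ (key hp _ (zero_add i) r).1))))
        (.smul _ _ (.of_neg_one _))
    | diff hj g r =>
      rw [Q.relations.br_smul hj h (add_zero i) (by omega) rfl (by omega),
        br_eq_neg_of_pair_eq_zero _ (zero_add i) (hp.pair_eq_zero hA (.of_d r) _)]
      exact .add (.const_smul _ (.smul _ _ (hneg (.const_smul _ (key hp rfl (zero_add i) r).2))))
        (.smul _ _ (.of_d _))

end CourantAlgebroid

end DRCourant
end

/-! ### The cotangent sheaf in a Courant algebroid -/

noncomputable section
namespace DRCourant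

variable {X : Type u} [TopologicalSpace X] {A : CdgaSheaf X} {U : Opens X}

namespace CourantAlgebroid

variable {Q : CourantAlgebroid A U} {V W : Set.Iic U} {i j k : ℤ}

section Iota

variable (Q) in
/-- The `A`-linear map from the cotangent sheaf to `Q` through which the derivation factors. -/
def iota {V : Set.Iic U} {i : ℤ} : OneForm A i V.1 →ₗ[ℂ] Q.sec i V :=
  Q.derived.der_factors.choose V i

theorem res_iota (hW : W ≤ V) (φ : OneForm A i V.1) :
    Q.res hW (Q.iota φ) = Q.iota (OneForm.res hW φ) :=
  Q.derived.der_factors.choose_spec.1 V W hW i φ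

theorem iota_fsmul (h : i + j = k) (f : A.sec i V.1) (φ : OneForm A j V.1) :
    Q.iota (OneForm.fsmul h f φ) = Q.smul h f (Q.iota φ) :=
  Q.derived.der_factors.choose_spec.2.1 V i j k h f φ

theorem iota_ofFun (f : A.sec i V.1) : Q.iota (OneForm.ofFun f) = Q.der f :=
  Q.derived.der_factors.choose_spec.2.2 V i f

/-- To prove a local and additive property of the one-forms on the open subsets of `V`, it suffices to
consider the forms `f dg`. -/
theorem iota_induction (hA : HasFrames A) (V : Set.Iic U)
    {P : ∀ W : Set.Iic U, W ≤ V → OneForm A i W.1 → Prop}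
    (loc : ∀ {W : Set.Iic U} (hW : W ≤ V) (φ : OneForm A i W.1),
      (∀ x ∈ W.1, ∃ (Z : Set.Iic U) (hZ : Z ≤ W), x ∈ Z.1 ∧ P Z (hZ.trans hW) (OneForm.res hZ φ)) →
        P W hW φ)
    (zero : ∀ {W : Set.Iic U} (hW : W ≤ V), P W hW 0)
    (add : ∀ {W : Set.Iic U} (hW : W ≤ V) (φ ψ : OneForm A i W.1), P W hW φ → P W hW ψ →
      P W hW (φ + ψ))
    (gen : ∀ {W : Set.Iic U} (hW : W ≤ V) {j k : ℤ} (h : j + k = i) (f : A.sec j W.1)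
      (g : A.sec k W.1), P W hW (OneForm.fsmul h f (OneForm.ofFun g)))
    (φ : OneForm A i V.1) : P V le_rfl φ :=
  OneForm.local_induction hA (V₀ := V.1) (P := fun _ hW φ => P (sub hW) hW φ)
    (fun hW φ H => loc (W := sub hW) hW φ fun x hx => by
      obtain ⟨Z, hZ, hxZ, H⟩ := H x hx
      exact ⟨sub (hZ.trans hW), hZ, hxZ, H⟩)
    (fun hW => zero (W := sub hW) hW) (fun hW => add (W := sub hW) hW)
    (fun hW => gen (W := sub hW) hW) le_rfl φ

theorem anchor_iota (hA : HasFrames A) (φ : OneForm A i V.1) : Q.anchor (Q.iota φ) = 0 := by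
  refine iota_induction hA V (P := fun W _ φ => Q.anchor (Q.iota φ) = 0)
    (fun hW φ H => Der.eq_of_local fun x hx => ?_) (fun _ => ?_) (fun _ φ ψ H H' => ?_)
    (fun _ a b h f g => ?_) φ
  · obtain ⟨Z, hZ, hxZ, e⟩ := H x hx
    exact ⟨Z.1, hZ, hxZ, by rw [Q.isLocal.res_anchor hZ, res_iota, e, map_zero]⟩
  · rw [map_zero, map_zero]
  · rw [map_add, map_add, H, H', add_zero]
  · rw [iota_fsmul, iota_ofFun, Q.anchored.anchor_smul, Q.relations.anchor_der, ← Der.fsmulₗ_apply,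
      map_zero]

theorem pair_iota (hA : HasFrames A) (h : i + j = k) (h' : j + i = k) (q : Q.sec i V)
    (φ : OneForm A j V.1) :
    Q.pair h q (Q.iota φ) = (-1 : ℂ) ^ (i * j) • OneForm.on φ le_rfl h' (Q.anchor q) := by
  refine iota_induction hA V (P := fun W _ φ => ∀ q : Q.sec i W, Q.pair h q (Q.iota φ) =
      (-1 : ℂ) ^ (i * j) • OneForm.on φ le_rfl h' (Q.anchor q))
    (fun hW φ H q => CdgaSheaf.eq_of_local fun x hx => ?_) (fun _ q => ?_)
    (fun _ φ ψ H H' q => ?_) (fun _ a b hab f g q => ?_) φ q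
  · obtain ⟨Z, hZ, hxZ, H⟩ := H x hx
    refine ⟨Z.1, hZ, hxZ, ?_⟩
    rw [Q.isLocal.res_pair hZ, res_iota, H, map_smul, OneForm.res_on, Q.isLocal.res_anchor hZ]
    rfl
  · simp
  · rw [map_add, map_add, H, H', OneForm.on_add, smul_add]
  · obtain ⟨m, hm⟩ : ∃ m, b + i = m := ⟨_, rfl⟩
    rw [iota_fsmul, iota_ofFun, Q.paired.pair_comm h h', Q.paired.pair_smul hab h' hm (by omega),
      Q.paired.pair_comm hm (show i + b = m by omega), Q.relations.pair_der _ hm,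
      OneForm.on_fsmul hab _ _ _ h' hm (by omega), OneForm.on_ofFun, A.res_self, A.res_self,
      mul_comm b i]

theorem br_iota (hA : HasFrames A) (h : i + j = k) (q : Q.sec i V) (φ : OneForm A j V.1) :
    Q.br h q (Q.iota φ) = Q.iota (OneForm.lie h (Q.anchor q) φ) := by
  refine iota_induction hA V (P := fun W _ φ => ∀ q : Q.sec i W, Q.br h q (Q.iota φ) =
      Q.iota (OneForm.lie h (Q.anchor q) φ))
    (fun hW φ H q => Q.eq_of_local fun x hx => ?_) (fun _ q => ?_)
    (fun _ φ ψ H H' q => ?_) (fun _ a b hab f g q => ?_) φ q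
  · obtain ⟨Z, hZ, hxZ, H⟩ := H x hx
    refine ⟨Z, hZ, hxZ, ?_⟩
    rw [Q.isLocal.res_br hZ, res_iota, H, res_iota, OneForm.res_lie, Q.isLocal.res_anchor hZ]
  · rw [← OneForm.lieₗ_apply]; simp only [map_zero]
  · rw [← OneForm.lieₗ_apply]; simp only [map_add, H, H', OneForm.lieₗ_apply]
  · obtain ⟨m, hm⟩ : ∃ m, i + b = m := ⟨_, rfl⟩
    rw [iota_fsmul, iota_ofFun,
      Q.relations.br_smul hab h hm (show a + m = k by omega) rfl (by omega),
      Q.relations.br_der _ (show b + i = m by omega),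
      OneForm.lie_fsmul hab h hm (show a + m = k by omega) rfl (by omega),
      OneForm.lie_ofFun _ (show b + i = m by omega), map_add, map_smul, iota_fsmul, iota_fsmul,
      iota_ofFun, iota_ofFun]

theorem iota_br (hA : HasFrames A) (h : i + j = k) (h' : j + i = k) (φ : OneForm A i V.1)
    (q : Q.sec j V) :
    Q.br h (Q.iota φ) q = Q.iota (-((-1 : ℂ) ^ (i * j) • OneForm.lie h' (Q.anchor q) φ) +
      OneForm.ofFun (OneForm.on φ le_rfl h (Q.anchor q))) := by
  have e := Q.relations.br_symm h h' (Q.iota φ) q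
  rw [br_iota hA, Q.paired.pair_comm h h', pair_iota hA h' h, smul_smul, mul_comm j i,
    Der.sign_mul_self, one_smul] at e
  rw [eq_sub_of_add_eq e, map_add, map_neg, map_smul, iota_ofFun]
  abel

theorem d_iota (hA : HasFrames A) (h : i + 1 = j) (h' : 1 + i = j) (φ : OneForm A i V.1) :
    Q.d h (Q.iota φ) = Q.iota (OneForm.lie h' (Der.δ V.1) φ) := by
  refine iota_induction hA V (P := fun W _ φ => Q.d h (Q.iota φ) =
      Q.iota (OneForm.lie h' (Der.δ W.1) φ))
    (fun hW φ H => Q.eq_of_local fun x hx => ?_) (fun _ => ?_)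
    (fun _ φ ψ H H' => ?_) (fun _ a b hab f g => ?_) φ
  · obtain ⟨Z, hZ, hxZ, H⟩ := H x hx
    refine ⟨Z, hZ, hxZ, ?_⟩
    rw [Q.res_d hZ, res_iota, H, res_iota, OneForm.res_lie, Der.res_δ]
  · rw [← OneForm.lieₗ_apply]; simp only [map_zero]
  · rw [← OneForm.lieₗ_apply]; simp only [map_add, H, H', OneForm.lieₗ_apply]
  · obtain ⟨m, hm⟩ : ∃ m, 1 + b = m := ⟨_, rfl⟩
    obtain ⟨n, hn⟩ : ∃ n, a + 1 = n := ⟨_, rfl⟩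
    rw [iota_fsmul, iota_ofFun,
      Q.d_smul hab hn (show b + 1 = m by omega) h (show n + b = j by omega)
        (show a + m = j by omega),
      Q.commDiff.d_der,
      OneForm.lie_fsmul hab h' hm (show a + m = j by omega) hn (show n + b = j by omega),
      OneForm.lie_ofFun _ (show b + 1 = m by omega), map_add, map_smul, iota_fsmul, iota_fsmul,
      iota_ofFun, iota_ofFun, one_mul, add_comm]
    rfl

end Iota

/-! ### The flat connection of an exact Courant algebroid -/

section Exact

/-- The lift of the tangent sheaf and the cotangent sheaf are in perfect duality. -/
theorem IsExact.oneForm_eq_zero (hA : HasFrames A) (hQ : Q.IsExact) (φ : OneForm A j V.1)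
    (H : ∀ {W : Set.Iic U} (hW : W ≤ V) {i k : ℤ} (h : i + j = k) (p : Q.sec i W), Q.IsLag p →
      Q.pair h p (Q.iota (OneForm.res hW φ)) = 0) : φ = 0 := by
  refine OneForm.ext_on fun W hW i k hk D => CdgaSheaf.eq_of_local fun x hx => ?_
  obtain ⟨Z, hZ, hxZ, p, hp, e⟩ := hQ.exists_isLag_local (V := sub hW) hA D x hx
  refine ⟨Z.1, hZ, hxZ, ?_⟩
  have h' := H (W := Z) (le_trans (b := sub hW) hZ hW) (show i + j = k by omega) p hp
  rw [pair_iota hA _ hk, e] at h'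
  have h'' := (smul_eq_zero_iff_right (zpow_ne_zero _ (by norm_num))).mp h'
  rw [OneForm.on_zero, map_zero]
  exact (OneForm.res_on φ hW (show Z.1 ≤ W from hZ) hk D).trans h''

theorem IsExact.iota_injective (hA : HasFrames A) (hQ : Q.IsExact) {φ : OneForm A j V.1}
    (h : Q.iota φ = 0) : φ = 0 :=
  hQ.oneForm_eq_zero hA φ fun hW _ _ _ p _ => by rw [← res_iota, h, map_zero, map_zero]

/-- The kernel of the anchor is the cotangent sheaf. -/
theorem IsExact.exists_iota_eq (hA : HasFrames A) (hQ : Q.IsExact) {q : Q.sec i V}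
    (hq : Q.anchor q = 0) : ∃ φ, Q.iota φ = q := by
  refine InOmega.induction (V₀ := V) (P := fun W _ q => ∃ φ, Q.iota φ = q)
    (fun {W} hW q H => ?_) (fun _ => ⟨0, map_zero _⟩) ?_
    (fun _ _ _ h f g => ⟨OneForm.fsmul h f (OneForm.ofFun g), by rw [iota_fsmul, iota_ofFun]⟩)
    le_rfl ((hQ.ker q).1 hq)
  · obtain ⟨φ, hφ⟩ := UniqueGluing.exists_of_local (V := W.1) (OneForm.uniqueGluing (A := A) i)
      (Φ := fun Z hZ φ => Q.iota (V := sub (hZ : Z ≤ W.1)) φ =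
        Q.res (show sub (hZ : Z ≤ W.1) ≤ W from hZ) q)
      (fun {Z} hZ s t hs ht => sub_eq_zero.mp (hQ.iota_injective (V := sub (hZ : Z ≤ W.1)) hA
        (((Q.iota (V := sub (hZ : Z ≤ W.1))).map_sub s t).trans (sub_eq_zero.mpr (hs.trans ht.symm)))))
      (fun {Z Y} hZ hY s hs => by
        have h : sub (hY.trans hZ : Y ≤ W.1) ≤ sub (hZ : Z ≤ W.1) := hY
        exact (res_iota h s).symm.trans ((congrArg (Q.res h) hs).trans (Q.res_res _ _ _)))
      (fun x hx => by
        obtain ⟨Z, hZ, hxZ, φ, e⟩ := H x hx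
        exact ⟨Z.1, hZ, hxZ, φ, e⟩)
    refine ⟨φ, Q.eq_of_local fun x hx => ?_⟩
    obtain ⟨Z, hZ, hxZ, e⟩ := hφ x hx
    exact ⟨sub (hZ : Z ≤ W.1), hZ, hxZ,
      (res_iota (show sub (hZ : Z ≤ W.1) ≤ W from hZ) φ).trans e⟩
  · rintro _ _ _ _ ⟨φ, rfl⟩ ⟨ψ, rfl⟩
    exact ⟨φ + ψ, map_add _ _ _⟩

/-- The anchor is injective on the lift of the tangent sheaf: a section of the kernel is a one-form,
which vanishes because the lift is isotropic. -/
theorem IsLag.eq_zero (hA : HasFrames A) (hQ : Q.IsExact) {q : Q.sec i V} (hq : Q.IsLag q)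
    (h : Q.anchor q = 0) : q = 0 := by
  obtain ⟨φ, rfl⟩ := hQ.exists_iota_eq hA h
  rw [hQ.oneForm_eq_zero hA φ fun hW _ _ h p hp => ?_, map_zero]
  rw [← res_iota]
  exact hp.pair_eq_zero hA (hq.res hW) h

theorem IsLag.eq_of_anchor (hA : HasFrames A) (hQ : Q.IsExact) {q q' : Q.sec i V} (hq : Q.IsLag q)
    (hq' : Q.IsLag q') (h : Q.anchor q = Q.anchor q') : q = q' :=
  sub_eq_zero.mp ((hq.sub hq').eq_zero hA hQ (by rw [map_sub, h, sub_self]))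

theorem IsExact.exists_isLag (hA : HasFrames A) (hQ : Q.IsExact) (D : Der A i V.1) :
    ∃ q : Q.sec i V, Q.IsLag q ∧ Q.anchor q = D := by
  obtain ⟨q, hq⟩ := UniqueGluing.exists_of_local (V := V) (Q.glue i)
    (Φ := fun W hW q => Q.IsLag q ∧ Q.anchor q = Der.res hW D)
    (fun _ _ _ hs ht => hs.1.eq_of_anchor hA hQ ht.1 (hs.2.trans ht.2.symm))
    (fun hW hZ s hs => ⟨hs.1.res hZ, by rw [← Q.isLocal.res_anchor hZ, hs.2]; rfl⟩)
    (hQ.exists_isLag_local hA D)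
  refine ⟨q, .of_local fun x hx => ?_, Der.eq_of_local fun x hx => ?_⟩
  · obtain ⟨W, hW, hxW, h⟩ := hq x hx
    exact ⟨W, hW, hxW, h.1⟩
  · obtain ⟨W, hW, hxW, h⟩ := hq x hx
    exact ⟨W.1, hW, hxW, by rw [Q.isLocal.res_anchor hW]; exact h.2⟩

/-- The flat connection of an exact Courant algebroid, the inverse of the anchor on the lift of the
tangent sheaf. -/
def nabla (hA : HasFrames A) (hQ : Q.IsExact) : Der A i V.1 →ₗ[ℂ] Q.sec i V where
  toFun D := (hQ.exists_isLag hA D).choose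
  map_add' D E := (hQ.exists_isLag hA (D + E)).choose_spec.1.eq_of_anchor hA hQ
    ((hQ.exists_isLag hA D).choose_spec.1.add (hQ.exists_isLag hA E).choose_spec.1) (by
      rw [map_add, (hQ.exists_isLag hA (D + E)).choose_spec.2,
        (hQ.exists_isLag hA D).choose_spec.2, (hQ.exists_isLag hA E).choose_spec.2])
  map_smul' c D := (hQ.exists_isLag hA (c • D)).choose_spec.1.eq_of_anchor hA hQ
    ((hQ.exists_isLag hA D).choose_spec.1.const_smul c) (by
      rw [map_smul, (hQ.exists_isLag hA (c • D)).choose_spec.2,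
        (hQ.exists_isLag hA D).choose_spec.2, RingHom.id_apply])

variable (hA : HasFrames A) (hQ : Q.IsExact)

theorem isLag_nabla (D : Der A i V.1) : Q.IsLag (nabla hA hQ D) :=
  (hQ.exists_isLag hA D).choose_spec.1

theorem anchor_nabla (D : Der A i V.1) : Q.anchor (nabla hA hQ D) = D :=
  (hQ.exists_isLag hA D).choose_spec.2

theorem IsLag.eq_nabla {q : Q.sec i V} (hq : Q.IsLag q) {D : Der A i V.1} (h : Q.anchor q = D) :
    q = nabla hA hQ D :=
  hq.eq_of_anchor hA hQ (isLag_nabla hA hQ D) (h.trans (anchor_nabla hA hQ D).symm)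

/-- The lift of the tangent sheaf defines a flat connection. -/
def flatConnection : Q.FlatConnection where
  toFun := nabla hA hQ
  res_toFun hW _ D := ((isLag_nabla hA hQ D).res hW).eq_nabla hA hQ
    (by rw [← Q.isLocal.res_anchor hW, anchor_nabla])
  toFun_smul h f D := (((isLag_nabla hA hQ D).smul h f).eq_nabla hA hQ
    (by rw [Q.anchored.anchor_smul, anchor_nabla])).symm
  toFun_diff h D := (((isLag_nabla hA hQ D).d h).eq_nabla hA hQ
    (by rw [Q.commDiff.anchor_d, anchor_nabla])).symm
  anchor_toFun := anchor_nabla hA hQ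
  toFun_bracket h D E := (((isLag_nabla hA hQ D).br hA hQ (isLag_nabla hA hQ E) h).eq_nabla hA hQ
    (by rw [Q.anchored.anchor_br, anchor_nabla, anchor_nabla])).symm

/-- Every flat connection inverts the anchor on the lift of the tangent sheaf: this is clear in degree
`-1`, where the anchor is injective, and connections commute with products and differentials. -/
theorem FlatConnection.toFun_anchor (hA : HasFrames A) (hQ : Q.IsExact) (C : Q.FlatConnection)
    {q : Q.sec i V} (hq : Q.IsLag q) : C.toFun (Q.anchor q) = q := by
  have h₁ : ∀ {W : Set.Iic U} (r : Q.sec (-1) W), C.toFun (Q.anchor r) = r := fun r =>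
    sub_eq_zero.mp (hQ.eq_zero_of_neg hA (by norm_num) (by rw [map_sub, C.anchor_toFun, sub_self]))
  refine IsLag.induction (V₀ := V) (P := fun W _ q => C.toFun (Q.anchor q) = q)
    (fun hW q H => Q.eq_of_local fun x hx => ?_) (fun _ => ?_)
    (fun _ q q' H H' => ?_) (fun _ c q H => ?_) (fun _ q hq => ?_) le_rfl hq
  · obtain ⟨Z, hZ, hxZ, H⟩ := H x hx
    exact ⟨Z, hZ, hxZ, by rw [C.res_toFun hZ, Q.isLocal.res_anchor hZ, H]⟩
  · rw [map_zero, map_zero]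
  · rw [map_add, map_add, H, H']
  · rw [map_smul, map_smul, H]
  · cases hq with
    | base hj f r => rw [Q.anchored.anchor_smul, C.toFun_smul, h₁]
    | diff hj f r => rw [Q.anchored.anchor_smul, C.toFun_smul, Q.commDiff.anchor_d, C.toFun_diff, h₁]

/-- Every exact Courant algebroid admits a unique flat connection. -/
theorem nonempty_unique_flatConnection (hA : HasFrames A) (hQ : Q.IsExact) :
    Nonempty (Unique Q.FlatConnection) :=
  ⟨{ default := flatConnection hA hQ
     uniq := fun C => FlatConnection.ext (by
      funext V i
      refine LinearMap.ext fun D => ?_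
      have e := C.toFun_anchor hA hQ (isLag_nabla hA hQ D)
      rw [anchor_nabla] at e
      exact e) }⟩

end Exact

end CourantAlgebroid

end DRCourant
end

/-! ### Exactness of the standard Courant algebroid -/

noncomputable section
namespace DRCourant

variable {X : Type u} [TopologicalSpace X] {A : CdgaSheaf X} {U : Opens X}

namespace CourantAlgebroid

variable {Q Q' : CourantAlgebroid A U} {V W : Set.Iic U} {i j k : ℤ}

section Standard

theorem InOmega.anchor_eq_zero {q : Q.sec i V} (hq : Q.InOmega q) : Q.anchor q = 0 := by
  refine InOmega.induction (V₀ := V) (P := fun W _ q => Q.anchor q = 0)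
    (fun hW q H => Der.eq_of_local fun x hx => ?_) (fun _ => map_zero _) (fun _ q q' H H' => ?_)
    (fun _ _ _ h f g => ?_) le_rfl hq
  · obtain ⟨Z, hZ, hxZ, e⟩ := H x hx
    exact ⟨Z.1, hZ, hxZ, by rw [Q.isLocal.res_anchor hZ, e, map_zero]⟩
  · rw [map_add, H, H', add_zero]
  · rw [Q.anchored.anchor_smul, Q.relations.anchor_der, ← Der.fsmulₗ_apply, map_zero]

theorem inOmega_iota (hA : HasFrames A) (φ : OneForm A i V.1) : Q.InOmega (Q.iota φ) := by
  refine iota_induction hA V (P := fun W _ φ => Q.InOmega (Q.iota φ))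
    (fun {W} hW φ H x hx => ?_) (fun {W} _ x hx => ⟨W, le_rfl, hx, ?_⟩)
    (fun {W} _ φ ψ H H' x hx => ?_) (fun {W} _ {_ _} h f g x hx => ⟨W, le_rfl, hx, ?_⟩) φ
  · obtain ⟨Z, hZ, hxZ, H⟩ := H x hx
    rw [← res_iota] at H
    obtain ⟨Y, hY, hxY, e⟩ := H x hxZ
    exact ⟨Y, hY.trans hZ, hxY, by rwa [Q.res_res] at e⟩
  · rw [map_zero, map_zero]
    exact zero_mem _
  · obtain ⟨Z, hZ, hxZ, e⟩ := H x hx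
    obtain ⟨Z', hZ', hxZ', e'⟩ := H' x hx
    have hres : ∀ {Z Y : Set.Iic U} (hY : Y ≤ Z) {q : Q.sec i Z},
        q ∈ AddSubgroup.closure {q' : Q.sec i Z | ∃ (j k : ℤ) (hi : j + k = i)
          (f : A.sec j Z.1) (g : A.sec k Z.1), q' = Q.smul hi f (Q.der g)} →
        Q.res hY q ∈ AddSubgroup.closure {q' : Q.sec i Y | ∃ (j k : ℤ) (hi : j + k = i)
          (f : A.sec j Y.1) (g : A.sec k Y.1), q' = Q.smul hi f (Q.der g)} := by
      intro Z Y hY q hq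
      refine (AddSubgroup.closure_le
        (K := (AddSubgroup.closure _).comap (Q.res hY).toAddMonoidHom)).2 ?_ hq
      rintro _ ⟨j, k, hi, f, g, rfl⟩
      refine AddSubgroup.subset_closure ⟨j, k, hi, A.res hY f, A.res hY g, ?_⟩
      exact (Q.res_smul hY hi f _).trans (by rw [Q.isLocal.res_der hY])
    let Y : Set.Iic U := ⟨Z.1 ⊓ Z'.1, Set.mem_Iic.2 (inf_le_left.trans Z.2)⟩
    have hY : Y ≤ Z := inf_le_left (a := Z.1)
    have hY' : Y ≤ Z' := inf_le_right (a := Z.1)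
    refine ⟨Y, hY.trans hZ, ⟨hxZ, hxZ'⟩, ?_⟩
    have e₁ := hres hY e
    have e₂ := hres hY' e'
    rw [Q.res_res] at e₁ e₂
    rw [map_add, map_add]
    exact add_mem e₁ e₂
  · rw [iota_fsmul, iota_ofFun, Q.res_self]
    exact AddSubgroup.subset_closure ⟨_, _, h, f, g, rfl⟩

theorem stdCourant_iota (hA : HasFrames A) (φ : OneForm A i V.1) :
    (stdCourant A U).iota φ = ((0, φ) : StdSec A i V.1) := by
  refine iota_induction hA V (P := fun W _ φ =>
      (stdCourant A U).iota φ = ((0, φ) : StdSec A i W.1))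
    (fun {W} hW φ H => (stdCourant A U).eq_of_local fun x hx => ?_) (fun _ => map_zero _)
    (fun {W} _ φ ψ H H' => ?_) (fun {W} _ {_ k} h f g => ?_) φ
  · obtain ⟨Z, hZ, hxZ, H⟩ := H x hx
    exact ⟨Z, hZ, hxZ, (res_iota hZ φ).trans (H.trans rfl)⟩
  · rw [map_add, H, H']
    exact Prod.ext (add_zero (0 : Der A i W.1)) rfl
  · rw [iota_fsmul, iota_ofFun]
    exact Prod.ext ((Der.fsmulₗ A W.1 h f).map_zero) rfl

/-- The standard Courant algebroid is exact. -/
theorem isExact_stdCourant (hA : HasFrames A) (U : Opens X) : (stdCourant A U).IsExact where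
  ker {i V} q := by
    refine ⟨fun h => ?_, InOmega.anchor_eq_zero⟩
    obtain ⟨D, φ⟩ : StdSec A i V.1 := q
    obtain rfl : D = 0 := h
    rw [← stdCourant_iota hA]
    exact inOmega_iota hA φ
  surj {i V} D x hx := ⟨V, le_rfl, hx, ((D, 0) : StdSec A i V.1), rfl⟩

end Standard

/-! ### Morphisms of exact Courant algebroids -/

section Morphisms

theorem Hom.toFun_iota (hA : HasFrames A) (f : Hom Q Q') (φ : OneForm A i V.1) :
    f.toFun (Q.iota φ) = Q'.iota φ := by
  refine iota_induction hA V (P := fun W _ φ => f.toFun (Q.iota φ) = Q'.iota φ)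
    (fun hW φ H => Q'.eq_of_local fun x hx => ?_) (fun _ => ?_)
    (fun _ φ ψ H H' => ?_) (fun _ _ _ h g g' => ?_) φ
  · obtain ⟨Z, hZ, hxZ, H⟩ := H x hx
    exact ⟨Z, hZ, hxZ, by rw [f.res_toFun hZ, res_iota, H, res_iota]⟩
  · rw [map_zero, map_zero, map_zero]
  · rw [map_add, map_add, map_add, H, H']
  · rw [iota_fsmul, iota_ofFun, iota_fsmul, iota_ofFun, f.toFun_smul, f.toFun_der]

/-- Morphisms preserve the lifts of the tangent sheaf. -/
theorem Hom.isLag_toFun (f : Hom Q Q') {q : Q.sec i V} (hq : Q.IsLag q) :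
    Q'.IsLag (f.toFun q) := by
  refine IsLag.induction (V₀ := V) (P := fun W _ q => Q'.IsLag (f.toFun q))
    (fun hW q H => .of_local fun x hx => ?_) (fun _ => ?_) (fun _ q q' H H' => ?_)
    (fun _ c q H => ?_) (fun _ q hq => ?_) le_rfl hq
  · obtain ⟨Z, hZ, hxZ, H⟩ := H x hx
    exact ⟨Z, hZ, hxZ, by rw [f.res_toFun hZ]; exact H⟩
  · rw [map_zero]; exact .zero
  · rw [map_add]; exact H.add H'
  · rw [map_smul]; exact H.const_smul c
  · cases hq with
    | base hj g r => rw [f.toFun_smul]; exact .smul _ _ (.of_neg_one _)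
    | diff hj g r => rw [f.toFun_smul, f.toFun_d]; exact .smul _ _ (.of_d _)

/-- An exact Courant algebroid is the direct sum of the lift of the tangent sheaf and of the
cotangent sheaf. -/
theorem IsExact.exists_eq_add (hA : HasFrames A) (hQ : Q.IsExact) (q : Q.sec i V) :
    ∃ φ, nabla hA hQ (Q.anchor q) + Q.iota φ = q := by
  obtain ⟨φ, hφ⟩ := hQ.exists_iota_eq hA (q := q - nabla hA hQ (Q.anchor q))
    (by rw [map_sub, anchor_nabla, sub_self])
  exact ⟨φ, by rw [hφ, add_sub_cancel]⟩

theorem Hom.toFun_nabla (hA : HasFrames A) (hQ : Q.IsExact) (hQ' : Q'.IsExact) (f : Hom Q Q')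
    (D : Der A i V.1) : f.toFun (nabla hA hQ D) = nabla hA hQ' D :=
  (f.isLag_toFun (isLag_nabla hA hQ D)).eq_nabla hA hQ' (by rw [f.anchor_toFun, anchor_nabla])

/-- A morphism is determined on the cotangent sheaf by its compatibility with the derivations, and on
the lift of the tangent sheaf by its compatibility with the anchors. -/
theorem Hom.eq_of_isExact (hA : HasFrames A) (hQ : Q.IsExact) (hQ' : Q'.IsExact) (f g : Hom Q Q') :
    f = g := by
  refine Hom.ext (funext fun V => funext fun i => LinearMap.ext fun q => ?_)
  obtain ⟨φ, hφ⟩ := hQ.exists_eq_add hA q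
  rw [← hφ, map_add, map_add, f.toFun_nabla hA hQ hQ', g.toFun_nabla hA hQ hQ', f.toFun_iota hA,
    g.toFun_iota hA]

variable (hA : HasFrames A)

theorem nabla_res (hQ : Q.IsExact) (hW : W ≤ V) (D : Der A i V.1) :
    Q.res hW (nabla hA hQ D) = nabla hA hQ (Der.res hW D) := (flatConnection hA hQ).res_toFun hW D

theorem nabla_fsmul (hQ : Q.IsExact) (h : i + j = k) (f : A.sec i V.1) (D : Der A j V.1) :
    nabla hA hQ (Der.fsmul h f D) = Q.smul h f (nabla hA hQ D) :=
  (flatConnection hA hQ).toFun_smul h f D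

theorem nabla_diff (hQ : Q.IsExact) (h : i + 1 = j) (D : Der A i V.1) :
    nabla hA hQ (Der.diff h D) = Q.d h (nabla hA hQ D) := (flatConnection hA hQ).toFun_diff h D

theorem nabla_bracket (hQ : Q.IsExact) (h : i + j = k) (D : Der A i V.1) (E : Der A j V.1) :
    nabla hA hQ (Der.bracket h D E) = Q.br h (nabla hA hQ D) (nabla hA hQ E) :=
  (flatConnection hA hQ).toFun_bracket h D E

/-- The morphism from the standard Courant algebroid to an exact one given by the flat
connection. -/
def ofStd (hQ : Q.IsExact) : Hom (stdCourant A U) Q where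
  toFun {V i} := (nabla hA hQ).coprod (Q.iota (V := V) (i := i))
  res_toFun {V W} hW {i} q := by
    obtain ⟨D, φ⟩ : StdSec A i V.1 := q
    refine ((Q.res hW).map_add (nabla hA hQ D) (Q.iota φ)).trans ?_
    rw [nabla_res, res_iota]
    rfl
  toFun_smul {V i j k} h f q := by
    obtain ⟨D, φ⟩ : StdSec A j V.1 := q
    refine (congrArg₂ (· + ·) (nabla_fsmul hA hQ h f D) (iota_fsmul h f φ)).trans ?_
    exact ((Q.smul h f).map_add _ _).symm
  toFun_d {V i j} h q := by
    obtain ⟨D, φ⟩ : StdSec A i V.1 := q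
    refine Eq.trans ?_ ((Q.d h).map_add (nabla hA hQ D) (Q.iota φ)).symm
    rw [← nabla_diff, d_iota hA h (show 1 + i = j by omega)]
    refine congrArg₂ (fun a b => nabla hA hQ a + Q.iota b) (StdSec.d_fst h _) ?_
    refine (StdSec.br_snd (show 1 + i = j by omega) h _ _).trans ?_
    rw [show (StdSec.δ V.1 : StdSec A 1 V.1).2 = 0 from rfl]
    simp only [map_zero, OneForm.on_zero, smul_zero, sub_zero, add_zero]
    rfl
  toFun_br {V i j k} h a b := by
    obtain ⟨D, φ⟩ : StdSec A i V.1 := a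
    obtain ⟨E, ψ⟩ : StdSec A j V.1 := b
    have h' : j + i = k := by omega
    change nabla hA hQ _ + Q.iota _ =
      Q.br h (nabla hA hQ D + Q.iota φ) (nabla hA hQ E + Q.iota ψ)
    rw [map_add, map_add, LinearMap.add_apply, LinearMap.add_apply, br_iota hA, br_iota hA,
      iota_br hA h h', ← nabla_bracket, anchor_nabla, anchor_nabla, anchor_iota hA]
    have e : OneForm.lie h (0 : Der A i V.1) ψ = 0 := LinearMap.map_zero₂ (OneForm.lieₗ A V.1 h) ψ
    rw [e, map_zero, add_zero, add_assoc, ← map_add]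
    refine congrArg (nabla hA hQ (Der.bracket h D E) + Q.iota ·) ?_
    refine (StdSec.br_snd h h' (D, φ) (E, ψ)).trans ?_
    simp only [OneForm.lieₗ_apply, OneForm.ofFunₗ_apply]
    abel
  anchor_toFun {V i} q := by
    obtain ⟨D, φ⟩ : StdSec A i V.1 := q
    refine (Q.anchor.map_add (nabla hA hQ D) (Q.iota φ)).trans ?_
    rw [anchor_nabla, anchor_iota hA, add_zero]
    rfl
  pair_toFun {V i j k} h a b := by
    obtain ⟨D, φ⟩ : StdSec A i V.1 := a
    obtain ⟨E, ψ⟩ : StdSec A j V.1 := b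
    have h' : j + i = k := by omega
    change Q.pair h (nabla hA hQ D + Q.iota φ) (nabla hA hQ E + Q.iota ψ) = _
    rw [map_add, map_add, LinearMap.add_apply, LinearMap.add_apply, pair_iota hA h h',
      pair_iota hA h h', Q.paired.pair_comm h h' (Q.iota φ), pair_iota hA h' h, anchor_nabla,
      anchor_nabla, anchor_iota hA, (isLag_nabla hA hQ D).pair_eq_zero hA (isLag_nabla hA hQ E),
      map_zero, smul_zero, add_zero, zero_add, smul_smul, mul_comm j i, Der.sign_mul_self, one_smul]
    exact (StdSec.pair_apply h h' (D, φ) (E, ψ)).symm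
  toFun_der {V i} f := by
    refine (congrArg (· + Q.iota (OneForm.ofFun f)) (nabla hA hQ).map_zero).trans ?_
    rw [zero_add, iota_ofFun]

theorem bijective_ofStd (hQ : Q.IsExact) (V : Set.Iic U) (i : ℤ) :
    Function.Bijective ((ofStd hA hQ).toFun (V := V) (i := i)) := by
  refine ⟨(injective_iff_map_eq_zero _).2 fun q hq => ?_, fun q => ?_⟩
  · obtain ⟨D, φ⟩ : StdSec A i V.1 := q
    have hD : D = 0 := by
      have e := (ofStd hA hQ).anchor_toFun ((D, φ) : StdSec A i V.1)
      rw [hq, map_zero] at e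
      exact e.symm
    subst hD
    have e : nabla hA hQ (0 : Der A i V.1) + Q.iota φ = 0 := hq
    rw [map_zero, zero_add] at e
    rw [hQ.iota_injective hA e]
    rfl
  · obtain ⟨φ, hφ⟩ := hQ.exists_eq_add hA q
    exact ⟨((Q.anchor q, φ) : StdSec A i V.1), hφ⟩

/-- The inverse of a bijective morphism. -/
def Hom.inverse (f : Hom Q Q')
    (hf : ∀ (V : Set.Iic U) (i : ℤ), Function.Bijective (f.toFun (V := V) (i := i))) : Hom Q' Q :=
  have h₁ : ∀ {V : Set.Iic U} {i : ℤ} (q : Q'.sec i V),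
      f.toFun ((LinearEquiv.ofBijective _ (hf V i)).symm q) = q := fun q =>
    (LinearEquiv.ofBijective _ (hf _ _)).apply_symm_apply q
  have h₂ : ∀ {V : Set.Iic U} {i : ℤ} {q : Q'.sec i V} {p : Q.sec i V}, f.toFun p = q →
      (LinearEquiv.ofBijective _ (hf V i)).symm q = p := fun {V i q p} h =>
    (hf V i).1 ((h₁ q).trans h.symm)
  { toFun := fun {V i} => (LinearEquiv.ofBijective _ (hf V i)).symm.toLinearMap
    res_toFun := fun {V W} hW {i} q => (h₂ (by rw [← f.res_toFun]; exact congrArg _ (h₁ q))).symm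
    toFun_smul := fun h g q => h₂ (by rw [f.toFun_smul]; exact congrArg _ (h₁ q))
    toFun_d := fun h q => h₂ (by rw [f.toFun_d]; exact congrArg _ (h₁ q))
    toFun_br := fun h a b => h₂ (by
      rw [f.toFun_br]; exact congrArg₂ (fun a b => Q'.br h a b) (h₁ a) (h₁ b))
    anchor_toFun := fun q => by
      rw [← f.anchor_toFun]; exact congrArg _ (h₁ q)
    pair_toFun := fun h a b => by
      rw [← f.pair_toFun]; exact congrArg₂ (fun a b => Q'.pair h a b) (h₁ a) (h₁ b)
    toFun_der := fun g => h₂ (f.toFun_der g) }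

end Morphisms

end CourantAlgebroid

/-- All exact Courant algebroids are uniquely isomorphic to the standard one. -/
theorem isContractible_exactCA (hA : HasFrames A) (U : Opens X) : IsContractible (ExactCA A U) where
  nonempty := ⟨⟨stdCourant A U, CourantAlgebroid.isExact_stdCourant hA U⟩⟩
  nonempty_hom M N := ⟨CourantAlgebroid.Hom.comp
    (CourantAlgebroid.Hom.inverse _ (CourantAlgebroid.bijective_ofStd hA M.exact))
    (CourantAlgebroid.ofStd hA N.exact)⟩
  hom_ext {M N} f g := CourantAlgebroid.Hom.eq_of_isExact hA M.exact N.exact f g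

end DRCourant
end

/-! ### Coordinates and differential forms -/

noncomputable section
namespace DRCourant

variable {X : Type u} [TopologicalSpace X] {O : AlgSheaf X}

variable (O) in
/-- Coordinates on an open set `W`: functions `x a` and vector fields `∂ a` with `∂ a (x b) = δ_{ab}`
that form a basis of the vector fields on the open subsets of `W`. -/
structure Coords (W : Opens X) where
  n : ℕ
  x : Fin n → O.sec W
  del : Fin n → VF O W
  act_del : ∀ a b, VF.act (del a) (x b) = if a = b then 1 else 0
  eq_sum : ∀ {Z : Opens X} (hZ : Z ≤ W) (ξ : VF O Z),
    ξ = ∑ a, VF.fsmul (VF.act ξ (O.res hZ (x a))) (VF.res hZ (del a))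

namespace Coords

variable {W Z Y : Opens X} (C : Coords O W)

/-- Derivations with values in differential forms are determined by their values on the
coordinates. -/
theorem formDer_eq_zero : ∀ {p : ℕ} {Z : Opens X} (hZ : Z ≤ W)
    (F : ∀ {Y : Opens X}, Y ≤ Z → O.sec Y →ₗ[ℂ] PreForm O p Y)
    (_ : ∀ {Y : Opens X} (hY : Y ≤ Z) (f : O.sec Y), (F hY f).IsForm)
    (_ : ∀ {Y Y' : Opens X} (hY : Y ≤ Z) (h : Y' ≤ Y) (f : O.sec Y),
      PreForm.res h (F hY f) = F (h.trans hY) (O.res h f))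
    (_ : ∀ {Y : Opens X} (hY : Y ≤ Z) (f g : O.sec Y), F hY (f * g) =
      PreForm.wedge p (PreForm.ofFun f) (F hY g) + PreForm.wedge p (PreForm.ofFun g) (F hY f))
    (_ : ∀ a, F le_rfl (O.res hZ (C.x a)) = 0) {Y : Opens X} (hY : Y ≤ Z) (f : O.sec Y),
    F hY f = 0
  | 0, Z, hZ, F, _, hres, hmul, hx, Y, hY, f => by
    let ξ : VF O Z := ⟨fun T => Derivation.mk' (PreForm.toFun ∘ₗ F T.2) fun f g =>
        congrArg PreForm.toFun ((hmul T.2 f g).trans (by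
          rw [PreForm.wedge_00, PreForm.wedge_00]; rfl)),
      fun T T' h h' f => congrArg PreForm.toFun (hres h h' f)⟩
    have hξ : ξ = 0 := by
      rw [C.eq_sum hZ ξ]
      refine Finset.sum_eq_zero fun a _ => ?_
      have e : VF.act ξ (O.res hZ (C.x a)) = 0 := congrArg PreForm.toFun (hx a)
      rw [e]
      refine VF.ext_act fun T hT g => ?_
      rw [VF.res_fsmul, VF.act_fsmul, map_zero, zero_mul]
      rfl
    exact congrArg (fun ξ : VF O Z => ξ.1 ⟨Y, hY⟩ f) hξ
  | p + 1, Z, hZ, F, hform, hres, hmul, hx, Y, hY, f => by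
    refine PreForm.ext_ev fun T hT ξ => ?_
    have e := formDer_eq_zero (p := p) (Z := T) ((hT.trans hY).trans hZ)
      (fun {T'} hT' => PreForm.ev le_rfl (VF.res hT' ξ) ∘ₗ F (hT'.trans (hT.trans hY)))
      (fun hT' f => (hform _ f).ev _ _)
      (fun {T' T''} hT' h f => by
        rw [LinearMap.comp_apply, LinearMap.comp_apply, (hform _ f).res_ev, ← hres _ h]
        rfl)
      (fun {T'} hT' f g => by
        simp only [LinearMap.comp_apply]
        rw [hmul, map_add, PreForm.ev_wedge01, PreForm.ev_wedge01, PreForm.res_self,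
          PreForm.res_self])
      (fun a => by
        rw [LinearMap.comp_apply, ← O.res_res hZ (hT.trans hY), ← hres le_rfl, hx, map_zero,
          map_zero])
      le_rfl (O.res hT f)
    rw [LinearMap.comp_apply, ← hres hY hT, PreForm.ev_res] at e
    rw [map_zero]
    exact e

/-- The expansion of a differential form with respect to the coordinates,
`(p + 1) ω = ∑ dx_a ∧ ι_a ω`. -/
theorem form_eq_sum : ∀ {p : ℕ} {Z : Opens X} (hZ : Z ≤ W) {ω : PreForm O (p + 1) Z},
    ω.IsForm → ((p + 1 : ℕ) : ℂ) • ω = ∑ a, PreForm.wedge (p + 1)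
      (PreForm.d (PreForm.ofFun (O.res hZ (C.x a)))) (PreForm.ev le_rfl (VF.res hZ (C.del a)) ω) := by
  have key : ∀ {p : ℕ} {Z Y : Opens X} (hZ : Z ≤ W) {ω : PreForm O (p + 1) Z} (hω : ω.IsForm)
      (hY : Y ≤ Z) (ξ : VF O Y), PreForm.ev hY ξ ω = ∑ a, PreForm.wedge p
        (PreForm.ofFun (VF.act ξ (O.res (hY.trans hZ) (C.x a))))
        (PreForm.ev hY (VF.res (hY.trans hZ) (C.del a)) ω) := by
    intro p Z Y hZ ω hω hY ξ
    let φ : VF O Y →+ PreForm O p Y :=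
      { toFun := fun ξ => PreForm.ev hY ξ ω
        map_zero' := hω.ev_zero hY
        map_add' := hω.ev_add hY }
    conv_lhs => rw [C.eq_sum (hY.trans hZ) ξ]
    refine (map_sum φ _ _).trans (Finset.sum_congr rfl fun a _ => ?_)
    exact hω.ev_fsmul hY _ _
  intro p
  induction p with
  | zero =>
    intro Z hZ ω hω
    refine PreForm.ext_ev fun Y hY ξ => ?_
    rw [show ((0 + 1 : ℕ) : ℂ) = 1 by norm_num, one_smul, key hZ hω hY ξ, map_sum]
    refine Finset.sum_congr rfl fun a _ => ?_
    rw [PreForm.ev_wedge10, PreForm.ev_d_zero, PreForm.lie_zero_deg, hω.res_ev, PreForm.res_ofFun,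
      PreForm.toFun_ofFun, O.res_res, VF.res_res]
  | succ p ih =>
    intro Z hZ ω hω
    refine PreForm.ext_ev fun Y hY ξ => ?_
    have e : ∀ a, PreForm.ev hY ξ (PreForm.wedge (p + 2)
        (PreForm.d (PreForm.ofFun (O.res hZ (C.x a)))) (PreForm.ev le_rfl (VF.res hZ (C.del a)) ω)) =
        PreForm.wedge (p + 1) (PreForm.ofFun (VF.act ξ (O.res (hY.trans hZ) (C.x a))))
          (PreForm.ev hY (VF.res (hY.trans hZ) (C.del a)) ω) +
        PreForm.wedge (p + 1) (PreForm.d (PreForm.ofFun (O.res (hY.trans hZ) (C.x a))))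
          (PreForm.ev le_rfl (VF.res (hY.trans hZ) (C.del a)) (PreForm.ev hY ξ ω)) := by
      intro a
      have e₁ : PreForm.ev hY ξ (PreForm.ev le_rfl (VF.res hZ (C.del a)) ω) =
          -PreForm.ev le_rfl (VF.res (hY.trans hZ) (C.del a)) (PreForm.ev hY ξ ω) := by
        rw [← hω.antisymm, ← PreForm.ev_res hY le_rfl, hω.res_ev, VF.res_res]
      rw [PreForm.ev_wedge11, PreForm.ev_d_zero, PreForm.lie_zero_deg, hω.res_ev,
        PreForm.res_ofFun, PreForm.toFun_ofFun, O.res_res, VF.res_res, e₁, PreForm.res_d,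
        PreForm.res_ofFun, O.res_res, ← PreForm.wedge_smul_right]
      simp
    rw [map_sum, Finset.sum_congr rfl fun a _ => e a, Finset.sum_add_distrib, ← key hZ hω hY ξ,
      ← ih (hY.trans hZ) (hω.ev hY ξ), map_smul]
    push_cast
    module

end Coords

/-! ### Contractions -/

namespace DRSec

variable {V W : Opens X}

/-- Contraction with a vector field, from degree `p + 1` to degree `q = p`. -/
def contractForm (ξ : VF O V) {p : ℕ} : ∀ {q : ℕ}, p = q →
    DRSec O (.ofNat (p + 1)) V →ₗ[ℂ] DRSec O (.ofNat q) V
  | _, rfl =>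
    { toFun := fun a => of (PreForm.ev le_rfl ξ (val a)) ((isForm a).ev _ _)
      map_add' := fun _ _ => ext ((PreForm.ev le_rfl ξ).map_add _ _)
      map_smul' := fun _ _ => ext ((PreForm.ev le_rfl ξ).map_smul _ _) }

/-- Contraction with a vector field. -/
def contract (ξ : VF O V) : ∀ {i j : ℤ}, i + -1 = j → DRSec O i V →ₗ[ℂ] DRSec O j V
  | .ofNat (p + 1), .ofNat q, h => contractForm ξ (show p = q by
      simp only [Int.ofNat_eq_natCast] at h; omega)
  | .ofNat (_ + 1), .negSucc _, _ => 0
  | .ofNat 0, _, _ => 0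
  | .negSucc _, _, _ => 0

theorem contract_zero (ξ : VF O V) {j : ℤ} (h : Int.ofNat 0 + -1 = j) (a : DRSec O (.ofNat 0) V) :
    contract ξ h a = 0 := by
  cases j <;> simp [contract]

theorem contract_neg (ξ : VF O V) {n : ℕ} {j : ℤ} (h : Int.negSucc n + -1 = j)
    (a : DRSec O (.negSucc n) V) : contract ξ h a = 0 := by
  cases j <;> simp [contract]

theorem res_contract (hW : W ≤ V) (ξ : VF O V) {i j : ℤ} (h : i + -1 = j) (a : DRSec O i V) :
    res hW (contract ξ h a) = contract (VF.res hW ξ) h (res hW a) := by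
  rcases i with p | n
  · rcases p with _ | p
    · rw [contract_zero, contract_zero, map_zero]
    · obtain rfl : Int.ofNat p = j := by rw [← h]; simp
      exact ext ((isForm a).res_ev _ _ _)
  · rw [contract_neg, contract_neg, map_zero]

theorem contract_mul (ξ : VF O V) {i j l i' j' l' : ℤ} (hl : i + j = l) (hi : i + -1 = i')
    (hj : j + -1 = j') (hl' : l + -1 = l') (h₁ : i' + j = l') (h₂ : i + j' = l') (a : DRSec O i V)
    (b : DRSec O j V) :
    contract ξ hl' (mul hl a b) =
      mul h₁ (contract ξ hi a) b + (-1 : ℂ) ^ (-1 * i) • mul h₂ a (contract ξ hj b) := by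
  rcases i with p | i
  · rcases j with q | j
    · rcases l with r | r
      swap
      · simp only [Int.ofNat_eq_natCast] at hl; omega
      rcases r with _ | r
      · obtain rfl : p = 0 := by simp only [Int.ofNat_eq_natCast] at hl; omega
        obtain rfl : q = 0 := by simp only [Int.ofNat_eq_natCast] at hl; omega
        rw [contract_zero, contract_zero, contract_zero, map_zero, map_zero, LinearMap.zero_apply,
          smul_zero, add_zero]
      obtain rfl : Int.ofNat r = l' := by rw [← hl']; simp
      rcases p with _ | p <;> rcases q with _ | q
      · simp only [Int.ofNat_eq_natCast] at hl; omega
      · obtain rfl : Int.ofNat q = j' := by rw [← hj]; simp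
        rw [contract_zero, map_zero, LinearMap.zero_apply, zero_add]
        simp only [Int.ofNat_eq_natCast, Nat.cast_zero, mul_zero, zpow_zero, one_smul]
        refine ext ((PreForm.ev_wedge01 le_rfl ξ (val a) (val b)).trans ?_)
        rw [PreForm.res_self]
        rfl
      · obtain rfl : Int.ofNat p = i' := by rw [← hi]; simp
        rw [contract_zero, map_zero, smul_zero, add_zero]
        refine ext ((PreForm.ev_wedge10 le_rfl ξ (val b) (val a)).trans ?_)
        rw [PreForm.res_self]
        rfl
      · obtain rfl : Int.ofNat p = i' := by rw [← hi]; simp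
        obtain rfl : Int.ofNat q = j' := by rw [← hj]; simp
        have e : (-1 : ℂ) ^ (-1 * Int.ofNat (p + 1)) = (-1 : ℂ) ^ (p + 1) := by
          rw [neg_one_mul, zpow_neg, Int.ofNat_eq_natCast, zpow_natCast, ← inv_pow]
          norm_num
        rw [e]
        refine ext ((PreForm.ev_wedge11 le_rfl ξ (val a) (val b)).trans ?_)
        rw [PreForm.res_self, PreForm.res_self, map_add, map_smul]
        rfl
    · rw [Subsingleton.elim b 0]
      simp only [map_zero, smul_zero, add_zero]
  · rw [Subsingleton.elim a 0]
    simp only [map_zero, LinearMap.zero_apply, smul_zero, add_zero]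

end DRSec

/-! ### Frames from coordinates -/

/-- Contraction with a vector field, as a derivation of degree `-1` of the de Rham complex. -/
def VF.contract {V : Opens X} (ξ : VF O V) : Der (deRham O) (-1) V :=
  Der.mk (fun hW _ _ h => DRSec.contract (VF.res hW ξ) h)
    (fun hW h' _ _ h a => DRSec.res_contract h' (VF.res hW ξ) h a)
    (fun hW _ _ _ _ _ _ hl hi' hj' hl' h₁ h₂ a b =>
      DRSec.contract_mul (VF.res hW ξ) hl hi' hj' hl' h₁ h₂ a b)

theorem deRham_eq_zero_of_neg : ∀ {i : ℤ} {V : Opens X} (f : (deRham O).sec i V), i < 0 → f = 0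
  | .ofNat p, _, _, hi => by simp only [Int.ofNat_eq_natCast] at hi; omega
  | .negSucc _, _, _, _ => rfl

variable (O) in
/-- The functions, as the sections of degree `0` of the de Rham complex. -/
def deRhamFun (V : Opens X) : O.sec V →ₗ[ℂ] (deRham O).sec 0 V where
  toFun f := DRSec.of (p := 0) (PreForm.ofFun f) trivial
  map_add' _ _ := rfl
  map_smul' _ _ := rfl

theorem deRhamFun_mul {V : Opens X} (f g : O.sec V) :
    deRhamFun O V (f * g) = (deRham O).mul (zero_add 0) (deRhamFun O V f) (deRhamFun O V g) := rfl

theorem exists_deRhamFun {V : Opens X} (f : (deRham O).sec 0 V) : ∃ g, deRhamFun O V g = f :=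
  ⟨PreForm.toFun (DRSec.val (p := 0) f), rfl⟩

namespace Coords

variable {W Z Y : Opens X} (C : Coords O W)

/-- The coordinates, as functions of degree `0` of the de Rham complex. -/
def y (a : Fin C.n) : (deRham O).sec 0 W := deRhamFun O W (C.x a)

/-- The contractions with the coordinate vector fields. -/
def I (a : Fin C.n) : Der (deRham O) (-1) W := VF.contract (C.del a)

theorem deRham_eq_sum (hY : Y ≤ W) (p : ℕ) (h : 1 + (p : ℤ) = (p + 1 : ℕ))
    (h' : ((p + 1 : ℕ) : ℤ) + -1 = p) (f : (deRham O).sec (p + 1 : ℕ) Y) :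
    ((p + 1 : ℕ) : ℂ) • f = ∑ a, (deRham O).mul h
      ((deRham O).d (zero_add 1) ((deRham O).res hY (C.y a)))
      (Der.on (C.I a) hY h' f) := by
  refine DRSec.ext (p := p + 1) ((C.form_eq_sum hY (DRSec.isForm (p := p + 1) f)).trans ?_)
  exact (map_sum (DRSec.val (O := O) (p := p + 1) (V := Y)) (fun a => (deRham O).mul h
      ((deRham O).d (zero_add 1) ((deRham O).res hY (C.y a)))
      (Der.on (C.I a) hY h' f)) Finset.univ).symm

/-- A derivation of the de Rham complex that annihilates the coordinates annihilates all
functions. -/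
theorem der_deRhamFun_eq_zero (hZ : Z ≤ W) : ∀ {k : ℤ} (h : 0 + k = k) (E : Der (deRham O) k Z)
    (_ : ∀ a, Der.act E h ((deRham O).res hZ (C.y a)) = 0) (hY : Y ≤ Z) (f : O.sec Y),
    Der.on E hY h (deRhamFun O Y f) = 0
  | .negSucc n, h, E, _, hY, f => deRham_eq_zero_of_neg _ (Int.negSucc_lt_zero n)
  | .ofNat p, h, E, h₀, hY, f => by
    refine DRSec.ext (p := p) ?_
    refine C.formDer_eq_zero hZ (p := p)
      (fun {Y} hY => DRSec.val (p := p) ∘ₗ Der.on E hY h ∘ₗ deRhamFun O Y)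
      (fun hY f => DRSec.isForm (p := p) _)
      (fun hY h' f => congrArg (DRSec.val (p := p)) (Der.res_on E hY h' h _)) (fun {Y} hY f g => ?_)
      (fun a => congrArg (DRSec.val (p := p)) (h₀ a)) hY f
    have e : Der.on E hY h (deRhamFun O Y (f * g)) =
        (deRham O).mul h (deRhamFun O Y f) (Der.on E hY h (deRhamFun O Y g)) +
        (deRham O).mul h (deRhamFun O Y g) (Der.on E hY h (deRhamFun O Y f)) := by
      rw [deRhamFun_mul, Der.on_mul E hY (zero_add 0) h h h (add_zero _) h, mul_zero, zpow_zero,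
        one_smul, add_comm, (deRham O).mul_comm (add_zero _) h, mul_zero, zpow_zero, one_smul]
    exact congrArg (DRSec.val (p := p)) e

/-- Derivations of the de Rham complex are determined by their values on the coordinates and on
their differentials. -/
theorem der_eq_zero (hZ : Z ≤ W) {k l : ℤ} (h : 0 + k = k) (h' : 1 + k = l)
    (E : Der (deRham O) k Z) (h₀ : ∀ a, Der.act E h ((deRham O).res hZ (C.y a)) = 0)
    (h₁ : ∀ a, Der.act E h' ((deRham O).d (zero_add 1) ((deRham O).res hZ (C.y a))) = 0) :
    E = 0 := by
  have hd : ∀ {Y : Opens X} (hY : Y ≤ Z) (a), Der.on E hY h'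
      ((deRham O).d (zero_add 1) ((deRham O).res (hY.trans hZ) (C.y a))) = 0 := by
    intro Y hY a
    have e := congrArg ((deRham O).res hY) (h₁ a)
    rw [Der.act, Der.res_on, map_zero, (deRham O).res_d, (deRham O).res_res] at e
    exact e
  -- The derivation vanishes on forms of degree `p`.
  have hform : ∀ (p : ℕ) {Y : Opens X} (hY : Y ≤ Z) {j : ℤ} (hj : (p : ℤ) + k = j)
      (f : (deRham O).sec p Y), Der.on E hY hj f = 0 := by
    intro p
    induction p with
    | zero =>
      intro Y hY j hj f
      obtain rfl : k = j := by rw [← hj]; simp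
      obtain ⟨g, rfl⟩ := exists_deRhamFun f
      exact C.der_deRhamFun_eq_zero hZ hj E h₀ hY g
    | succ p ih =>
      intro Y hY j hj f
      have hp : ((p + 1 : ℕ) : ℤ) = p + 1 := by push_cast; rfl
      have e := congrArg (Der.on E hY hj)
        (C.deRham_eq_sum (hY.trans hZ) p (by omega) (by omega) f)
      rw [map_sum, map_smul] at e
      refine (smul_eq_zero_iff_right (Nat.cast_ne_zero.2 p.succ_ne_zero)).mp
        (e.trans (Finset.sum_eq_zero fun a _ => ?_))
      obtain ⟨j', hj'⟩ : ∃ j', (p : ℤ) + k = j' := ⟨_, rfl⟩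
      rw [Der.on_mul E hY _ h' hj' hj (by omega) (by omega), hd hY, ih hY hj',
        map_zero, LinearMap.zero_apply, map_zero, smul_zero, add_zero]
  refine Der.ext_on fun Y hY i j hj f => ?_
  rcases i with p | n
  · exact hform p hY hj f
  · rw [deRham_eq_zero_of_neg f (Int.negSucc_lt_zero n), map_zero, map_zero]

theorem contract_y (hZ : Z ≤ W) (a b : Fin C.n) {j : ℤ} (h : 0 + -1 = j) :
    Der.on (C.I a) hZ h ((deRham O).res hZ (C.y b)) = 0 :=
  deRham_eq_zero_of_neg _ (by omega)

theorem contract_d_y (hZ : Z ≤ W) (a b : Fin C.n) (h : 1 + -1 = (0 : ℤ)) :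
    Der.on (C.I a) hZ h ((deRham O).d (zero_add 1) ((deRham O).res hZ (C.y b))) =
      if a = b then (deRham O).one Z else 0 := by
  have e : Der.on (C.I a) hZ h
      ((deRham O).d (zero_add 1) ((deRham O).res hZ (C.y b))) =
      deRhamFun O Z (VF.act (VF.res hZ (C.del a)) (O.res hZ (C.x b))) := by
    refine DRSec.ext (p := 0) ?_
    refine (PreForm.ev_d_zero le_rfl _ _).trans ?_
    rw [PreForm.lie_zero_deg, PreForm.res_self]
    rfl
  rw [e, ← VF.res_act, C.act_del]
  split_ifs
  · rw [map_one]; rfl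
  · rw [map_zero, map_zero]

theorem diff_contract_y (hZ : Z ≤ W) (a b : Fin C.n) (h : 0 + 0 = (0 : ℤ)) :
    Der.on (Der.diff (neg_add_cancel 1) (C.I a)) hZ h ((deRham O).res hZ (C.y b)) =
      if a = b then (deRham O).one Z else 0 := by
  rw [Der.on_diff (neg_add_cancel 1) _ hZ h rfl (zero_add 1) (by omega) (by omega), contract_y,
    contract_d_y, map_zero]
  split_ifs <;> simp

theorem diff_contract_d_y (hZ : Z ≤ W) (a b : Fin C.n) (h : 1 + 0 = (1 : ℤ)) :
    Der.on (Der.diff (neg_add_cancel 1) (C.I a)) hZ h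
      ((deRham O).d (zero_add 1) ((deRham O).res hZ (C.y b))) = 0 := by
  rw [Der.on_diff (neg_add_cancel 1) _ hZ h (show 1 + -1 = 0 by omega) one_add_one_eq_two
    (by omega) (by omega), (deRham O).d_d, map_zero, contract_d_y]
  split_ifs
  · rw [CdgaSheaf.d_one, smul_zero, sub_zero]
  · rw [map_zero, smul_zero, sub_zero]

/-- The frame of the tangent sheaf of the de Rham complex defined by coordinates: it consists of the
contractions with the coordinate vector fields. -/
def frame : Frame (deRham O) W where
  n := C.n
  I := C.I
  y := C.y
  expand {Z} hZ {k l} h h' h₁ h₂ D := by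
    have hsum : ∀ {i j : ℤ} (hj : i + k = j) (f : (deRham O).sec i Z)
        (E : Fin C.n → Der (deRham O) k Z),
        Der.act (D - ∑ a, E a) hj f = Der.act D hj f - ∑ a, Der.act (E a) hj f := by
      intro i j hj f E
      let φ : Der (deRham O) k Z →+ (deRham O).sec j Z :=
        { toFun := fun D => Der.act D hj f
          map_zero' := rfl
          map_add' := fun _ _ => rfl }
      exact (map_sub φ _ _).trans (congrArg (φ D - ·) (map_sum φ _ _))
    have mul_one : ∀ {i : ℤ} (h : i + 0 = i) (f : (deRham O).sec i Z),
        (deRham O).mul h f ((deRham O).one Z) = f := fun {i} h f => by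
      rw [(deRham O).mul_comm h (zero_add i), (deRham O).one_mul, mul_zero, zpow_zero, one_smul]
    refine sub_eq_zero.mp (C.der_eq_zero hZ h h' _ (fun b => ?_) fun b => ?_)
    · rw [hsum, sub_eq_zero, Finset.sum_eq_single b]
      · rw [Der.act, Der.act, Der.on_add, Der.on_fsmul h₁ _ _ le_rfl h (zero_add 0) h₁,
          Der.on_fsmul h₂ _ _ le_rfl h (zero_add (-1)) h₂, ← Der.res_diff, Der.on_res, Der.on_res,
          C.diff_contract_y, C.contract_y, if_pos rfl, map_zero, add_zero, (deRham O).res_self,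
          mul_one]
      · intro a _ hab
        rw [Der.act, Der.on_add, Der.on_fsmul h₁ _ _ le_rfl h (zero_add 0) h₁,
          Der.on_fsmul h₂ _ _ le_rfl h (zero_add (-1)) h₂, ← Der.res_diff, Der.on_res, Der.on_res,
          C.diff_contract_y, C.contract_y, if_neg hab, map_zero, map_zero, add_zero]
      · exact fun hb => absurd (Finset.mem_univ b) hb
    · rw [hsum, sub_eq_zero, Finset.sum_eq_single b]
      · rw [Der.act, Der.act, Der.on_add,
          Der.on_fsmul h₁ _ _ le_rfl h' (add_zero 1) (by omega),
          Der.on_fsmul h₂ _ _ le_rfl h' (show 1 + -1 = 0 by omega) (by omega), ← Der.res_diff,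
          Der.on_res, Der.on_res, C.diff_contract_d_y, C.contract_d_y, if_pos rfl, map_zero,
          zero_add, (deRham O).res_self, mul_one]
      · intro a _ hab
        rw [Der.act, Der.on_add,
          Der.on_fsmul h₁ _ _ le_rfl h' (add_zero 1) (by omega),
          Der.on_fsmul h₂ _ _ le_rfl h' (show 1 + -1 = 0 by omega) (by omega), ← Der.res_diff,
          Der.on_res, Der.on_res, C.diff_contract_d_y, C.contract_d_y, if_neg hab, map_zero,
          map_zero, add_zero]
      · exact fun hb => absurd (Finset.mem_univ b) hb

end Coords

variable (O) in
/-- Coordinates exist locally. -/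
def HasCoords : Prop := ∀ (V : Opens X) (x), x ∈ V → ∃ W ≤ V, x ∈ W ∧ Nonempty (Coords O W)

/-- The frames given by local coordinates. -/
theorem HasCoords.hasFrames (h : HasCoords O) : HasFrames (deRham O) where
  eq_zero_of_neg := deRham_eq_zero_of_neg
  exists_frame {V} x hx := by
    obtain ⟨W, hW, hxW, ⟨C⟩⟩ := h V x hx
    exact ⟨W, hW, hxW, ⟨C.frame⟩⟩

end DRCourant
end

/-! ### Hadamard's lemma -/

noncomputable section
namespace DRCourant

section Hadamard

open scoped ContDiff Topology Convolution
open MeasureTheory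

/-- Hadamard's lemma for functions of class `C^r` on the normed space `E` over `𝕜`: near a point `a`,
every function is of the form `f(a) + G(y)(y - a)`. -/
def HadamardLemma (𝕜 : Type) [NontriviallyNormedField 𝕜] [NormedAlgebra 𝕜 ℂ] (E : Type)
    [NormedAddCommGroup E] [NormedSpace 𝕜 E] (r : ℕ∞ω) : Prop :=
  ∀ (f : E → ℂ) (U : Set E) (a : E), IsOpen U → a ∈ U → ContDiffOn 𝕜 r f U →
    ∃ U' ⊆ U, IsOpen U' ∧ a ∈ U' ∧ ∃ G : E → E →L[𝕜] ℂ, ContDiffOn 𝕜 r G U' ∧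
      ∀ y ∈ U', f y = f a + G y (y - a)

variable {E F : Type} [NormedAddCommGroup E] [NormedAddCommGroup F]

/-- The average of a smooth function over the segment from `a` to `y` is a smooth function of `y`: it
is the convolution in the parameter of the segment with a characteristic function. -/
theorem contDiff_integral_segment [NormedSpace ℝ E] [NormedSpace ℝ F] {h : E → F}
    (hh : ContDiff ℝ ∞ h) (a : E) :
    ContDiff ℝ ∞ fun y => ∫ t in (0 : ℝ)..1, h (a + t • (y - a)) := by
  let ρ : ContDiffBump (0 : ℝ) := ⟨1, 2, by norm_num, by norm_num⟩
  have key := contDiffOn_convolution_right_with_param_comp (𝕜 := ℝ) (μ := (volume : Measure ℝ))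
    (n := ⊤) (ContinuousLinearMap.lsmul ℝ ℝ : ℝ →L[ℝ] F →L[ℝ] F) (s := Set.univ)
    (v := fun _ : E => (0 : ℝ)) contDiffOn_const
    (f := (Set.Ioc (0 : ℝ) 1).indicator fun _ => (1 : ℝ))
    (g := fun y s => ρ s • h (a - s • (y - a))) (k := Metric.closedBall 0 2) isOpen_univ
    (isCompact_closedBall _ _) (fun y s _ hs => by
      have : ρ s = 0 := by
        rw [← Function.notMem_support, ρ.support_eq]
        exact fun h => hs (Metric.ball_subset_closedBall h)
      rw [this, zero_smul])
    ((integrable_indicator_iff measurableSet_Ioc).2 (by simp)).locallyIntegrable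
    (ContDiff.contDiffOn (by
      have : ContDiff ℝ ∞ fun q : E × ℝ => ρ q.2 • h (a - q.2 • (q.1 - a)) := by
        refine (ρ.contDiff.comp contDiff_snd).smul (hh.comp ?_)
        fun_prop
      exact this))
  rw [contDiffOn_univ] at key
  convert! key using 2 with y
  rw [convolution_def, intervalIntegral.integral_of_le zero_le_one,
    ← integral_indicator measurableSet_Ioc]
  refine integral_congr_ae (Filter.Eventually.of_forall fun t => ?_)
  by_cases ht : t ∈ Set.Ioc (0 : ℝ) 1
  · have : ρ (0 - t) = 1 := ρ.one_of_mem_closedBall (by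
      rw [mem_closedBall_zero_iff, zero_sub, norm_neg, Real.norm_eq_abs, abs_of_pos ht.1]
      exact ht.2)
    simp only [Set.indicator_of_mem ht, this, ContinuousLinearMap.lsmul_apply, one_smul]
    congr 1
    module
  · simp only [Set.indicator_of_notMem ht, map_zero, _root_.zero_apply]

/-- Hadamard's lemma for smooth functions: `G(y)` is the average of the derivative over the segment
from `a` to `y`. -/
theorem hadamardLemma_smooth [NormedSpace ℝ E] [FiniteDimensional ℝ E] :
    HadamardLemma ℝ E ∞ := by
  intro f U a hU ha hf
  -- Multiplication by a bump function makes `f` smooth on the whole space.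
  obtain ⟨ε, hε, hεU⟩ := Metric.nhds_basis_closedBall.mem_iff.1 (hU.mem_nhds ha)
  let χ : ContDiffBump a := ⟨ε / 2, ε, by positivity, by linarith⟩
  have hsm : ContDiff ℝ ∞ fun y => χ y • f y := by
    refine contDiff_iff_contDiffAt.2 fun y => ?_
    by_cases hy : y ∈ U
    · exact χ.contDiffAt.smul (hf.contDiffAt (hU.mem_nhds hy))
    · have h₁ : y ∉ tsupport χ := by
        rw [χ.tsupport_eq]
        exact fun h => hy (hεU h)
      refine (contDiffAt_const (c := (0 : ℂ))).congr_of_eventuallyEq ?_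
      filter_upwards [notMem_tsupport_iff_eventuallyEq.1 h₁] with z hz
      rw [hz, Pi.zero_apply, zero_smul]
  have heq : ∀ y ∈ Metric.ball a (ε / 2), χ y • f y = f y := fun y hy => by
    rw [χ.one_of_mem_closedBall (Metric.ball_subset_closedBall hy), one_smul]
  obtain ⟨f', hf', heq⟩ : ∃ f' : E → ℂ, ContDiff ℝ ∞ f' ∧ ∀ y ∈ Metric.ball a (ε / 2), f' y = f y :=
    ⟨_, hsm, heq⟩
  have hd : ContDiff ℝ ∞ (fderiv ℝ f') := hf'.fderiv_right (by exact le_rfl)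
  have haU : a ∈ Metric.ball a (ε / 2) := Metric.mem_ball_self (by positivity)
  refine ⟨Metric.ball a (ε / 2), fun y hy => hεU (Metric.ball_subset_closedBall
    (Metric.ball_subset_ball (by linarith) hy)), Metric.isOpen_ball, haU,
    fun y => ∫ t in (0 : ℝ)..1, fderiv ℝ f' (a + t • (y - a)),
    (contDiff_integral_segment hd a).contDiffOn, fun y hy => ?_⟩
  have hc : Continuous fun t : ℝ => a + t • (y - a) := by fun_prop
  have hder : ∀ t : ℝ, HasDerivAt (fun t : ℝ => f' (a + t • (y - a)))
      (fderiv ℝ f' (a + t • (y - a)) (y - a)) t := fun t => by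
    have h₁ : HasDerivAt (fun t : ℝ => a + t • (y - a)) (y - a) t := by
      simpa using ((hasDerivAt_id t).smul_const (y - a)).const_add a
    exact ((hf'.differentiable (by simp)) _).hasFDerivAt.comp_hasDerivAt t h₁
  have hint := intervalIntegral.integral_eq_sub_of_hasDerivAt (a := 0) (b := 1)
    (fun t _ => hder t)
    (((hd.continuous.comp hc).clm_apply continuous_const).intervalIntegrable _ _)
  have happ := ContinuousLinearMap.intervalIntegral_apply (μ := volume) (a := 0) (b := 1)
    (φ := fun t : ℝ => fderiv ℝ f' (a + t • (y - a)))
    ((hd.continuous.comp hc).intervalIntegrable _ _) (y - a)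
  rw [hint] at happ
  rw [← heq y hy, ← heq a haU, happ]
  simp

/-- Hadamard's lemma for analytic functions. -/
theorem hadamardLemma_analytic [NormedSpace ℂ E] : HadamardLemma ℂ E ω := by
  intro f U a hU ha hf
  obtain ⟨p, r, hp⟩ : AnalyticAt ℂ f a :=
    hU.analyticOn_iff_analyticOnNhd.1 ((contDiffOn_omega_iff_analyticOn hU.uniqueDiffOn).1 hf) a ha
  -- `G` is the sum of the shifted power series.
  have hpos : 0 < p.shift.radius := by
    rw [p.radius_shift]
    exact hp.r_pos.trans_le hp.r_le
  have hq : HasFPowerSeriesOnBall p.shift.sum p.shift 0 r :=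
    (p.shift.hasFPowerSeriesOnBall hpos).mono hp.r_pos (by rw [p.radius_shift]; exact hp.r_le)
  have hq' : HasFPowerSeriesOnBall (fun y => p.shift.sum (y - a)) p.shift a r := by
    simpa using hq.comp_sub a
  have hs : p.shift.unshift (f a) = p := by
    ext n v
    cases n with
    | zero =>
      rw [← hp.coeff_zero v]
      rfl
    | succ n => exact congrArg (fun g => g v) (ContinuousMultilinearMap.uncurry_curryRight (p (n + 1)))
  have hu := hq'.unshift (z := f a)
  rw [hs] at hu
  refine ⟨Metric.eball a r ∩ U, Set.inter_subset_right, Metric.isOpen_eball.inter hU,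
    ⟨Metric.mem_eball_self hp.r_pos, ha⟩, fun y => p.shift.sum (y - a), ?_, fun y hy =>
      hp.unique hu hy.1⟩
  exact (hq'.analyticOnNhd.contDiffOn_of_completeSpace).mono Set.inter_subset_left

end Hadamard

end DRCourant
end

/-! ### Coordinates on smooth and complex manifolds -/

noncomputable section
namespace DRCourant

section FunSheaf

open scoped _root_.Manifold ContDiff Topology

variable {𝕜 : Type} [NontriviallyNormedField 𝕜] [NormedAlgebra 𝕜 ℂ]
  {E : Type} [NormedAddCommGroup E] [NormedSpace 𝕜 E]
  {M : Type u} [TopologicalSpace M] [ChartedSpace E M] {r : ℕ∞ω}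

namespace FunSec

/-- A function of class `C^r` as a section of the sheaf of functions. -/
def mk {Y : Opens M} (f : Y → ℂ) (hf : ContMDiff 𝓘(𝕜, E) 𝓘(𝕜, ℂ) r f) :
    (funSheaf 𝕜 E M r).sec Y := ⟨f, hf⟩

/-- The value of a function at a point. -/
def ev {Y : Opens M} (p : Y) : (funSheaf 𝕜 E M r).sec Y →ₐ[ℂ] ℂ :=
  (Pi.evalAlgHom ℂ _ p).comp (funAlgebra 𝕜 E M r Y).val

theorem ext_ev {Y : Opens M} {f g : (funSheaf 𝕜 E M r).sec Y} (h : ∀ p, ev p f = ev p g) : f = g :=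
  Subtype.ext (funext h)

theorem ev_res {Y Y' : Opens M} (h : Y' ≤ Y) (f : (funSheaf 𝕜 E M r).sec Y) (p : Y') :
    ev p ((funSheaf 𝕜 E M r).res h f) = ev ⟨p.1, h p.2⟩ f := rfl

theorem contMDiff_ev {Y : Opens M} (f : (funSheaf 𝕜 E M r).sec Y) :
    ContMDiff 𝓘(𝕜, E) 𝓘(𝕜, ℂ) r fun p => ev p f := f.2

variable (x₀ : M)

/-- A function in the chart at `x₀`, extended by zero from the domain where it is defined. -/
def hat {Y : Opens M} (f : (funSheaf 𝕜 E M r).sec Y) (z : E) : ℂ :=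
  Function.extend Subtype.val (fun p => ev p f) 0 ((chartAt E x₀).symm z)

/-- The germ of `hat x₀ f` at a point of the chart is determined by the values of `f` nearby. -/
theorem hat_eventuallyEq {Y Y' : Opens M} (hY : Y' ≤ Y) {p : M} (hp : p ∈ Y')
    (hp' : p ∈ (chartAt E x₀).source) (f : (funSheaf 𝕜 E M r).sec Y) (g : E → ℂ)
    (h : ∀ (q : M) (hq : q ∈ Y'), q ∈ (chartAt E x₀).source →
      ev ⟨q, hY hq⟩ f = g (chartAt E x₀ q)) :
    hat x₀ f =ᶠ[𝓝 (chartAt E x₀ p)] g := by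
  have hc := (chartAt E x₀).continuousAt_symm ((chartAt E x₀).map_source hp')
  have hn : (Y' : Set M) ∈ 𝓝 ((chartAt E x₀).symm (chartAt E x₀ p)) := by
    rw [(chartAt E x₀).left_inv hp']
    exact Y'.isOpen.mem_nhds hp
  filter_upwards [hc.preimage_mem_nhds hn, (chartAt E x₀).open_target.mem_nhds
    ((chartAt E x₀).map_source hp')] with z hz hz'
  have e := Subtype.val_injective.extend_apply (fun p => ev p f) 0 ⟨_, hY hz⟩
  have e' := h _ hz ((chartAt E x₀).map_target hz')
  rw [(chartAt E x₀).right_inv hz'] at e'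
  exact e.trans e'

theorem hat_chart {Y : Opens M} (p : Y) (hp' : p.1 ∈ (chartAt E x₀).source)
    (f : (funSheaf 𝕜 E M r).sec Y) : hat x₀ f (chartAt E x₀ p) = ev p f := by
  rw [hat, (chartAt E x₀).left_inv hp']
  exact Subtype.val_injective.extend_apply (fun p => ev p f) 0 p

variable [IsManifold 𝓘(𝕜, E) r M]

theorem contDiffAt_hat {Y : Opens M} (p : Y) (hp' : p.1 ∈ (chartAt E x₀).source)
    (f : (funSheaf 𝕜 E M r).sec Y) : ContDiffAt 𝕜 r (hat x₀ f) (chartAt E x₀ p) := by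
  have h₁ : ContMDiffAt 𝓘(𝕜, E) 𝓘(𝕜, ℂ) r (Function.extend Subtype.val (fun p => ev p f) 0) p.1 :=
    contMDiffAt_subtype_iff.1 (by
      simpa only [Subtype.val_injective.extend_apply] using contMDiff_ev f p)
  have h₂ : ContMDiffAt 𝓘(𝕜, E) 𝓘(𝕜, E) r (chartAt E x₀).symm (chartAt E x₀ p) :=
    (contMDiffOn_chart_symm (I := 𝓘(𝕜, E))).contMDiffAt
      ((chartAt E x₀).open_target.mem_nhds ((chartAt E x₀).map_source hp'))
  rw [← (chartAt E x₀).left_inv hp'] at h₁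
  exact contMDiffAt_iff_contDiffAt.1 (h₁.comp _ h₂)

theorem contMDiff_comp_chart {Y : Opens M} (hY : ∀ p ∈ Y, p ∈ (chartAt E x₀).source) (g : E → ℂ)
    (hg : ∀ p ∈ Y, ContDiffAt 𝕜 r g (chartAt E x₀ p)) :
    ContMDiff 𝓘(𝕜, E) 𝓘(𝕜, ℂ) r fun p : Y => g (chartAt E x₀ p) := by
  intro p
  have h₁ : ContMDiffAt 𝓘(𝕜, E) 𝓘(𝕜, E) r (chartAt E x₀) p.1 :=
    (contMDiffOn_chart (I := 𝓘(𝕜, E))).contMDiffAt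
      ((chartAt E x₀).open_source.mem_nhds (hY p p.2))
  exact (contMDiffAt_subtype_iff (f := fun q => g (chartAt E x₀ q)) (x := p)).2
    ((contMDiffAt_iff_contDiffAt.2 (hg p p.2)).comp p.1 h₁)

/-- The derivative of a function in the direction `v` of the model space, in the chart at `x₀`. -/
def dirDer (hr : r + 1 ≤ r) (v : E) {Y : Opens M} (hY : ∀ p ∈ Y, p ∈ (chartAt E x₀).source)
    (f : (funSheaf 𝕜 E M r).sec Y) : (funSheaf 𝕜 E M r).sec Y :=
  mk (fun p => fderiv 𝕜 (hat x₀ f) (chartAt E x₀ p) v)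
    (contMDiff_comp_chart x₀ hY (fun z => fderiv 𝕜 (hat x₀ f) z v) fun p hp =>
      ((contDiffAt_hat x₀ ⟨p, hp⟩ (hY p hp) f).fderiv_right hr).clm_apply contDiffAt_const)

variable {x₀} in
theorem ev_dirDer_eq (hr : r + 1 ≤ r) (v : E) {Y Y' : Opens M}
    (hY : ∀ p ∈ Y, p ∈ (chartAt E x₀).source) (h' : Y' ≤ Y) (f : (funSheaf 𝕜 E M r).sec Y)
    (p : Y') (g : E → ℂ)
    (h : ∀ (q : M) (hq : q ∈ Y'), q ∈ (chartAt E x₀).source →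
      ev ⟨q, h' hq⟩ f = g (chartAt E x₀ q)) :
    ev ⟨p.1, h' p.2⟩ (dirDer x₀ hr v hY f) = fderiv 𝕜 g (chartAt E x₀ p) v :=
  congrArg (fun L : E →L[𝕜] ℂ => L v)
    (hat_eventuallyEq x₀ h' p.2 (hY _ (h' p.2)) f g h).fderiv_eq

end FunSec

open FunSec

variable [IsManifold 𝓘(𝕜, E) r M]

/-- The coordinate vector field in the direction `v` of the model space, in the chart at `x₀`. -/
def FunSec.vf (x₀ : M) (hr : r + 1 ≤ r) (v : E) {W : Opens M}
    (hW : ∀ p ∈ W, p ∈ (chartAt E x₀).source) : VF (funSheaf 𝕜 E M r) W :=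
  ⟨fun Y => Derivation.mk'
    { toFun := dirDer x₀ hr v fun p hp => hW p (Y.2 hp)
      map_add' := fun f g => ext_ev fun p => by
        have hp := hW p (Y.2 p.2)
        have hr' : r ≠ 0 := by rintro rfl; simp at hr
        rw [ev_dirDer_eq hr v _ le_rfl (f + g) p (hat x₀ f + hat x₀ g) fun q hq hq' => by
          rw [Pi.add_apply, hat_chart x₀ ⟨q, hq⟩ hq', hat_chart x₀ ⟨q, hq⟩ hq', map_add],
          fderiv_add ((contDiffAt_hat x₀ p hp f).differentiableAt hr')
            ((contDiffAt_hat x₀ p hp g).differentiableAt hr'), map_add]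
        rfl
      map_smul' := fun c f => ext_ev fun p => by
        have hp := hW p (Y.2 p.2)
        have hr' : r ≠ 0 := by rintro rfl; simp at hr
        rw [ev_dirDer_eq hr v _ le_rfl (c • f) p (fun z => c * hat x₀ f z) fun q hq hq' => by
          rw [hat_chart x₀ ⟨q, hq⟩ hq', map_smul, smul_eq_mul],
          fderiv_const_mul ((contDiffAt_hat x₀ p hp f).differentiableAt hr'), map_smul]
        rfl }
    fun f g => ext_ev fun p => by
      have hp := hW p (Y.2 p.2)
      have hr' : r ≠ 0 := by rintro rfl; simp at hr
      refine (ev_dirDer_eq hr v (fun p hp => hW p (Y.2 hp)) le_rfl (f * g) p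
        (hat x₀ f * hat x₀ g) fun q hq hq' => by
          rw [Pi.mul_apply, hat_chart x₀ ⟨q, hq⟩ hq', hat_chart x₀ ⟨q, hq⟩ hq', map_mul]).trans ?_
      rw [fderiv_mul ((contDiffAt_hat x₀ p hp f).differentiableAt hr')
            ((contDiffAt_hat x₀ p hp g).differentiableAt hr'), map_add, smul_eq_mul, smul_eq_mul,
            map_mul, map_mul, ← hat_chart x₀ p hp f, ← hat_chart x₀ p hp g]
      rfl,
  fun Y Y' h h' f => ext_ev fun p => by
    refine ev_dirDer_eq hr v (fun p hp => hW p (h hp)) h' f p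
      (hat x₀ ((funSheaf 𝕜 E M r).res h' f)) fun q hq hq' => ?_
    rw [hat_chart x₀ ⟨q, hq⟩ hq']
    rfl⟩

/-- The linear coordinates on the model space define coordinates on the domain of a chart. By
Hadamard's lemma, a vector field is determined at every point by its values on the coordinates. -/
theorem FunSec.hasCoords (hr : r + 1 ≤ r) (hE : HadamardLemma 𝕜 E r) {n : ℕ}
    (l : Fin n → E →L[𝕜] 𝕜) (e : Fin n → E) (hl : ∀ v, v = ∑ i, l i v • e i)
    (hle : ∀ i j, l j (e i) = if i = j then 1 else 0) :
    HasCoords (funSheaf 𝕜 E M r) := by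
  intro V x₀ hx₀
  let W : Opens M := V ⊓ ⟨(chartAt E x₀).source, (chartAt E x₀).open_source⟩
  have hW : ∀ p ∈ W, p ∈ (chartAt E x₀).source := fun p hp => hp.2
  let x : Fin n → (funSheaf 𝕜 E M r).sec W := fun i =>
    mk (fun p => algebraMap 𝕜 ℂ (l i (chartAt E x₀ p)))
      (contMDiff_comp_chart x₀ hW (fun z => algebraMap 𝕜 ℂ (l i z)) fun p hp =>
        ((algebraMapCLM 𝕜 ℂ).contDiff.comp (l i).contDiff).contDiffAt)
  -- The expansion of a function at `p`, from Hadamard's lemma.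
  have hexp : ∀ {Y : Opens M} (hY : Y ≤ W) (f : (funSheaf 𝕜 E M r).sec Y) (p : Y),
      ∃ (Y' : Opens M) (h' : Y' ≤ Y) (_ : p.1 ∈ Y') (g : Fin n → (funSheaf 𝕜 E M r).sec Y'),
        (funSheaf 𝕜 E M r).res h' f = algebraMap ℂ _ (ev p f) + ∑ i,
          ((funSheaf 𝕜 E M r).res (h'.trans hY) (x i) -
            algebraMap ℂ _ (ev ⟨p.1, hY p.2⟩ (x i))) * g i := by
    intro Y hY f p
    have hYs : ∀ p ∈ Y, p ∈ (chartAt E x₀).source := fun p hp => hW p (hY hp)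
    obtain ⟨U', hU', hUo, hpU, G, hG, hGf⟩ := hE (hat x₀ f)
      ((chartAt E x₀).target ∩ (chartAt E x₀).symm ⁻¹' Y) (chartAt E x₀ p)
      ((chartAt E x₀).isOpen_inter_preimage_symm Y.isOpen)
      ⟨(chartAt E x₀).map_source (hYs p p.2), by
        rw [Set.mem_preimage, (chartAt E x₀).left_inv (hYs p p.2)]; exact p.2⟩
      (fun z hz => by
        have := contDiffAt_hat x₀ ⟨_, hz.2⟩ (hYs _ hz.2) f
        rw [(chartAt E x₀).right_inv hz.1] at this
        exact this.contDiffWithinAt)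
    let Y' : Opens M := ⟨(chartAt E x₀).source ∩ chartAt E x₀ ⁻¹' U',
      (chartAt E x₀).isOpen_inter_preimage hUo⟩
    have h' : Y' ≤ Y := fun q hq => by
      have := (hU' hq.2).2
      rwa [Set.mem_preimage, (chartAt E x₀).left_inv hq.1] at this
    refine ⟨Y', h', ⟨hYs p p.2, hpU⟩, fun i => mk (fun q => G (chartAt E x₀ q) (e i))
      (contMDiff_comp_chart x₀ (Y := Y') (fun p hp => hp.1) (fun z => G z (e i)) fun q hq =>
        (hG.contDiffAt (hUo.mem_nhds hq.2)).clm_apply contDiffAt_const), ext_ev fun q => ?_⟩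
    have e₁ := hGf _ q.2.2
    rw [hat_chart x₀ p (hYs _ p.2), hat_chart x₀ ⟨q.1, h' q.2⟩ q.2.1] at e₁
    rw [ev_res, e₁, map_add, AlgHom.commutes, map_sum]
    refine congrArg _ ?_
    conv_lhs => rw [hl (chartAt E x₀ q.1 - chartAt E x₀ p.1), map_sum]
    refine Finset.sum_congr rfl fun i _ => ?_
    rw [map_smul, map_mul, map_sub, map_sub, AlgHom.commutes, Algebra.smul_def, map_sub]
    rfl
  -- The value at `p` of a vector field on `f` depends linearly on its values on the coordinates.
  have hact : ∀ {Y Z : Opens M} (hZ : Z ≤ W) (hY : Y ≤ Z) (f : (funSheaf 𝕜 E M r).sec Y) (p : Y),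
      ∃ c : Fin n → ℂ, ∀ ξ : VF (funSheaf 𝕜 E M r) Z, ev p (VF.act (VF.res hY ξ) f) = ∑ i,
        ev ⟨p.1, hY p.2⟩ (VF.act ξ ((funSheaf 𝕜 E M r).res hZ (x i))) * c i := by
    intro Y Z hZ hY f p
    obtain ⟨Y', h', hp', g, hg⟩ := hexp (hY.trans hZ) f p
    refine ⟨fun i => ev ⟨p.1, hp'⟩ (g i), fun ξ => ?_⟩
    have e₀ : ∀ c : ℂ, VF.act (VF.res (h'.trans hY) ξ) (algebraMap ℂ _ c) = 0 := fun c =>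
      Derivation.map_algebraMap _ c
    have e₁ := congrArg (ev ⟨p.1, hp'⟩) (VF.res_act h' (VF.res hY ξ) f)
    rw [ev_res] at e₁
    rw [e₁, VF.res_res, hg, map_add, e₀, zero_add, map_sum, map_sum]
    refine Finset.sum_congr rfl fun i _ => ?_
    rw [VF.act_mul, map_sub, e₀, sub_zero, map_add, map_mul, map_mul, map_sub, AlgHom.commutes,
      ev_res, Algebra.algebraMap_self, RingHom.id_apply, sub_self, zero_mul, add_zero,
      ← (funSheaf 𝕜 E M r).res_res hZ (h'.trans hY), ← VF.res_act, ev_res]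
  have hdel : ∀ a b, VF.act (vf x₀ hr (e a) hW) (x b) = if a = b then 1 else 0 := by
    intro a b
    refine ext_ev fun p => (ev_dirDer_eq hr (e a) hW le_rfl (x b) p
      ((algebraMapCLM 𝕜 ℂ).comp (l b)) fun q hq hq' => rfl).trans ?_
    rw [ContinuousLinearMap.fderiv, ContinuousLinearMap.comp_apply, hle]
    split_ifs <;> simp
  refine ⟨W, inf_le_left, ⟨hx₀, mem_chart_source E x₀⟩,
    ⟨⟨n, x, fun i => vf x₀ hr (e i) hW, hdel, ?_⟩⟩⟩
  intro Z hZ ξ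
  refine VF.ext_act fun Y hY f => ext_ev fun p => ?_
  obtain ⟨c, hc⟩ := hact hZ hY f p
  rw [hc, hc]
  refine Finset.sum_congr rfl fun i _ => ?_
  congr 2
  have hs : ∀ (s : Finset (Fin n)) (h : Fin n → VF (funSheaf 𝕜 E M r) Z) (f),
      VF.act (∑ a ∈ s, h a) f = ∑ a ∈ s, VF.act (h a) f := by
    intro s h f
    induction s using Finset.cons_induction with
    | empty => rfl
    | cons a s ha ih => rw [Finset.sum_cons, Finset.sum_cons, VF.act_add, ih]
  rw [hs]
  simp only [VF.act_fsmul, ← VF.res_act, hdel]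
  rw [Finset.sum_eq_single i]
  · simp
  · intro b _ hb
    simp [hb]
  · simp

theorem hasCoords_funSheaf_euclidean {𝕜 : Type} [RCLike 𝕜] [NormedAlgebra 𝕜 ℂ] {n : ℕ}
    {M : Type u} [TopologicalSpace M] [ChartedSpace (EuclideanSpace 𝕜 (Fin n)) M]
    [IsManifold 𝓘(𝕜, EuclideanSpace 𝕜 (Fin n)) r M] (hr : r + 1 ≤ r)
    (hE : HadamardLemma 𝕜 (EuclideanSpace 𝕜 (Fin n)) r) :
    HasCoords (funSheaf 𝕜 (EuclideanSpace 𝕜 (Fin n)) M r) :=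
  FunSec.hasCoords hr hE (fun i => EuclideanSpace.proj i) (fun i => EuclideanSpace.single i 1)
    (fun v => by
      ext j
      simp [Pi.single_apply])
    (fun i j => by simp [Pi.single_apply, eq_comm])

end FunSheaf

end DRCourant
end

/-! ### Coordinates on smooth schemes -/

noncomputable section
namespace DRCourant

section Restriction

variable {X : Type u} [TopologicalSpace X] {O : AlgSheaf X} {W W' : Opens X}

/-- Restriction of coordinates to a smaller open set. -/
def Coords.res (C : Coords O W) (h : W' ≤ W) : Coords O W' where
  n := C.n
  x a := O.res h (C.x a)
  del a := VF.res h (C.del a)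
  act_del a b := by
    rw [← VF.res_act, C.act_del]
    split_ifs
    exacts [map_one _, map_zero _]
  eq_sum {Z} hZ ξ := by
    simp only [O.res_res, VF.res_res]
    exact C.eq_sum (hZ.trans h) ξ

end Restriction

section Localization

variable {k B C N : Type*} [CommRing k] [CommRing B] [CommRing C] [CommRing N] [Algebra k B]

/-- A derivation on a localization, relative to a homomorphism `φ`, vanishes if it vanishes on the
original ring. -/
theorem derivation_eq_zero_of_isLocalization [Algebra B C] (S : Submonoid B) [IsLocalization S C]
    (φ : C →+* N) (D : C →+ N) (hD : ∀ a b, D (a * b) = φ a * D b + φ b * D a)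
    (h : ∀ b : B, D (algebraMap B C b) = 0) (c : C) : D c = 0 := by
  obtain ⟨⟨b, s⟩, e⟩ := IsLocalization.surj S c
  have e' := congrArg D e
  rw [hD, h, h, mul_zero, zero_add] at e'
  exact ((IsLocalization.map_units C s).map φ).mul_right_eq_zero.1 e'

/-- A derivation of a ring extends to every localization. -/
theorem exists_derivation_of_isLocalization [Algebra k C] [Algebra B C] [IsScalarTower k B C]
    (S : Submonoid B) [IsLocalization S C] (D : Derivation k B B) :
    ∃ D' : Derivation k C C, ∀ b, D' (algebraMap B C b) = algebraMap B C (D b) := by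
  have : Algebra.FormallyEtale B C := .of_isLocalization S
  have hb := KaehlerDifferential.isBaseChange_of_formallyEtale k B C
  let L : Ω[B⁄k] →ₗ[B] C := Algebra.linearMap B C ∘ₗ D.liftKaehlerDifferential
  refine ⟨(hb.lift L).compDer (KaehlerDifferential.D k C), fun b => ?_⟩
  have e := hb.lift_eq L (KaehlerDifferential.D k B b)
  rw [KaehlerDifferential.map_D] at e
  refine e.trans ?_
  simp [L]

/-- A standard smooth algebra has coordinates `x a`, with dual derivations `∂ a`, which determine
derivations relative to any homomorphism `φ`. -/
theorem exists_coords_of_isStandardSmooth {k : Type} {B : Type u} [CommRing k] [CommRing B]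
    [Algebra k B] [Algebra.IsStandardSmooth k B] :
    ∃ (n : ℕ) (x : Fin n → B) (del : Fin n → Derivation k B B),
      (∀ a b, del a (x b) = if a = b then 1 else 0) ∧
      ∀ {N : Type u} [CommRing N] (φ : B →+* N) (D : B →+ N)
        (_ : ∀ a b, D (a * b) = φ a * D b + φ b * D a)
        (_ : ∀ c : k, D (algebraMap k B c) = 0) (_ : ∀ a, D (x a) = 0) (b : B), D b = 0 := by
  obtain ⟨ι, σ, _, _, ⟨P⟩⟩ := Algebra.IsStandardSmooth.out (R := k) (S := B)
  obtain ⟨n, ⟨e⟩⟩ := Finite.exists_equiv_fin ((Set.range P.map)ᶜ : Set ι)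
  let bas := P.basisKaehler.reindex e
  have hbas : ∀ a, bas a = KaehlerDifferential.D k B (P.val (e.symm a)) := fun a => by
    simp [bas]
  refine ⟨n, fun a => P.val (e.symm a), fun a => (bas.coord a).compDer (KaehlerDifferential.D k B),
    fun a b => ?_, fun {N} _ φ D hD hc hx => ?_⟩
  · change bas.coord a (KaehlerDifferential.D k B (P.val (e.symm b))) = _
    rw [← hbas, Module.Basis.coord_apply,
      Module.Basis.repr_self, Finsupp.single_apply]
    simp only [eq_comm]
  · let : Algebra B N := φ.toAlgebra
    let : Algebra k N := (φ.comp (algebraMap k B)).toAlgebra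
    have : IsScalarTower k B N := .of_algebraMap_eq fun _ => rfl
    let D' : Derivation k B N := Derivation.mk'
      { D with
        map_smul' := fun c b => by
          change D (c • b) = c • D b
          rw [Algebra.smul_def, hD, hc, mul_zero, add_zero]
          rfl } fun a b => hD a b
    have h0 : D'.liftKaehlerDifferential = 0 := bas.ext fun a => by
      rw [hbas, Derivation.liftKaehlerDifferential_comp_D]
      exact hx a
    intro b
    have := D'.liftKaehlerDifferential_comp_D b
    rw [h0] at this
    exact this.symm

end Localization

section Basis

variable {X : Type u} [TopologicalSpace X] {O : AlgSheaf X} {W : Opens X} {ι : Type u}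
  {U : ι → Opens X}

/-- Functions are determined by their restrictions to the members of a basis of the topology. -/
theorem AlgSheaf.ext_of_basis (hU : ∀ Z ≤ W, ∀ x ∈ Z, ∃ i, x ∈ U i ∧ U i ≤ Z) {Z : Opens X}
    (hZ : Z ≤ W) {f g : O.sec Z} (h : ∀ i (hi : U i ≤ Z), O.res hi f = O.res hi g) : f = g := by
  refine (O.glue Z {i // U i ≤ Z} (fun i => U i.1) (fun i => i.2) (fun x hx => ?_)
    (fun i => O.res i.2 f) fun a b T ha hb => ?_).unique (fun i => rfl) fun i => (h i.1 i.2).symm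
  · obtain ⟨i, hi, hi'⟩ := hU Z hZ x hx
    exact ⟨⟨i, hi'⟩, hi⟩
  · change O.res ha (O.res a.2 f) = O.res hb (O.res b.2 f)
    rw [O.res_res, O.res_res]

/-- A compatible family of derivations of the functions on the members of a basis of the topology
extends to a vector field. -/
theorem VF.exists_of_basis (hU : ∀ Z ≤ W, ∀ x ∈ Z, ∃ i, x ∈ U i ∧ U i ≤ Z)
    (D : ∀ i, Derivation ℂ (O.sec (U i)) (O.sec (U i)))
    (hD : ∀ i j (h : U j ≤ U i) (f : O.sec (U i)), O.res h (D i f) = D j (O.res h f)) :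
    ∃ ξ : VF O W, ∀ (Z : Opens X) (hZ : Z ≤ W) (f : O.sec Z) i (hi : U i ≤ Z),
      O.res hi (VF.act (VF.res hZ ξ) f) = D i (O.res hi f) := by
  have key : ∀ (Z : Set.Iic W) (f : O.sec Z), ∃ t : O.sec Z, ∀ i (hi : U i ≤ Z),
      O.res hi t = D i (O.res hi f) := by
    rintro ⟨Z, hZ⟩ f
    obtain ⟨t, ht, -⟩ := O.glue Z {i // U i ≤ Z} (fun i => U i.1) (fun i => i.2) (fun x hx => by
        obtain ⟨i, hi, hi'⟩ := hU Z hZ x hx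
        exact ⟨⟨i, hi'⟩, hi⟩)
      (fun i => D i.1 (O.res i.2 f)) fun a b T ha hb => by
        refine AlgSheaf.ext_of_basis hU ((ha.trans a.2).trans hZ) fun i hi => ?_
        rw [O.res_res, O.res_res, hD, hD, O.res_res, O.res_res]
    exact ⟨t, fun i hi => ht ⟨i, hi⟩⟩
  choose t ht using key
  refine ⟨⟨fun Z => Derivation.mk'
    { toFun := t Z
      map_add' := fun f g => AlgSheaf.ext_of_basis hU Z.2 fun i hi => by
        rw [map_add, ht, ht, ht, map_add, map_add]
      map_smul' := fun c f => AlgSheaf.ext_of_basis hU Z.2 fun i hi => by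
        rw [map_smul, ht, ht, map_smul, Derivation.map_smul]; rfl }
    fun f g => AlgSheaf.ext_of_basis hU Z.2 fun i hi => by
      change O.res hi (t Z (f * g)) = O.res hi (f * t Z g + g * t Z f)
      rw [map_add, map_mul, map_mul, ht, ht, ht, map_mul, Derivation.leibniz]
      rfl, fun Z Z' hZ hZ' f => AlgSheaf.ext_of_basis hU (hZ'.trans hZ) fun i hi => ?_⟩,
    fun Z hZ f i hi => ht ⟨Z, hZ⟩ f i hi⟩
  change O.res hi (O.res hZ' (t ⟨Z, hZ⟩ f)) = O.res hi (t ⟨Z', hZ'.trans hZ⟩ (O.res hZ' f))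
  rw [O.res_res]
  exact (ht ⟨Z, hZ⟩ f i (hi.trans hZ')).trans (by
    rw [ht ⟨Z', hZ'.trans hZ⟩ (O.res hZ' f) i hi, O.res_res])

end Basis

section Affine

variable {X : Type u} [TopologicalSpace X] {O : AlgSheaf X} {W : Opens X}

/-- Coordinates on an open set `W` on which functions form a standard smooth algebra, and whose
topology has a basis of open sets `D g` on which functions are the localizations at `g`. -/
theorem nonempty_coords_of_isStandardSmooth [Algebra.IsStandardSmooth ℂ (O.sec W)]
    (D : O.sec W → Opens X) (hDW : ∀ g, D g ≤ W)
    (hD : ∀ Z ≤ W, ∀ x ∈ Z, ∃ g, x ∈ D g ∧ D g ≤ Z)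
    (hloc : ∀ g, @IsLocalization.Away _ _ g (O.sec (D g)) _ (O.res (hDW g)).toRingHom.toAlgebra) :
    Nonempty (Coords O W) := by
  obtain ⟨n, x, del, hdel, huniq⟩ := exists_coords_of_isStandardSmooth (k := ℂ) (B := O.sec W)
  -- The dual derivations extend to the localizations, and hence to vector fields on `W`.
  have hext : ∀ g (a : Fin n), ∃ D' : Derivation ℂ (O.sec (D g)) (O.sec (D g)),
      ∀ b, D' (O.res (hDW g) b) = O.res (hDW g) (del a b) := fun g a => by
    let := (O.res (hDW g)).toRingHom.toAlgebra
    have := hloc g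
    have : IsScalarTower ℂ (O.sec W) (O.sec (D g)) :=
      .of_algebraMap_eq fun c => ((O.res (hDW g)).commutes c).symm
    exact exists_derivation_of_isLocalization (.powers g) (del a)
  choose D' hD' using hext
  have hzero : ∀ g {N : Type u} [CommRing N] (φ : O.sec (D g) →+* N) (F : O.sec (D g) →+ N)
      (_ : ∀ a b, F (a * b) = φ a * F b + φ b * F a) (_ : ∀ b, F (O.res (hDW g) b) = 0) (c),
      F c = 0 := fun g {N} _ φ F hF h0 c => by
    let := (O.res (hDW g)).toRingHom.toAlgebra
    have := hloc g
    exact derivation_eq_zero_of_isLocalization (.powers g) φ F hF h0 c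
  have hξ := fun a => VF.exists_of_basis hD (fun g => D' g a) fun g g' h f => by
    have := hzero g (O.res h).toRingHom
      ((O.res h).toAddMonoidHom.comp (D' g a).toAddMonoidHom -
        (D' g' a).toAddMonoidHom.comp (O.res h).toAddMonoidHom)
      (fun b c => by
        change O.res h (D' g a (b * c)) - D' g' a (O.res h (b * c)) =
          O.res h b * (O.res h (D' g a c) - D' g' a (O.res h c)) +
          O.res h c * (O.res h (D' g a b) - D' g' a (O.res h b))
        simp only [map_mul, Derivation.leibniz, smul_eq_mul, map_add]
        ring)
      (fun b => by
        change O.res h (D' g a (O.res _ b)) - D' g' a (O.res h (O.res _ b)) = 0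
        rw [hD', O.res_res, O.res_res, hD', sub_self]) f
    exact sub_eq_zero.1 this
  choose ξ hξ using hξ
  have hact : ∀ a b, VF.act (ξ a) (x b) = if a = b then 1 else 0 := fun a b =>
    AlgSheaf.ext_of_basis hD le_rfl fun g hg => by
      rw [← hdel a b]
      exact (hξ a W le_rfl (x b) g hg).trans (hD' g a (x b))
  refine ⟨n, x, ξ, hact, fun {Z} hZ η => ?_⟩
  have hs : ∀ {Z : Opens X} (s : Finset (Fin n)) (h : Fin n → VF O Z) (f),
      VF.act (∑ a ∈ s, h a) f = ∑ a ∈ s, VF.act (h a) f := by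
    intro Z s h f
    induction s using Finset.cons_induction with
    | empty => rfl
    | cons a s ha ih => rw [Finset.sum_cons, Finset.sum_cons, VF.act_add, ih]
  rw [← sub_eq_zero]
  -- The difference `θ` of `η` and its expansion kills the coordinates, hence the functions on `W`,
  -- hence those on the basic open sets.
  set θ : VF O Z := η - ∑ a, VF.fsmul (VF.act η (O.res hZ (x a))) (VF.res hZ (ξ a)) with hθ
  have hθx : ∀ b, VF.act θ (O.res hZ (x b)) = 0 := fun b => by
    have : VF.act θ (O.res hZ (x b)) = VF.act η (O.res hZ (x b)) -
      VF.act (∑ a, VF.fsmul (VF.act η (O.res hZ (x a))) (VF.res hZ (ξ a))) (O.res hZ (x b)) := rfl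
    rw [this, hs, Finset.sum_eq_single b]
    · rw [VF.act_fsmul, ← VF.res_act, hact, if_pos rfl, map_one, mul_one, sub_self]
    · intro a _ ha
      rw [VF.act_fsmul, ← VF.res_act, hact, if_neg ha, map_zero, mul_zero]
    · simp
  clear_value θ
  refine VF.ext_act fun Y hY f => AlgSheaf.ext_of_basis hD (hY.trans hZ) fun g hg => ?_
  rw [VF.res_act hg, VF.res_res]
  rw [show O.res hg (VF.act (VF.res hY (0 : VF O Z)) f) = 0 from map_zero (O.res hg)]
  refine hzero g (RingHom.id _) (VF.act (VF.res (hg.trans hY) θ)).toAddMonoidHom (fun a b => ?_)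
    (fun b => ?_) _
  · change VF.act _ (a * b) = a * VF.act _ b + b * VF.act _ a
    rw [VF.act_mul]; ring
  · refine huniq (O.res (hDW g)).toRingHom ((VF.act (VF.res (hg.trans hY) θ)).toAddMonoidHom.comp
      (O.res (hDW g)).toAddMonoidHom) (fun a b => ?_) (fun c => ?_) (fun a => ?_) b
    · change VF.act _ (O.res _ (a * b)) = O.res (hDW g) a * VF.act _ (O.res _ b) +
        O.res (hDW g) b * VF.act _ (O.res _ a)
      rw [map_mul, VF.act_mul]; ring
    · change VF.act _ (O.res _ (algebraMap ℂ _ c)) = 0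
      rw [AlgHom.commutes]
      exact Derivation.map_algebraMap _ c
    · change VF.act _ (O.res (hDW g) (x a)) = 0
      rw [← O.res_res hZ (hg.trans hY), ← VF.res_act, hθx, map_zero]

end Affine

section Scheme

open AlgebraicGeometry

variable {X : Scheme.{u}} (f : X ⟶ Spec (CommRingCat.of (ULift.{u} ℂ)))

/-- The locally standard smooth charts of a smooth morphism to the spectrum of `ℂ` are standard smooth
algebras over `ℂ`. -/
theorem isStandardSmooth_schemeAlgebraMap {U : (Spec (CommRingCat.of (ULift.{u} ℂ))).Opens}
    {V : X.Opens} (hUV : V ≤ f ⁻¹ᵁ U) (hV : (V : Set X).Nonempty)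
    (h : (f.appLE U V hUV).hom.IsStandardSmooth) : (schemeAlgebraMap X f V).IsStandardSmooth := by
  -- The spectrum of a field is a point, so `U` is everything.
  have hU : U = ⊤ := by
    obtain ⟨x, hx⟩ := hV
    have : Subsingleton (PrimeSpectrum (ULift.{u} ℂ)) := inferInstance
    refine top_le_iff.1 fun y _ => ?_
    have e : y = f x := this.elim _ _
    rw [e]
    exact hUV hx
  subst hU
  refine h.comp (RingHom.IsStandardSmooth.comp (g := (Scheme.ΓSpecIso
    (CommRingCat.of (ULift.{u} ℂ))).inv.hom) ?_ ?_)
  · exact RingHom.IsStandardSmoothOfRelativeDimension.isStandardSmooth 0 _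
      (RingHom.IsStandardSmoothOfRelativeDimension.equiv
        (Scheme.ΓSpecIso (CommRingCat.of (ULift.{u} ℂ))).symm.commRingCatIsoToRingEquiv)
  · exact RingHom.IsStandardSmoothOfRelativeDimension.isStandardSmooth 0 _
      (RingHom.IsStandardSmoothOfRelativeDimension.equiv (ULift.ringEquiv (R := ℂ)).symm)

theorem hasCoords_schemeSheaf [Smooth f] : HasCoords (schemeSheaf X f) := by
  intro V x hx
  obtain ⟨U, hU, W, hW, hxW, hUW, hst⟩ := Smooth.exists_isStandardSmooth f x
  have : Algebra.IsStandardSmooth ℂ ((schemeSheaf X f).sec W) :=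
    isStandardSmooth_schemeAlgebraMap f hUW ⟨x, hxW⟩ hst
  obtain ⟨C⟩ := nonempty_coords_of_isStandardSmooth (O := schemeSheaf X f) (W := W)
    (fun g => X.basicOpen (U := W) g) (fun g => X.basicOpen_le g)
    (fun Z hZ x hx => by
      obtain ⟨g, hg, hxg⟩ := hW.exists_basicOpen_le ⟨x, hx⟩ (hZ hx)
      exact ⟨g, hxg, hg⟩)
    (fun g => hW.isLocalization_basicOpen g)
  exact ⟨V ⊓ W, inf_le_left, ⟨hx, hxW⟩, ⟨C.res inf_le_right⟩⟩

end Scheme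

end DRCourant
end

/-! ### Existence and uniqueness of flat connections -/

open scoped _root_.Manifold ContDiff in
/-- Smooth manifolds, complex manifolds and smooth varieties have local coordinates. -/
theorem DRCourant.hasCoords_structureSheaf :
    ∀ X : DRCourant.Manifold.{u}, DRCourant.HasCoords X.structureSheaf
  | @DRCourant.Manifold.smooth n M _ _ _ => DRCourant.hasCoords_funSheaf_euclidean (𝕜 := ℝ) (n := n)
      (M := M) (r := ∞) le_rfl DRCourant.hadamardLemma_smooth
  | @DRCourant.Manifold.complex n M _ _ _ => DRCourant.hasCoords_funSheaf_euclidean (𝕜 := ℂ) (n := n)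
      (M := M) (r := ω) le_rfl DRCourant.hadamardLemma_analytic
  | @DRCourant.Manifold.algebraic _ f _ => DRCourant.hasCoords_schemeSheaf f

theorem mainTheorem5 (X : DRCourant.Manifold.{u}) :
    (∀ (U : Opens X.carrier) (Q : DRCourant.CourantAlgebroid X.sharp U), Q.IsExact →
      Nonempty (Unique Q.FlatConnection)) ∧
    (DRCourant.ECA X.sharp).IsStack (Opens.grothendieckTopology X.carrier) ∧
    DRCourant.AreEquivalent (DRCourant.ECA X.sharp) (DRCourant.finalStack X.carrier) := by
  have hA : DRCourant.HasFrames X.sharp := (DRCourant.hasCoords_structureSheaf X).hasFrames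
  exact ⟨fun U Q hQ => DRCourant.CourantAlgebroid.nonempty_unique_flatConnection hA hQ,
    DRCourant.isStack_and_areEquivalent X.sharp fun U => DRCourant.isContractible_exactCA hA U⟩
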